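/- Let $n\ge 2$, let $\sigma_{n-1}=2\pi^{n/2}/\Gamma(n/2)$ be the area of $S^{n-1}\subset\mathbb R^n$, and write $\theta=(\theta',\theta_{n+1})$ for $\theta\in\mathbb R^{n+1}=\mathbb R^n\oplus\mathbb R e_{n+1}$. For a hyperplane $\tau=\tau(\eta,t)=\{x\in\mathbb R^n: x\cdot\eta=t\}$ ($\eta\in S^{n-1}$, $t\in\mathbb R$, $|\tau|=|t|$) let $$(Rg)(\tau)=(Rg)(\eta,t)=\int_{\eta^\perp}g(t\eta+y)\,dy,$$ let $(F f)(\theta)=\int_{S^n\cap\theta^\perp}f\,d_\theta\sigma$ be the Funk transform, where $d_\theta\sigma$ is the rotation invariant probability measure on $S^n\cap\theta^\perp$, and let $L^1_{even}(S^n)$ be the space of even integrable functions on $S^n$. Put $$\mu(x)=\frac{x+e_{n+1}}{|x+e_{n+1}|},\qquad \tilde\mu(\tau(\eta,t))=-\eta\cos\alpha+e_{n+1}\sin\alpha,\quad \tan\alpha=t,$$ (determined up to sign by $\tau$, and used only in even functions), so that $\tilde\mu^{-1}(\omega)=\tau(-\omega'/|\omega'|,\ \omega_{n+1}/|\omega'|)$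 for $\omega'\ne0$, and $$(Af)(\tau)=\frac{\sigma_{n-1}}{2\sqrt{1+|\tau|^2}}\,f(\tilde\mu(\tau)),\qquad (Bg)(\theta)=\frac1{|\theta_{n+1}|^{n}}\,g\Big(\frac{\theta'}{\theta_{n+1}}\Big)\ (\theta_{n+1}\neq0),$$ $$(A^{-1}h)(\omega)=\frac{2}{\sigma_{n-1}|\omega'|}\,h(\tilde\mu^{-1}(\omega))\ (\omega'\ne0),\qquad (B^{-1}f)(x)=(1+|x|^2)^{-n/2}f(\mu(x)).$$ Let $g$ be a measurable (real or complex valued) function on $\mathbb R^n$ with $$\int_{\mathbb R^n}\frac{|g(x)|}{\sqrt{1+|x|^2}}\,dx<\infty .$$ Then: 1. $Bg\in L^1_{even}(S^n)$. 2. For every hyperplane $\tau$, $g$ is integrable over $\tau$ if and only if $Bg$ is integrable over $S^n\cap\tilde\mu(\tau)^\perp$, and in that case $(Rg)(\tau)=(AFBg)(\tau)$. 3. $(Rg)(\tau)$ exists as a Lebesgue integral for almost all $\tau$. 4. $g=B^{-1}F^{-1}A^{-1}Rg$ almost everywhere on $\mathbb R^n$. Here $f=F^{-1}\varphi$, for $\varphi=A^{-1}Rg$,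 is the unique $f\in L^1_{even}(S^n)$ with $Ff=\varphi$ a.e., and it is evaluated explicitly as follows. Let $$\Phi_\theta(s)=\frac1{\sigma_{n-1}}\int_{S^n\cap\theta^\perp}\varphi\big(s\sigma+\sqrt{1-s^2}\,\theta\big)\,d\sigma,\qquad 0<s<1,$$ where $d\sigma$ is the surface measure of $S^n\cap\theta^\perp$. Then $$f(\theta)=\lim_{t\to1^-}\Big(\frac1{2t}\frac{\partial}{\partial t}\Big)^{n-1}\Big[\frac{2^{n-1}}{(n-2)!}\int_0^t(t^2-s^2)^{(n-3)/2}\,\Phi_\theta(s)\,s^{n-1}\,ds\Big],$$ $$f(\theta)=\lim_{t\to1^-}\Big(\frac{\partial}{\partial t}\Big)^{n-1}\Big[\frac{1}{(n-2)!}\int_0^t(t^2-s^2)^{(n-3)/2}\,\Phi_\theta(s)\,s\,ds\Big],$$ and, if $n$ is odd, $$f(\theta)=\lim_{t\to1^-}\frac{\pi^{1/2}}{\Gamma(n/2)}\Big(\frac1{2t}\frac{\partial}{\partial t}\Big)^{(n-1)/2}\big[t^{n-2}\Phi_\theta(t)\big].$$ In these formulas the integrals converge absolutely for almost all values of the parameters,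 the expressions in brackets are continuously differentiable functions of $t\in(0,1)$ with values in $L^1(S^n)$, up to the order of differentiation that is used, and derivatives and limits are taken in the norm of $L^1(S^n)$. -/

import Mathlib

open MeasureTheory Set Filter Topology

open scoped RealInnerProductSpace

noncomputable section

namespace FunkRadon

/-- The Euclidean space `ℝⁿ`. -/
abbrev E (n : ℕ) : Type := EuclideanSpace ℝ (Fin n)

/-- The unit sphere `Sⁿ⁻¹` of `ℝⁿ`. A function on this sphere is given below by a function on `ℝⁿ`
of which only the values at unit vectors are used. -/
abbrev Sph (n : ℕ) : Set (E n) := Metric.sphere (0 : E n) 1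

/-- The surface measure on `Sⁿ⁻¹ ⊂ ℝⁿ` (not normalized). -/
def sphMeasure (n : ℕ) : Measure (Sph n) := (volume : Measure (E n)).toSphere

/-- The area `σₙ₋₁` of the unit sphere `Sⁿ⁻¹ ⊂ ℝⁿ`. -/
def sphArea (n : ℕ) : ℝ := 2 * Real.pi ^ ((n : ℝ) / 2) / Real.Gamma ((n : ℝ) / 2)

/-- The hyperplane through the origin orthogonal to `θ`. -/
abbrev perp {d : ℕ} (θ : E d) : Submodule ℝ (E d) := (Submodule.span ℝ {θ})ᗮ

/-- The unit sphere of `θ^⊥`, that is `Sⁿ ∩ θ^⊥` when `θ ∈ Sⁿ ⊂ ℝⁿ⁺¹`. -/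
abbrev GreatSph {d : ℕ} (θ : E d) : Set (perp θ) := Metric.sphere (0 : perp θ) 1

/-- The surface measure on `Sⁿ ∩ θ^⊥` (not normalized). -/
def greatMeasure {d : ℕ} (θ : E d) : Measure (GreatSph θ) := (volume : Measure (perp θ)).toSphere

/-- The point `(x, c)` of `ℝⁿ⁺¹ = ℝⁿ ⊕ ℝ eₙ₊₁`. -/
def lift {n : ℕ} (x : E n) (c : ℝ) : E (n + 1) :=
  WithLp.toLp 2 (Fin.snoc (α := fun _ => ℝ) (fun i => x i) c)

/-- `θ' = (θ₁, …, θₙ)` for `θ ∈ ℝⁿ⁺¹`. -/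
def head {n : ℕ} (θ : E (n + 1)) : E n := WithLp.toLp 2 (fun i => θ (Fin.castSucc i))

/-- The last coordinate `θₙ₊₁`. -/
def last {n : ℕ} (θ : E (n + 1)) : ℝ := θ (Fin.last n)

variable {𝕜 : Type*} [RCLike 𝕜]

/-- `g` is integrable over the hyperplane `τ(η, t) = {x : x · η = t}`. -/
def PlaneIntegrable {n : ℕ} (g : E n → 𝕜) (η : E n) (t : ℝ) : Prop :=
  Integrable (fun y : perp η => g (t • η + (y : E n))) volume

/-- The hyperplane Radon transform `(Rg)(η, t) = ∫_{η^⊥} g(tη + y) dy`. -/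
def radon {n : ℕ} (g : E n → 𝕜) (η : E n) (t : ℝ) : 𝕜 :=
  ∫ y : perp η, g (t • η + (y : E n))

/-- `f` is integrable over the great sphere `Sⁿ ∩ θ^⊥`. -/
def GreatIntegrable {d : ℕ} (f : E d → 𝕜) (θ : E d) : Prop :=
  Integrable (fun ξ : GreatSph θ => f ((ξ : perp θ) : E d)) (greatMeasure θ)

/-- The Funk transform: the mean of `f` over `Sⁿ ∩ θ^⊥`. -/
def funk {d : ℕ} (f : E d → 𝕜) (θ : E d) : 𝕜 :=
  ⨍ ξ : GreatSph θ, f ((ξ : perp θ) : E d) ∂(greatMeasure θ)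

/-- Membership in `L¹_even` of the unit sphere. -/
def L1Even {d : ℕ} (f : E d → 𝕜) : Prop :=
  Integrable (fun θ : Sph d => f θ) (sphMeasure d) ∧
    ∀ᵐ θ : Sph d ∂(sphMeasure d), f (-(θ : E d)) = f θ

/-- `μ(x) = (x + eₙ₊₁) / |x + eₙ₊₁|`. -/
def mu {n : ℕ} (x : E n) : E (n + 1) := ‖lift x 1‖⁻¹ • lift x 1

/-- `μ̃(τ(η, t)) = -η cos α + eₙ₊₁ sin α`, `tan α = t`. For `t < 0` this is the antipode of the point
obtained from the parameters `(-η, -t)` of the same hyperplane, and it is inserted only in even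
functions. -/
def muTilde {n : ℕ} (η : E n) (t : ℝ) : E (n + 1) :=
  lift (-(Real.cos (Real.arctan t) • η)) (Real.sin (Real.arctan t))

/-- `(Af)(τ) = σₙ₋₁ / (2 √(1 + |τ|²)) f(μ̃(τ))`; here `|τ(η, t)| = |t|`. -/
def opA {n : ℕ} (f : E (n + 1) → 𝕜) (η : E n) (t : ℝ) : 𝕜 :=
  (sphArea n / (2 * √(1 + t ^ 2))) • f (muTilde η t)

/-- `(Bg)(θ) = |θₙ₊₁|⁻ⁿ g(θ' / θₙ₊₁)`, `θₙ₊₁ ≠ 0`. -/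
def opB {n : ℕ} (g : E n → 𝕜) (θ : E (n + 1)) : 𝕜 :=
  (|last θ| ^ n)⁻¹ • g ((last θ)⁻¹ • head θ)

/-- `(A⁻¹h)(ω) = 2 / (σₙ₋₁ |ω'|) h(μ̃⁻¹(ω))`, `ω' ≠ 0`, where
`μ̃⁻¹(ω) = τ(-ω' / |ω'|, ωₙ₊₁ / |ω'|)`. -/
def opAinv {n : ℕ} (h : E n → ℝ → 𝕜) (ω : E (n + 1)) : 𝕜 :=
  (2 / (sphArea n * ‖head ω‖)) • h (-(‖head ω‖⁻¹ • head ω)) (last ω / ‖head ω‖)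

/-- `(B⁻¹f)(x) = (1 + |x|²)^{-n/2} f(μ(x))`. -/
def opBinv {n : ℕ} (f : E (n + 1) → 𝕜) (x : E n) : 𝕜 :=
  ((1 + ‖x‖ ^ 2) ^ (-(n : ℝ) / 2)) • f (mu x)

/-! ### Evaluation of the inverse Funk transform -/

/-- The integrand of `Φ_θ(s)`: the value of `φ` at `sξ + √(1 - s²) θ`, `ξ ∈ Sⁿ ∩ θ^⊥`. -/
def capPoint {d : ℕ} (φ : E d → 𝕜) (θ : E d) (s : ℝ) (ξ : GreatSph θ) : 𝕜 :=
  φ (s • ((ξ : perp θ) : E d) + √(1 - s ^ 2) • θ)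

/-- `Φ_θ(s)`, the mean of `φ` over the points `sξ + √(1 - s²) θ`, `ξ ∈ Sⁿ ∩ θ^⊥`. -/
def capMean {d : ℕ} (φ : E d → 𝕜) (θ : E d) (s : ℝ) : 𝕜 :=
  ⨍ ξ : GreatSph θ, capPoint φ θ s ξ ∂(greatMeasure θ)

/-- The operator `1/(2t) d/dt`. -/
def derivSq {X : Type*} [NormedAddCommGroup X] [NormedSpace ℝ X] (w : ℝ → X) (t : ℝ) : X :=
  (1 / (2 * t)) • deriv w t

/-- For a family `w(θ, t)`, `0 < t < 1`, and a differential operator `D` of order one in `t`: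
`f = lim_{t → 1-} D^m w(·, t)`, where derivatives and limit are understood in the norm of `L¹`
of the unit sphere. It is part of the assertion that `w(·, t)` belongs to `L¹` and is `m` times
continuously differentiable in `t` as an `L¹`-valued function. -/
def HasL1Limit {d : ℕ} (m : ℕ)
    (D : (ℝ → Lp 𝕜 1 (sphMeasure d)) → ℝ → Lp 𝕜 1 (sphMeasure d))
    (w : E d → ℝ → 𝕜) (f : E d → 𝕜) : Prop :=
  ∃ (W : ℝ → Lp 𝕜 1 (sphMeasure d)) (L : Lp 𝕜 1 (sphMeasure d)),
    (∀ t ∈ Ioo (0 : ℝ) 1, ∀ᵐ θ : Sph d ∂(sphMeasure d), W t θ = w θ t) ∧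
    (∀ᵐ θ : Sph d ∂(sphMeasure d), L θ = f θ) ∧
    ContDiffOn ℝ m W (Ioo (0 : ℝ) 1) ∧
    Tendsto (D^[m] W) (𝓝[<] 1) (𝓝 L)

/-- The first formula for `f = F⁻¹φ` on `Sⁿ`:
`f(θ) = lim_{t → 1} (1/(2t) ∂/∂t)ⁿ⁻¹ [2ⁿ⁻¹/(n-2)! ∫₀ᵗ (t² - s²)^{(n-3)/2} Φ_θ(s) sⁿ⁻¹ ds]`,
all integrals being absolutely convergent for almost all values of the parameters. -/
def FunkInversionI (n : ℕ) (φ f : E (n + 1) → 𝕜) : Prop :=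
  (∀ᵐ θ : Sph (n + 1) ∂(sphMeasure (n + 1)), ∀ᵐ s : ℝ, s ∈ Ioo (0 : ℝ) 1 →
    Integrable (capPoint φ (θ : E (n + 1)) s) (greatMeasure (θ : E (n + 1)))) ∧
  (∀ t ∈ Ioo (0 : ℝ) 1, ∀ᵐ θ : Sph (n + 1) ∂(sphMeasure (n + 1)),
    IntervalIntegrable
      (fun s => ((t ^ 2 - s ^ 2) ^ (((n : ℝ) - 3) / 2) * s ^ (n - 1)) •
        capMean φ (θ : E (n + 1)) s) volume 0 t) ∧
  HasL1Limit (n - 1) derivSq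
    (fun θ t => ((2 : ℝ) ^ (n - 1) / (Nat.factorial (n - 2) : ℝ)) •
      ∫ s in (0 : ℝ)..t, ((t ^ 2 - s ^ 2) ^ (((n : ℝ) - 3) / 2) * s ^ (n - 1)) •
        capMean φ θ s) f

/-- The second formula for `f = F⁻¹φ` on `Sⁿ`, `n` odd:
`f(θ) = lim_{t → 1} π^{1/2}/Γ(n/2) (1/(2t) ∂/∂t)^{(n-1)/2} [tⁿ⁻² Φ_θ(t)]`. -/
def FunkInversionII (n : ℕ) (φ f : E (n + 1) → 𝕜) : Prop :=
  (∀ t ∈ Ioo (0 : ℝ) 1, ∀ᵐ θ : Sph (n + 1) ∂(sphMeasure (n + 1)),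
    Integrable (capPoint φ (θ : E (n + 1)) t) (greatMeasure (θ : E (n + 1)))) ∧
  HasL1Limit ((n - 1) / 2) derivSq
    (fun θ t => (√Real.pi / Real.Gamma ((n : ℝ) / 2) * t ^ (n - 2)) • capMean φ θ t) f

/-- The third formula for `f = F⁻¹φ` on `Sⁿ`:
`f(θ) = lim_{t → 1} (∂/∂t)ⁿ⁻¹ [1/(n-2)! ∫₀ᵗ (t² - s²)^{(n-3)/2} Φ_θ(s) s ds]`,
all integrals being absolutely convergent for almost all values of the parameters. -/
def FunkInversionIII (n : ℕ) (φ f : E (n + 1) → 𝕜) : Prop :=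
  (∀ᵐ θ : Sph (n + 1) ∂(sphMeasure (n + 1)), ∀ᵐ s : ℝ, s ∈ Ioo (0 : ℝ) 1 →
    Integrable (capPoint φ (θ : E (n + 1)) s) (greatMeasure (θ : E (n + 1)))) ∧
  (∀ t ∈ Ioo (0 : ℝ) 1, ∀ᵐ θ : Sph (n + 1) ∂(sphMeasure (n + 1)),
    IntervalIntegrable
      (fun s => ((t ^ 2 - s ^ 2) ^ (((n : ℝ) - 3) / 2) * s) •
        capMean φ (θ : E (n + 1)) s) volume 0 t) ∧
  HasL1Limit (n - 1) deriv
    (fun θ t => (1 / (Nat.factorial (n - 2) : ℝ)) •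
      ∫ s in (0 : ℝ)..t, ((t ^ 2 - s ^ 2) ^ (((n : ℝ) - 3) / 2) * s) •
        capMean φ θ s) f

end FunkRadon

end

set_option linter.unusedSectionVars false

/-! Central projection carries the affine plane `last = 1` of ℝⁿ⁺¹ to a half sphere, and a
hyperplane τ in it to half of a great sphere. `opB g` extends `g` evenly and homogeneously of degree
-n. Lebesgue measure on τ differs from great sphere measure by a density with the same exponent n,
so R = AFB holds without a weight inside the integral (`radon_eq_opA`). On all of ℝⁿ the exponent is
n + 1, which leaves exactly the weight (1 + |x|²)^(-1/2) (`integrable_surf_opB`). An integrable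
function on the sphere is integrable over almost every great sphere (`ae_integrable_greatLaw`), and
`ae_muTilde_of_ae` carries this over to almost every τ. What remains is to invert F on even
integrable functions.

Let M_t f (`zonMean`) be the mean of f over the points at height t over θ^⊥. Choose ω uniformly at
height √(1-s²), then ξ uniformly on the great sphere orthogonal to ω. Then ξ is uniform on the
parallel at height su, where u is a coordinate of a uniform point of Sⁿ⁻¹ (`map_dirPerp_zon`). Hence
Φ_θ(s) is the average of M_{su} f over u (`funkMean_zon`), an Abel integral with kernel (s² -
v²)^((n-3)/2). The outer Abel kernels turn it into an integral against ((t² - v²)/2)^(n-2) or (t -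
v)^(n-2) (`kernel_one`, `kernel_two`); for odd n the kernel is polynomial from the start.
Differentiation removes the integral and leaves M_t f up to a factor (`iterate_abelInt`). M_t f is
L¹-continuous in t and equals f at t = 1 (`continuous_zonLp`, `zonMean_one`). The formula itself
gives uniqueness.

Two devices run through the proof. Laws on the sphere are identified by symmetry: invariance under
the stabilizer of θ and the law of ⟪θ, ·⟫ determine them (`ext_of_stabilizer_invariant`). And the
sphere of θ^⊥ is parametrized by `dirPerp θ` of a uniform point of the whole sphere, so that Fubini
is applied on product spaces independent of θ. -/

noncomputable section
namespace FunkRadon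

/-! ### Surface measure and uniform distribution as measures on the ambient space. -/

section SphereMeasure

variable (V : Type*) [NormedAddCommGroup V] [InnerProductSpace ℝ V] [FiniteDimensional ℝ V]
  [MeasurableSpace V] [BorelSpace V]

/-- The surface measure of the unit sphere of `V`, as a measure on `V`. -/
def surf : Measure V := (volume : Measure V).toSphere.map Subtype.val

instance : IsFiniteMeasure (surf V) := by unfold surf; infer_instance

variable {V}

theorem measurableEmbedding_sphere :
    MeasurableEmbedding (Subtype.val : Metric.sphere (0 : V) 1 → V) :=
  MeasurableEmbedding.subtype_coe Metric.isClosed_sphere.measurableSet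

theorem ae_surf_iff {P : V → Prop} :
    (∀ᵐ x ∂(surf V), P x) ↔
      ∀ᵐ ξ : Metric.sphere (0 : V) 1 ∂(volume : Measure V).toSphere, P ξ :=
  measurableEmbedding_sphere.ae_map_iff

/-- Truncated cones express the surface measure through volume in `V`. Isometry invariance and null
sets are then inherited from volume. -/
theorem surf_apply {A : Set V} (hA : MeasurableSet A) :
    surf V A = Module.finrank ℝ V * volume {x : V | 0 < ‖x‖ ∧ ‖x‖ < 1 ∧ ‖x‖⁻¹ • x ∈ A} := by
  rw [surf, Measure.map_apply measurable_subtype_coe hA,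
    Measure.toSphere_apply' _ (measurable_subtype_coe hA)]
  congr 2
  ext x
  rw [Set.mem_smul]
  constructor
  · rintro ⟨r, ⟨h0, h1⟩, _, ⟨y, hy, rfl⟩, rfl⟩
    have : ‖r • (y : V)‖ = r := by
      rw [norm_smul, mem_sphere_zero_iff_norm.1 y.2, mul_one, Real.norm_of_nonneg h0.le]
    simp only [Set.mem_ofPred_eq, this, inv_smul_smul₀ h0.ne']
    exact ⟨h0, h1, hy⟩
  · rintro ⟨h0, h1, h2⟩
    refine ⟨‖x‖, ⟨h0, h1⟩, ‖x‖⁻¹ • x, ⟨⟨‖x‖⁻¹ • x, ?_⟩, h2, rfl⟩, smul_inv_smul₀ h0.ne' x⟩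
    rw [mem_sphere_zero_iff_norm, norm_smul, norm_inv, norm_norm, inv_mul_cancel₀ h0.ne']

theorem ae_surf_norm_eq_one : ∀ᵐ x ∂(surf V), ‖x‖ = 1 :=
  ae_surf_iff.2 (Eventually.of_forall fun ξ => by simp)

theorem surf_map_isometry {V' : Type*} [NormedAddCommGroup V'] [InnerProductSpace ℝ V']
    [FiniteDimensional ℝ V'] [MeasurableSpace V'] [BorelSpace V'] (U : V ≃ₗᵢ[ℝ] V') :
    (surf V).map U = surf V' := by
  ext A hA
  have hU : Measurable U := U.continuous.measurable
  rw [Measure.map_apply hU hA, surf_apply hA, surf_apply (hU hA), U.toLinearEquiv.finrank_eq,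
    ← U.measurePreserving.measure_preimage]
  · congr 2
    ext x
    simp
  · refine MeasurableSet.nullMeasurableSet ?_
    refine (measurableSet_lt measurable_const measurable_norm).inter
      ((measurableSet_lt measurable_norm measurable_const).inter ?_)
    exact (measurable_norm.inv.smul measurable_id) hA

theorem surf_submodule (S : Submodule ℝ V) (hS : S ≠ ⊤) : surf V (S : Set V) = 0 := by
  rw [surf_apply S.closed_of_finiteDimensional.measurableSet]
  refine mul_eq_zero_of_right _ (measure_mono_null ?_ (Measure.addHaar_submodule volume S hS))
  rintro x ⟨h0, -, h⟩
  exact (S.smul_mem_iff (inv_ne_zero h0.ne')).1 h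

theorem surf_univ_toReal {n : ℕ} [Nontrivial V] (hn : Module.finrank ℝ V = n) :
    surf V univ = ENNReal.ofReal (sphArea n) := by
  have hn0 : 0 < n := hn ▸ Module.finrank_pos
  have hn0' : (0 : ℝ) < n := by exact_mod_cast hn0
  rw [surf, Measure.map_apply measurable_subtype_coe .univ, preimage_univ,
    Measure.toSphere_apply_univ, InnerProductSpace.volume_ball, hn, ENNReal.ofReal_one, one_pow,
    one_mul, ← ENNReal.ofReal_natCast, ← ENNReal.ofReal_mul hn0'.le, sphArea,
    Real.Gamma_add_one (by positivity), Real.sqrt_eq_rpow, ← Real.rpow_natCast, ← Real.rpow_mul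
    Real.pi_pos.le]
  congr 1
  have := (Real.Gamma_pos_of_pos (half_pos hn0')).ne'
  field_simp

theorem sphArea_pos {n : ℕ} (hn : 0 < n) : 0 < sphArea n := by
  have : (0 : ℝ) < n := by exact_mod_cast hn
  have := Real.Gamma_pos_of_pos (half_pos this)
  have := Real.pi_pos
  unfold sphArea
  positivity

variable (V) in
/-- The uniform distribution on the unit sphere of `V`, as a measure on `V`. -/
def unif : Measure V := (surf V univ)⁻¹ • surf V

theorem surf_univ_ne_zero [Nontrivial V] : surf V univ ≠ 0 := by
  rw [surf_univ_toReal rfl]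
  simpa using sphArea_pos (Module.finrank_pos (R := ℝ) (M := V))

instance [Nontrivial V] : IsProbabilityMeasure (unif V) := by
  constructor
  rw [unif, Measure.smul_apply, smul_eq_mul,
    ENNReal.inv_mul_cancel surf_univ_ne_zero (measure_ne_top _ _)]

instance : SFinite (unif V) := by unfold unif; infer_instance

theorem surf_eq_smul_unif [Nontrivial V] : surf V = surf V univ • unif V := by
  rw [unif, smul_smul, ENNReal.mul_inv_cancel surf_univ_ne_zero (measure_ne_top _ _), one_smul]

theorem unif_absolutelyContinuous : unif V ≪ surf V := Measure.smul_absolutelyContinuous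

theorem unif_map_isometry {V' : Type*} [NormedAddCommGroup V'] [InnerProductSpace ℝ V']
    [FiniteDimensional ℝ V'] [MeasurableSpace V'] [BorelSpace V'] (U : V ≃ₗᵢ[ℝ] V') :
    (unif V).map U = unif V' := by
  rw [unif, unif, Measure.map_smul, surf_map_isometry, ← surf_map_isometry U,
    Measure.map_apply U.continuous.measurable .univ, preimage_univ]

theorem ae_unif_norm_eq_one : ∀ᵐ x ∂(unif V), ‖x‖ = 1 :=
  unif_absolutelyContinuous.ae_le ae_surf_norm_eq_one

end SphereMeasure

/-! ### Projection to θ^⊥ and points at given height. -/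

section Direction

variable {V : Type*} [NormedAddCommGroup V] [InnerProductSpace ℝ V]

/-- The component of `x` orthogonal to `θ` (for `θ` of norm one), normalized. -/
def dirPerp (θ x : V) : V := ‖x - ⟪θ, x⟫ • θ‖⁻¹ • (x - ⟪θ, x⟫ • θ)

theorem norm_dirPerp {θ x : V} (h : x - ⟪θ, x⟫ • θ ≠ 0) : ‖dirPerp θ x‖ = 1 := by
  rw [dirPerp, norm_smul, norm_inv, norm_norm, inv_mul_cancel₀ (norm_ne_zero_iff.2 h)]

theorem inner_dirPerp {θ : V} (hθ : ‖θ‖ = 1 ∨ θ = 0) (x : V) : ⟪θ, dirPerp θ x⟫ = 0 := by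
  rcases hθ with hθ | rfl
  · simp [dirPerp, inner_smul_right, inner_sub_right, hθ]
  · simp

theorem dirPerp_neg (θ x : V) : dirPerp θ (-x) = -dirPerp θ x := by
  have : -x - ⟪θ, -x⟫ • θ = -(x - ⟪θ, x⟫ • θ) := by rw [inner_neg_right, neg_smul]; abel
  rw [dirPerp, this, norm_neg, smul_neg, dirPerp]

theorem dirPerp_isometry (U : V ≃ₗᵢ[ℝ] V) (θ x : V) :
    dirPerp (U θ) (U x) = U (dirPerp θ x) := by
  rw [dirPerp, dirPerp, LinearIsometryEquiv.inner_map_map, ← map_smul, ← map_sub,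
    LinearIsometryEquiv.norm_map, ← map_smul]

/-- The reflection in the hyperplane orthogonal to `x - y` works: it exchanges vectors of equal
norm, and it fixes θ because θ is orthogonal to `x - y`. -/
theorem exists_isometry_of_inner_eq {θ x y : V} (hn : ‖x‖ = ‖y‖) (hi : ⟪θ, x⟫ = ⟪θ, y⟫) :
    ∃ U : V ≃ₗᵢ[ℝ] V, U x = y ∧ U θ = θ := by
  refine ⟨(ℝ ∙ (x - y))ᗮ.reflection, Submodule.reflection_sub hn, ?_⟩
  rw [Submodule.reflection_eq_self_iff, Submodule.mem_orthogonal_singleton_iff_inner_right,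
    inner_sub_left, real_inner_comm, hi, real_inner_comm, sub_self]

/-- The point at height `t` over `θ^⊥` in the direction of the projection of `x`. -/
def zon (t : ℝ) (θ x : V) : V := t • θ + √(1 - t ^ 2) • dirPerp θ x

theorem zon_isometry (U : V ≃ₗᵢ[ℝ] V) (t : ℝ) (θ x : V) :
    zon t (U θ) (U x) = U (zon t θ x) := by
  simp [zon, dirPerp_isometry]

theorem zon_zero (θ x : V) : zon 0 θ x = dirPerp θ x := by simp [zon]

theorem zon_one (θ x : V) : zon 1 θ x = θ := by simp [zon]

theorem zon_neg (t : ℝ) (θ x : V) : zon (-t) θ (-x) = -zon t θ x := by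
  simp [zon, dirPerp_neg, add_comm]

variable [MeasurableSpace V] [BorelSpace V] [SecondCountableTopology V]

theorem measurable_dirPerp : Measurable fun p : V × V => dirPerp p.1 p.2 := by
  have h : Measurable fun p : V × V => p.2 - ⟪p.1, p.2⟫ • p.1 := by
    apply Continuous.measurable; fun_prop
  exact h.norm.inv.smul h

theorem measurable_zon : Measurable fun p : ℝ × V × V => zon p.1 p.2.1 p.2.2 := by
  have h1 : Measurable fun p : ℝ × V × V => p.1 • p.2.1 := by
    apply Continuous.measurable; fun_prop
  have h2 : Measurable fun p : ℝ × V × V => √(1 - p.1 ^ 2) := by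
    apply Continuous.measurable; fun_prop
  exact h1.add (h2.smul (measurable_dirPerp.comp measurable_snd))

end Direction

/-! ### Measures on the sphere determined by symmetry, via characteristic functions. -/

section Uniqueness

variable {V : Type*} [NormedAddCommGroup V] [InnerProductSpace ℝ V] [FiniteDimensional ℝ V]
  [MeasurableSpace V] [BorelSpace V]

theorem nontrivial_of_norm_eq_one {η : V} (hη : ‖η‖ = 1) : Nontrivial V :=
  ⟨η, 0, fun h => by simp [h] at hη⟩

/-- The exceptional points lie on the line through θ, a proper subspace because it misses η. Off it,
`dirPerp θ` is a genuine unit vector rather than the default value 0. -/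
theorem ae_sub_inner_smul_ne_zero {θ η : V} (hη : ‖η‖ = 1) (hθη : ⟪θ, η⟫ = 0) :
    ∀ᵐ x ∂(unif V), x - ⟪θ, x⟫ • θ ≠ 0 := by
  have hS : (ℝ ∙ θ) ≠ ⊤ := by
    intro h
    obtain ⟨c, hc⟩ := Submodule.mem_span_singleton.1 (h ▸ Submodule.mem_top : η ∈ ℝ ∙ θ)
    have : ⟪η, η⟫ = 0 := by
      nth_rewrite 1 [← hc]
      rw [inner_smul_left, hθη, mul_zero]
    rw [inner_self_eq_zero] at this
    simp [this] at hη
  have h0 : unif V ((ℝ ∙ θ : Submodule ℝ V) : Set V) = 0 :=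
    unif_absolutelyContinuous (surf_submodule _ hS)
  filter_upwards [measure_eq_zero_iff_ae_notMem.1 h0] with x hx h
  exact hx (Submodule.mem_span_singleton.2 ⟨_, (sub_eq_zero.1 h).symm⟩)

theorem ae_norm_dirPerp {θ η : V} (hη : ‖η‖ = 1) (hθη : ⟪θ, η⟫ = 0) :
    ∀ᵐ x ∂(unif V), ‖dirPerp θ x‖ = 1 := by
  filter_upwards [ae_sub_inner_smul_ne_zero hη hθη] with x hx using norm_dirPerp hx

theorem charFun_isometry {ν : Measure V} (U : V ≃ₗᵢ[ℝ] V) (hU : ν.map U = ν) (y : V) :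
    charFun ν (U y) = charFun ν y := by
  simp only [charFun_apply]
  conv_lhs => rw [← hU]
  rw [integral_map U.continuous.aemeasurable (by fun_prop)]
  simp

/-- The average over the orbit `aθ + b S(θ^⊥)` of the exponential with frequency `x`. -/
def orbitChar (θ : V) (a b : ℝ) (x : V) : ℂ :=
  ∫ z, Complex.exp (⟪x, a • θ + b • dirPerp θ z⟫ * Complex.I) ∂(unif V)

theorem orbitChar_isometry [Nontrivial V] {θ : V} (U : V ≃ₗᵢ[ℝ] V) (hU : U θ = θ) (a b : ℝ)
    (x : V) : orbitChar θ a b (U x) = orbitChar θ a b x := by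
  have hm : Measurable (dirPerp θ) := measurable_dirPerp.comp measurable_prodMk_left
  have hm' : Measurable fun z => Complex.exp (⟪U x, a • θ + b • dirPerp θ z⟫ * Complex.I) := by
    fun_prop
  rw [orbitChar, ← unif_map_isometry U, integral_map U.continuous.aemeasurable
    hm'.aestronglyMeasurable, orbitChar]
  congr 1 with z
  have : dirPerp θ (U z) = U (dirPerp θ z) := by
    conv_lhs => rw [← hU]
    exact dirPerp_isometry U θ z
  rw [this]
  nth_rewrite 1 [← hU]
  rw [← map_smul, ← map_smul, ← map_add, LinearIsometryEquiv.inner_map_map]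

theorem measurable_orbit_exp (θ : V) (a b : ℝ) : Measurable fun p : V × V =>
    Complex.exp (⟪p.1, a • θ + b • dirPerp θ p.2⟫ * Complex.I) := by
  have hm : Measurable fun p : V × V => dirPerp θ p.2 :=
    measurable_dirPerp.comp (measurable_const.prodMk measurable_snd)
  fun_prop

theorem measurable_orbitChar (θ : V) (a b : ℝ) : Measurable (orbitChar θ a b) :=
  (StronglyMeasurable.integral_prod_right
    (measurable_orbit_exp θ a b).stronglyMeasurable).measurable

/-- By invariance of ν, η may be replaced by any unit vector of θ^⊥ without changing the left side.
Averaging over these vectors and exchanging the integrals gives the right side. -/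
theorem charFun_eq_integral_orbitChar {θ η : V} (hη : ‖η‖ = 1) (hθη : ⟪θ, η⟫ = 0)
    (hθ : ‖θ‖ = 1 ∨ θ = 0) {ν : Measure V} [IsProbabilityMeasure ν]
    (hν : ∀ U : V ≃ₗᵢ[ℝ] V, U θ = θ → ν.map U = ν) (a b : ℝ) :
    charFun ν (a • θ + b • η) = ∫ x, orbitChar θ a b x ∂ν := by
  have := nontrivial_of_norm_eq_one hη
  have key : ∀ᵐ z ∂(unif V), charFun ν (a • θ + b • η) =
      ∫ x, Complex.exp (⟪x, a • θ + b • dirPerp θ z⟫ * Complex.I) ∂ν := by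
    filter_upwards [ae_norm_dirPerp hη hθη] with z hz
    obtain ⟨U, hU, hUθ⟩ := exists_isometry_of_inner_eq (θ := θ) (hη.trans hz.symm)
      (hθη.trans (inner_dirPerp hθ z).symm)
    rw [← charFun_isometry U (hν U hUθ), map_add, map_smul, map_smul, hUθ, hU, charFun_apply]
  calc charFun ν (a • θ + b • η) = ∫ _z, charFun ν (a • θ + b • η) ∂(unif V) := by simp
    _ = _ := integral_congr_ae key
    _ = _ := by
      unfold orbitChar
      refine (integral_integral_swap ?_).symm
      refine Integrable.of_bound (measurable_orbit_exp θ a b).aestronglyMeasurable 1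
        (Eventually.of_forall fun p => ?_)
      simp only [Function.uncurry]
      rw [Complex.norm_exp_ofReal_mul_I]

/-- On unit vectors the orbit average depends only on r = ⟪θ, x⟫, since an isometry fixing θ moves x
to the normal form rθ + √(1-r²)η. So only the law of r enters. For θ = 0 the same computation holds
with r = 0. -/
theorem integral_orbitChar {θ η : V} (hη : ‖η‖ = 1) (hθη : ⟪θ, η⟫ = 0)
    (hθ : ‖θ‖ = 1 ∨ θ = 0) {ν : Measure V} (h1 : ∀ᵐ x ∂ν, ‖x‖ = 1) (a b : ℝ) :
    ∫ x, orbitChar θ a b x ∂ν =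
      ∫ r, orbitChar θ a b (r • θ + √(1 - r ^ 2) • η) ∂(ν.map fun x => ⟪θ, x⟫) := by
  have := nontrivial_of_norm_eq_one hη
  have hm : Measurable fun r : ℝ => orbitChar θ a b (r • θ + √(1 - r ^ 2) • η) :=
    (measurable_orbitChar θ a b).comp (Continuous.measurable (by fun_prop))
  rw [integral_map (Continuous.aemeasurable (by fun_prop)) hm.aestronglyMeasurable]
  refine integral_congr_ae ?_
  filter_upwards [h1] with x hx
  have hη2 : ⟪η, η⟫ = 1 := by rw [real_inner_self_eq_norm_sq, hη, one_pow]
  have hx2 : ⟪x, x⟫ = 1 := by rw [real_inner_self_eq_norm_sq, hx, one_pow]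
  have hηθ : ⟪η, θ⟫ = 0 := by rw [real_inner_comm, hθη]
  set r := ⟪θ, x⟫ with hr
  have hr1 : r ^ 2 ≤ 1 := by
    have h := abs_real_inner_le_norm θ x
    rw [hx, mul_one] at h
    rcases hθ with h' | h'
    · rw [h'] at h
      exact (sq_le_one_iff_abs_le_one r).2 h
    · simp [hr, h']
  have hs : √(1 - r ^ 2) * √(1 - r ^ 2) = 1 - r ^ 2 := Real.mul_self_sqrt (by linarith)
  have hrθ : r * ⟪θ, θ⟫ = r := by
    rcases hθ with h' | h'
    · rw [real_inner_self_eq_norm_sq, h', one_pow, mul_one]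
    · simp [hr, h']
  obtain ⟨U, hU, hUθ⟩ := exists_isometry_of_inner_eq (θ := θ) (x := x)
    (y := r • θ + √(1 - r ^ 2) • η) (by
      have : ⟪r • θ + √(1 - r ^ 2) • η, r • θ + √(1 - r ^ 2) • η⟫ = (1 : ℝ) := by
        simp only [inner_add_left, inner_add_right, real_inner_smul_left, real_inner_smul_right,
          hθη, hηθ, hη2]
        linear_combination r * hrθ + hs
      rw [hx, ← sq_eq_sq₀ zero_le_one (norm_nonneg _), ← real_inner_self_eq_norm_sq, this,
        one_pow]) (by
      rw [inner_add_right, real_inner_smul_right, real_inner_smul_right, hθη, hrθ, mul_zero,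
        add_zero])
  rw [← hU, orbitChar_isometry U hUθ]

/-- Two probability measures on the unit sphere that are invariant under the isometries fixing `θ`
agree as soon as they give the same law to `⟪θ, ·⟫`. -/
theorem ext_of_stabilizer_invariant {θ η : V} (hη : ‖η‖ = 1) (hθη : ⟪θ, η⟫ = 0)
    (hθ : ‖θ‖ = 1 ∨ θ = 0) {ν₁ ν₂ : Measure V} [IsProbabilityMeasure ν₁]
    [IsProbabilityMeasure ν₂] (h₁ : ∀ᵐ x ∂ν₁, ‖x‖ = 1) (h₂ : ∀ᵐ x ∂ν₂, ‖x‖ = 1)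
    (i₁ : ∀ U : V ≃ₗᵢ[ℝ] V, U θ = θ → ν₁.map U = ν₁)
    (i₂ : ∀ U : V ≃ₗᵢ[ℝ] V, U θ = θ → ν₂.map U = ν₂)
    (hlaw : ν₁.map (fun x => ⟪θ, x⟫) = ν₂.map (fun x => ⟪θ, x⟫)) : ν₁ = ν₂ := by
  refine Measure.ext_of_charFun (funext fun y => ?_)
  have main : ∀ ζ : V, ‖ζ‖ = 1 → ⟪θ, ζ⟫ = 0 → ∀ a b : ℝ,
      charFun ν₁ (a • θ + b • ζ) = charFun ν₂ (a • θ + b • ζ) := by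
    intro ζ hζ hθζ a b
    rw [charFun_eq_integral_orbitChar hζ hθζ hθ i₁, charFun_eq_integral_orbitChar hζ hθζ hθ i₂,
      integral_orbitChar hζ hθζ hθ h₁, integral_orbitChar hζ hθζ hθ h₂, hlaw]
  -- A frequency is a multiple of θ plus a multiple of a unit vector of θ^⊥; if the second part
  -- vanishes, η serves with coefficient 0.
  by_cases hy : y - ⟪θ, y⟫ • θ = 0
  · have := main η hη hθη ⟪θ, y⟫ 0
    rwa [zero_smul, add_zero, ← sub_eq_zero.1 hy] at this
  · have := main (dirPerp θ y) (norm_dirPerp hy) (inner_dirPerp hθ y) ⟪θ, y⟫ ‖y - ⟪θ, y⟫ • θ‖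
    rwa [dirPerp, smul_inv_smul₀ (norm_ne_zero_iff.2 hy), add_sub_cancel] at this

/-- The uniform distribution is the only isometry-invariant probability measure on the sphere. -/
theorem eq_unif_of_invariant [Nontrivial V] {ν : Measure V} [IsProbabilityMeasure ν]
    (h : ∀ᵐ x ∂ν, ‖x‖ = 1) (i : ∀ U : V ≃ₗᵢ[ℝ] V, ν.map U = ν) : ν = unif V := by
  obtain ⟨η, hη⟩ := exists_norm_eq V zero_le_one
  -- With θ = 0 the stabilizer is the full isometry group, and both laws of ⟪0, ·⟫ are the point
  -- mass at 0.
  refine ext_of_stabilizer_invariant (θ := 0) hη (inner_zero_left η) (.inr rfl) h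
    ae_unif_norm_eq_one (fun U _ => i U) (fun U _ => unif_map_isometry U) ?_
  simp

end Uniqueness

/-! ### Laws of random directions and of points at given height. -/

section Laws

variable {V : Type*} [NormedAddCommGroup V] [InnerProductSpace ℝ V] [FiniteDimensional ℝ V]
  [MeasurableSpace V] [BorelSpace V]

theorem measurable_dirPerp_right (θ : V) : Measurable (dirPerp θ) :=
  measurable_dirPerp.comp measurable_prodMk_left

theorem measurable_zon_prod (t : ℝ) : Measurable fun p : V × V => zon t p.1 p.2 :=
  measurable_zon.comp (measurable_const.prodMk measurable_id)

theorem exists_unit_inner_eq_zero {n : ℕ} (hV : Module.finrank ℝ V = n + 1) (hn : n ≠ 0)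
    {θ : V} (hθ : ‖θ‖ = 1) : ∃ η : V, ‖η‖ = 1 ∧ ⟪θ, η⟫ = 0 := by
  have : Fact (Module.finrank ℝ V = n + 1) := ⟨hV⟩
  have hf : Module.finrank ℝ (ℝ ∙ θ)ᗮ = n :=
    Submodule.finrank_orthogonal_span_singleton (fun h => by simp [h] at hθ)
  have : Nontrivial (ℝ ∙ θ)ᗮ := Module.nontrivial_of_finrank_pos (R := ℝ) (by omega)
  obtain ⟨η, hη⟩ := exists_norm_eq (ℝ ∙ θ)ᗮ zero_le_one
  exact ⟨η, hη, Submodule.mem_orthogonal_singleton_iff_inner_right.1 η.2⟩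

theorem unif_coe_map_isometry (S : Submodule ℝ V) (U : V ≃ₗᵢ[ℝ] V)
    (hS : S.map (U.toLinearEquiv : V →ₗ[ℝ] V) = S) :
    ((unif S).map (Subtype.val : S → V)).map U = (unif S).map (Subtype.val : S → V) := by
  -- `unif` lives on the subtype, so equality of submodules is transported before the measures can
  -- be compared.
  have key : ∀ S' : Submodule ℝ V, S' = S →
      (unif S').map (Subtype.val : S' → V) = (unif S).map (Subtype.val : S → V) := by
    rintro _ rfl; rfl
  have h : (unif S).map (U.submoduleMap S) =
      unif (S.map (U.toLinearEquiv : V →ₗ[ℝ] V) : Submodule ℝ V) :=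
    unif_map_isometry (U.submoduleMap S)
  have h2 : (unif (S.map (U.toLinearEquiv : V →ₗ[ℝ] V) : Submodule ℝ V)).map Subtype.val =
      (unif S).map (U ∘ Subtype.val) := by
    rw [← h]
    exact Measure.map_map measurable_subtype_coe (U.submoduleMap S).continuous.measurable
  rw [Measure.map_map U.continuous.measurable measurable_subtype_coe, ← h2, key _ hS]

theorem map_orthogonal_of_fixed {θ : V} (U : V ≃ₗᵢ[ℝ] V) (hU : U θ = θ) :
    (ℝ ∙ θ)ᗮ.map (U.toLinearEquiv : V →ₗ[ℝ] V) = (ℝ ∙ θ)ᗮ := by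
  ext x
  rw [Submodule.mem_map]
  simp only [Submodule.mem_orthogonal_singleton_iff_inner_right]
  constructor
  · rintro ⟨y, hy, rfl⟩
    nth_rewrite 1 [← hU]
    exact (U.inner_map_map θ y).trans hy
  · intro hx
    refine ⟨U.symm x, ?_, U.apply_symm_apply x⟩
    rw [← U.inner_map_map, U.apply_symm_apply, hU, hx]

theorem map_dirPerp_isometry [Nontrivial V] {θ : V} (U : V ≃ₗᵢ[ℝ] V) (hU : U θ = θ) :
    ((unif V).map (dirPerp θ)).map U = (unif V).map (dirPerp θ) := by
  conv_rhs => rw [← unif_map_isometry U]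
  rw [Measure.map_map U.continuous.measurable (measurable_dirPerp_right θ),
    Measure.map_map (measurable_dirPerp_right θ) U.continuous.measurable]
  congr 1 with x
  change _ = dirPerp θ (U x)
  conv_rhs => rw [← hU]
  exact (dirPerp_isometry U θ x).symm

/-- For uniform `x`, the direction `dirPerp θ x` is uniformly distributed on the sphere
of `θ^⊥`. -/
theorem map_dirPerp {θ η : V} (hθ : ‖θ‖ = 1) (hη : ‖η‖ = 1) (hθη : ⟪θ, η⟫ = 0) :
    (unif V).map (dirPerp θ) = (unif (ℝ ∙ θ)ᗮ).map (Subtype.val : (ℝ ∙ θ)ᗮ → V) := by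
  have := nontrivial_of_norm_eq_one hη
  have : Nontrivial (ℝ ∙ θ)ᗮ := ⟨⟨η, Submodule.mem_orthogonal_singleton_iff_inner_right.2 hθη⟩, 0,
    fun h => by
      have h0 : η = 0 := congrArg Subtype.val h
      simp [h0] at hη⟩
  have : IsProbabilityMeasure ((unif V).map (dirPerp θ)) :=
    Measure.isProbabilityMeasure_map (measurable_dirPerp_right θ).aemeasurable
  have : IsProbabilityMeasure ((unif (ℝ ∙ θ)ᗮ).map (Subtype.val : (ℝ ∙ θ)ᗮ → V)) :=
    Measure.isProbabilityMeasure_map measurable_subtype_coe.aemeasurable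
  have hm : MeasurableSet {x : V | ‖x‖ = 1} := measurableSet_eq_fun measurable_norm measurable_const
  refine ext_of_stabilizer_invariant hη hθη (.inl hθ) ?_ ?_
    (fun U hU => map_dirPerp_isometry U hU)
    (fun U hU => unif_coe_map_isometry _ U (map_orthogonal_of_fixed U hU)) ?_
  · exact (ae_map_iff (measurable_dirPerp_right θ).aemeasurable hm).2 (ae_norm_dirPerp hη hθη)
  · exact (ae_map_iff measurable_subtype_coe.aemeasurable hm).2 ae_unif_norm_eq_one
  · have hi : Measurable fun x : V => ⟪θ, x⟫ := Continuous.measurable (by fun_prop)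
    rw [Measure.map_map hi (measurable_dirPerp_right θ), Measure.map_map hi measurable_subtype_coe]
    have h1 : (fun x : V => ⟪θ, x⟫) ∘ dirPerp θ = fun _ => 0 :=
      funext fun x => inner_dirPerp (.inl hθ) x
    have h2 : (fun x : V => ⟪θ, x⟫) ∘ (Subtype.val : (ℝ ∙ θ)ᗮ → V) = fun _ => 0 :=
      funext fun x => Submodule.mem_orthogonal_singleton_iff_inner_right.1 x.2
    rw [h1, h2]
    simp

theorem inner_zon {θ : V} (hθ : ‖θ‖ = 1) (t : ℝ) (x : V) : ⟪θ, zon t θ x⟫ = t := by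
  rw [zon, inner_add_right, real_inner_smul_right, real_inner_smul_right,
    inner_dirPerp (.inl hθ), real_inner_self_eq_norm_sq, hθ]
  ring

theorem norm_zon {θ x : V} (hθ : ‖θ‖ = 1) (hx : ‖dirPerp θ x‖ = 1) {t : ℝ} (ht : |t| ≤ 1) :
    ‖zon t θ x‖ = 1 := by
  have h1 : ⟪θ, dirPerp θ x⟫ = 0 := inner_dirPerp (.inl hθ) x
  have h2 : t ^ 2 ≤ 1 := (sq_le_one_iff_abs_le_one t).2 ht
  have : ‖zon t θ x‖ ^ 2 = 1 := by
    rw [zon, norm_add_sq_real, norm_smul, norm_smul, hθ, hx, real_inner_smul_left,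
      real_inner_smul_right, h1, Real.norm_eq_abs, mul_one, mul_one, sq_abs,
      Real.norm_of_nonneg (Real.sqrt_nonneg _), Real.sq_sqrt (by linarith)]
    ring
  exact (pow_eq_one_iff_of_nonneg (norm_nonneg _) two_ne_zero).1 this

theorem ae_norm_zon {θ η : V} (hθ : ‖θ‖ = 1) (hη : ‖η‖ = 1) (hθη : ⟪θ, η⟫ = 0) {t : ℝ}
    (ht : |t| ≤ 1) : ∀ᵐ x ∂(unif V), ‖zon t θ x‖ = 1 := by
  filter_upwards [ae_norm_dirPerp hη hθη] with x hx using norm_zon hθ hx ht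

theorem ae_prod_norm_zon {n : ℕ} (hV : Module.finrank ℝ V = n + 1) (hn : n ≠ 0) {t : ℝ}
    (ht : |t| ≤ 1) : ∀ᵐ p ∂(unif V).prod (unif V), ‖zon t p.1 p.2‖ = 1 := by
  rw [Measure.ae_prod_iff_ae_ae
    (measurableSet_eq_fun (measurable_zon_prod t).norm measurable_const)]
  filter_upwards [ae_unif_norm_eq_one] with θ hθ
  obtain ⟨η, hη, hθη⟩ := exists_unit_inner_eq_zero hV hn hθ
  exact ae_norm_zon hθ hη hθη ht

/-- The point at height `t` over `θ^⊥` is uniformly distributed if `θ` is. -/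
theorem map_zon {n : ℕ} (hV : Module.finrank ℝ V = n + 1) (hn : n ≠ 0) {t : ℝ} (ht : |t| ≤ 1) :
    ((unif V).prod (unif V)).map (fun p => zon t p.1 p.2) = unif V := by
  have : Nontrivial V := Module.nontrivial_of_finrank_pos (R := ℝ) (by omega)
  have hz := measurable_zon_prod (V := V) t
  have : IsProbabilityMeasure (((unif V).prod (unif V)).map (fun p => zon t p.1 p.2)) :=
    Measure.isProbabilityMeasure_map hz.aemeasurable
  refine eq_unif_of_invariant ?_ fun U => ?_
  · exact (ae_map_iff hz.aemeasurable (measurableSet_eq_fun measurable_norm measurable_const)).2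
      (ae_prod_norm_zon hV hn ht)
  · have hU := U.continuous.measurable
    conv_rhs => rw [← unif_map_isometry U, Measure.map_prod_map _ _ hU hU,
      Measure.map_map hz (hU.prodMap hU)]
    rw [Measure.map_map hU hz]
    congr 1 with p
    exact (zon_isometry U t p.1 p.2).symm

theorem surf_eq_map_zon {n : ℕ} (hV : Module.finrank ℝ V = n + 1) (hn : n ≠ 0) {t : ℝ}
    (ht : |t| ≤ 1) : ((surf V).prod (unif V)).map (fun p => zon t p.1 p.2) = surf V := by
  have : Nontrivial V := Module.nontrivial_of_finrank_pos (R := ℝ) (by omega)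
  rw [surf_eq_smul_unif, Measure.prod_smul_left, Measure.map_smul, map_zon hV hn ht]

/-- The uniform point orthogonal to a uniform point `ω` at height `√(1 - s²)` over `θ^⊥` has
the law of a point at height `su` over `θ^⊥`, where `u` is a coordinate of a uniform point of the
sphere of `ω^⊥`. -/
theorem map_dirPerp_zon {n : ℕ} (hV : Module.finrank ℝ V = n + 1) (hn : n ≠ 0)
    {lam : Measure ℝ} [IsProbabilityMeasure lam]
    (hlam : ∀ ω e : V, ‖ω‖ = 1 → ‖e‖ = 1 → ⟪ω, e⟫ = 0 →
      (unif V).map (fun y => ⟪e, dirPerp ω y⟫) = lam)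
    {θ : V} (hθ : ‖θ‖ = 1) {s : ℝ} (hs0 : 0 ≤ s) (hs1 : s ≤ 1) :
    ((unif V).prod (unif V)).map (fun p => dirPerp (zon √(1 - s ^ 2) θ p.1) p.2) =
      (lam.prod (unif V)).map (fun p => zon (s * p.1) θ p.2) := by
  have : Nontrivial V := Module.nontrivial_of_finrank_pos (R := ℝ) (by omega)
  obtain ⟨η, hη, hθη⟩ := exists_unit_inner_eq_zero hV hn hθ
  have hs2 : s ^ 2 ≤ 1 := by nlinarith
  have hsq : √(1 - s ^ 2) ^ 2 = 1 - s ^ 2 := Real.sq_sqrt (by linarith)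
  have hsa : |√(1 - s ^ 2)| ≤ 1 := by
    rw [abs_of_nonneg (Real.sqrt_nonneg _), Real.sqrt_le_iff]
    constructor <;> nlinarith
  have hss : √(1 - √(1 - s ^ 2) ^ 2) = s := by
    rw [hsq, sub_sub_cancel, Real.sqrt_sq hs0]
  have m1 : Measurable fun p : V × V => dirPerp (zon √(1 - s ^ 2) θ p.1) p.2 :=
    measurable_dirPerp.comp ((measurable_zon.comp (measurable_const.prodMk
      (measurable_const.prodMk measurable_fst))).prodMk measurable_snd)
  have m2 : Measurable fun p : ℝ × V => zon (s * p.1) θ p.2 :=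
    measurable_zon.comp ((measurable_fst.const_mul s).prodMk
      (measurable_const.prodMk measurable_snd))
  have mi : Measurable fun x : V => ⟪θ, x⟫ := Continuous.measurable (by fun_prop)
  have := Measure.isProbabilityMeasure_map (μ := (unif V).prod (unif V)) m1.aemeasurable
  have := Measure.isProbabilityMeasure_map (μ := lam.prod (unif V)) m2.aemeasurable
  have hfix : ∀ U : V ≃ₗᵢ[ℝ] V, U θ = θ → ∀ t x, zon t θ (U x) = U (zon t θ x) := by
    intro U hU t x
    nth_rewrite 1 [← hU]
    exact zon_isometry U t θ x
  have hm : MeasurableSet {x : V | ‖x‖ = 1} := measurableSet_eq_fun measurable_norm measurable_const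
  -- Both constructions commute with the isometries fixing θ, so only the laws of the height ⟪θ, ·⟫
  -- need comparison. On the right the height is `s * u` by `inner_zon`.
  refine ext_of_stabilizer_invariant hη hθη (.inl hθ) ?_ ?_ ?_ ?_ ?_
  · refine (ae_map_iff m1.aemeasurable hm).2 ?_
    rw [Measure.ae_prod_iff_ae_ae (measurableSet_eq_fun m1.norm measurable_const)]
    filter_upwards [ae_norm_zon hθ hη hθη hsa] with x hx
    obtain ⟨ζ, hζ, hxζ⟩ := exists_unit_inner_eq_zero hV hn hx
    exact ae_norm_dirPerp hζ hxζ
  · refine (ae_map_iff m2.aemeasurable hm).2 ?_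
    rw [Measure.ae_prod_iff_ae_ae (measurableSet_eq_fun m2.norm measurable_const)]
    have hl : ∀ᵐ u ∂lam, |u| ≤ 1 := by
      have hi : Measurable fun y => ⟪η, dirPerp θ y⟫ :=
        Measurable.inner measurable_const (measurable_dirPerp_right θ)
      rw [← hlam θ η hθ hη hθη, ae_map_iff hi.aemeasurable
        (measurableSet_le (f := fun u : ℝ => |u|) measurable_norm measurable_const)]
      filter_upwards [ae_norm_dirPerp hη hθη] with y hy
      simpa [hη, hy] using abs_real_inner_le_norm η (dirPerp θ y)
    filter_upwards [hl] with u hu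
    refine ae_norm_zon hθ hη hθη ?_
    rw [abs_mul, abs_of_nonneg hs0]
    exact mul_le_one₀ hs1 (abs_nonneg u) hu
  · intro U hU
    have hUm := U.continuous.measurable
    conv_rhs => rw [← unif_map_isometry U, Measure.map_prod_map _ _ hUm hUm,
      Measure.map_map m1 (hUm.prodMap hUm)]
    rw [Measure.map_map hUm m1]
    congr 1 with p
    simp only [Function.comp_apply, Prod.map_fst, Prod.map_snd, hfix U hU, dirPerp_isometry]
  · intro U hU
    have hUm := U.continuous.measurable
    conv_rhs => rw [← unif_map_isometry U, ← Measure.map_id (μ := lam),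
      Measure.map_prod_map _ _ measurable_id hUm, Measure.map_map m2 (measurable_id.prodMap hUm)]
    rw [Measure.map_map hUm m2]
    congr 1 with p
    simp only [Function.comp_apply, Prod.map_fst, Prod.map_snd, hfix U hU, id]
  · rw [Measure.map_map mi m1, Measure.map_map mi m2]
    have e2 : (fun x => ⟪θ, x⟫) ∘ (fun p : ℝ × V => zon (s * p.1) θ p.2) =
        (fun u => s * u) ∘ Prod.fst := funext fun p => inner_zon hθ _ _
    rw [e2, ← Measure.map_map (measurable_const_mul s) measurable_fst, Measure.map_fst_prod,
      measure_univ, one_smul]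
    ext A hA
    have ms : Measurable fun u : ℝ => s * u := measurable_const_mul s
    rw [Measure.map_apply (mi.comp m1) hA, Measure.prod_apply ((mi.comp m1) hA),
      Measure.map_apply ms hA]
    have : ∀ᵐ x ∂(unif V), (unif V) (Prod.mk x ⁻¹' ((fun x => ⟪θ, x⟫) ∘
        (fun p : V × V => dirPerp (zon √(1 - s ^ 2) θ p.1) p.2) ⁻¹' A)) =
          lam ((fun u => s * u) ⁻¹' A) := by
      filter_upwards [ae_norm_dirPerp hη hθη] with x hx
      set ω := zon √(1 - s ^ 2) θ x with hω
      set N := dirPerp θ x with hN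
      have hθN : ⟪θ, N⟫ = 0 := inner_dirPerp (.inl hθ) x
      have hNθ : ⟪N, θ⟫ = 0 := by rw [real_inner_comm, hθN]
      have hθ2 : ⟪θ, θ⟫ = 1 := by rw [real_inner_self_eq_norm_sq, hθ, one_pow]
      have hN2 : ⟪N, N⟫ = 1 := by rw [real_inner_self_eq_norm_sq, hx, one_pow]
      have hω' : ω = √(1 - s ^ 2) • θ + s • N := by rw [hω, zon, hss]
      have hω1 : ‖ω‖ = 1 := norm_zon hθ hx hsa
      -- In the plane of θ and ω, `e` is the unit vector orthogonal to ω, and θ = √(1-s²)ω + se. On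
      -- ω^⊥ the height over θ^⊥ is therefore s times the coordinate along `e`, for every x.
      set e := s • θ - √(1 - s ^ 2) • N with he
      have he1 : ‖e‖ = 1 := by
        have : ⟪e, e⟫ = 1 := by
          simp only [he, inner_sub_left, inner_sub_right, real_inner_smul_left,
            real_inner_smul_right, hθN, hNθ, hθ2, hN2]
          linear_combination hsq
        rw [real_inner_self_eq_norm_sq] at this
        exact (pow_eq_one_iff_of_nonneg (norm_nonneg _) two_ne_zero).1 this
      have hωe : ⟪ω, e⟫ = 0 := by
        simp only [he, hω', inner_add_left, inner_sub_right, real_inner_smul_left,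
          real_inner_smul_right, hθN, hNθ, hθ2, hN2]
        ring
      have hdec : θ = √(1 - s ^ 2) • ω + s • e := by
        have : √(1 - s ^ 2) * √(1 - s ^ 2) + s * s = 1 := by linear_combination hsq
        rw [hω', he, smul_add, smul_sub, smul_smul, smul_smul, smul_smul, smul_smul,
          mul_comm s √(1 - s ^ 2), add_add_sub_cancel, ← add_smul, this, one_smul]
      rw [← hlam ω e hω1 he1 hωe, Measure.map_apply
        (Measurable.inner measurable_const (measurable_dirPerp_right ω)) (ms hA)]
      congr 1 with y
      simp only [mem_preimage, Function.comp_apply, ← hω]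
      nth_rewrite 1 [hdec]
      rw [inner_add_left, real_inner_smul_left, real_inner_smul_left,
        inner_dirPerp (.inl hω1), mul_zero, zero_add]
    rw [lintegral_congr_ae this]
    simp

end Laws

/-! ### Gnomonic charts of the sphere. -/

section Gnomonic

variable {V W : Type*} [NormedAddCommGroup V] [InnerProductSpace ℝ V] [FiniteDimensional ℝ V]
  [MeasurableSpace V] [BorelSpace V] [NormedAddCommGroup W] [InnerProductSpace ℝ W]
  [FiniteDimensional ℝ W] [MeasurableSpace W] [BorelSpace W]
  (L : WithLp 2 (W × ℝ) ≃ₗᵢ[ℝ] V)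

theorem finrank_of_decomposition (L : WithLp 2 (W × ℝ) ≃ₗᵢ[ℝ] V) :
    Module.finrank ℝ V = Module.finrank ℝ W + 1 := by
  rw [← L.toLinearEquiv.finrank_eq, (WithLp.linearEquiv 2 ℝ (W × ℝ)).finrank_eq,
    Module.finrank_prod, Module.finrank_self]

theorem measurePreserving_decomposition :
    MeasurePreserving (fun p : W × ℝ => L (WithLp.toLp 2 p)) :=
  L.measurePreserving.comp (WithLp.volume_preserving_toLp W ℝ)

theorem continuous_decomposition : Continuous fun p : W × ℝ => L (WithLp.toLp 2 p) :=
  L.continuous.comp (WithLp.prod_continuous_toLp 2 W ℝ)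

theorem norm_decomposition (y : W) (r : ℝ) :
    ‖L (WithLp.toLp 2 (y, r))‖ = √(‖y‖ ^ 2 + r ^ 2) := by
  rw [L.norm_map, WithLp.prod_norm_eq_of_L2]
  simp

theorem decomposition_smul (c : ℝ) (y : W) (r : ℝ) :
    L (WithLp.toLp 2 (c • y, c * r)) = c • L (WithLp.toLp 2 (y, r)) := by
  rw [← map_smul]; rfl

/-- The radial projection to the unit sphere of the point at height `ε` over `y`. -/
def gno (ε : ℝ) (y : W) : V := (√(1 + ‖y‖ ^ 2))⁻¹ • L (WithLp.toLp 2 (y, ε))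

theorem measurable_gnoDensity : Measurable fun y : W =>
    ENNReal.ofReal ((√(1 + ‖y‖ ^ 2) ^ (Module.finrank ℝ W + 1))⁻¹) := by
  have h : Measurable fun y : W => √(1 + ‖y‖ ^ 2) ^ (Module.finrank ℝ W + 1) :=
    Continuous.measurable (by fun_prop)
  exact h.inv.ennreal_ofReal

variable (W) in
/-- The density of the spherical measure in the gnomonic chart. -/
def gnoMeasure : Measure W :=
  volume.withDensity fun y =>
    ENNReal.ofReal ((√(1 + ‖y‖ ^ 2) ^ (Module.finrank ℝ W + 1))⁻¹)

theorem continuous_gno (ε : ℝ) : Continuous (gno L ε) := by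
  unfold gno
  refine Continuous.smul (Continuous.inv₀ (by fun_prop) fun y => ?_) ?_
  · positivity
  · exact (continuous_decomposition L).comp (by fun_prop)

theorem gno_neg (ε : ℝ) (y : W) : gno L (-ε) y = -gno L ε (-y) := by
  have := decomposition_smul L (-1) (-y) ε
  rw [neg_one_smul, neg_neg, neg_one_mul] at this
  rw [gno, gno, this, norm_neg, neg_one_smul, smul_neg]

theorem injective_gno {ε : ℝ} (hε : ε ≠ 0) : Function.Injective (gno L ε) := by
  intro y z h
  simp only [gno, ← decomposition_smul] at h
  have h' := (WithLp.toLp_injective 2) (L.injective h)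
  obtain ⟨h1, h2⟩ := Prod.mk.inj h'
  have h3 := mul_right_cancel₀ hε h2
  rw [h3] at h1
  exact smul_right_injective W (inv_ne_zero (by positivity)) h1

theorem measurableEmbedding_gno {ε : ℝ} (hε : ε ≠ 0) : MeasurableEmbedding (gno L ε) :=
  (continuous_gno L ε).measurableEmbedding (injective_gno L hε)

theorem cone_mem_iff {A : Set V} {ε : ℝ} (hε : ε ^ 2 = 1) {r : ℝ} (hr : 0 < r) (y : W) :
    (0 < ‖L (WithLp.toLp 2 (r • y, r * ε))‖ ∧ ‖L (WithLp.toLp 2 (r • y, r * ε))‖ < 1 ∧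
      ‖L (WithLp.toLp 2 (r • y, r * ε))‖⁻¹ • L (WithLp.toLp 2 (r • y, r * ε)) ∈ A) ↔
      r < (√(1 + ‖y‖ ^ 2))⁻¹ ∧ gno L ε y ∈ A := by
  have hs : 0 < √(1 + ‖y‖ ^ 2) := by positivity
  rw [decomposition_smul, norm_smul, norm_decomposition, hε, add_comm (‖y‖ ^ 2),
    Real.norm_of_nonneg hr.le, smul_smul, mul_inv, mul_comm r⁻¹, mul_assoc,
    inv_mul_cancel₀ hr.ne', mul_one, gno,
    lt_inv_comm₀ hr hs, inv_eq_one_div r, lt_div_iff₀ hr, mul_comm r]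
  have : 0 < √(1 + ‖y‖ ^ 2) * r := by positivity
  simp [this]

theorem lintegral_pow_Ioo {b : ℝ} (hb : 0 ≤ b) (k : ℕ) :
    ∫⁻ r in Ioo 0 b, ENNReal.ofReal (r ^ k) = ENNReal.ofReal (b ^ (k + 1) / (k + 1)) := by
  rw [← ofReal_integral_eq_lintegral_ofReal, ← integral_Ioc_eq_integral_Ioo,
    ← intervalIntegral.integral_of_le hb]
  · simp
  · exact ((continuous_pow k).integrableOn_Icc).mono_set Ioo_subset_Icc_self
  · filter_upwards [ae_restrict_mem measurableSet_Ioo] with r hr using pow_nonneg hr.1.le k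

/-- Rescaling the slice at height r by r extracts r^k and, by `cone_mem_iff`, leaves the condition r
< (1 + |y|²)^(-1/2) on the directions in A. Integrating in r first gives (1 + |y|²)^(-(k+1)/2)/(k +
1), and the factor k + 1 cancels the denominator. -/
theorem lintegral_half_cone {A : Set V} (hA : MeasurableSet A) {ε : ℝ} (hε : ε ^ 2 = 1) :
    (Module.finrank ℝ W + 1 : ENNReal) * ∫⁻ r in Ioi (0 : ℝ), volume {z : W |
      0 < ‖L (WithLp.toLp 2 (z, r * ε))‖ ∧ ‖L (WithLp.toLp 2 (z, r * ε))‖ < 1 ∧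
      ‖L (WithLp.toLp 2 (z, r * ε))‖⁻¹ • L (WithLp.toLp 2 (z, r * ε)) ∈ A} =
    (gnoMeasure W).map (gno L ε) A := by
  set k := Module.finrank ℝ W with hk
  set T : Set (ℝ × W) := {p | p.1 < (√(1 + ‖p.2‖ ^ 2))⁻¹ ∧ gno L ε p.2 ∈ A} with hT
  have hgm := (continuous_gno L ε).measurable
  have hTm : MeasurableSet T := by
    refine (measurableSet_lt measurable_fst ?_).inter ((hgm.comp measurable_snd) hA)
    exact (Measurable.inv (Continuous.measurable (by fun_prop)))
  have h1 : ∀ r ∈ Ioi (0 : ℝ), volume {z : W |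
      0 < ‖L (WithLp.toLp 2 (z, r * ε))‖ ∧ ‖L (WithLp.toLp 2 (z, r * ε))‖ < 1 ∧
      ‖L (WithLp.toLp 2 (z, r * ε))‖⁻¹ • L (WithLp.toLp 2 (z, r * ε)) ∈ A} =
      ∫⁻ y : W, ENNReal.ofReal (r ^ k) * T.indicator 1 (r, y) := by
    intro r hr
    have hr0 : (0 : ℝ) < r := hr
    have hi : Measurable fun y : W => T.indicator (1 : ℝ × W → ENNReal) (r, y) :=
      (measurable_one.indicator hTm).comp measurable_prodMk_left
    rw [lintegral_const_mul _ hi]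
    have e1 : ∫⁻ y : W, T.indicator (1 : ℝ × W → ENNReal) (r, y) = volume (Prod.mk r ⁻¹' T) := by
      rw [← lintegral_indicator_one (measurable_prodMk_left hTm)]
      rfl
    rw [e1]
    have e2 : Prod.mk r ⁻¹' T = (fun y : W => r • y) ⁻¹' {z : W |
        0 < ‖L (WithLp.toLp 2 (z, r * ε))‖ ∧ ‖L (WithLp.toLp 2 (z, r * ε))‖ < 1 ∧
        ‖L (WithLp.toLp 2 (z, r * ε))‖⁻¹ • L (WithLp.toLp 2 (z, r * ε)) ∈ A} := by
      ext y
      exact (cone_mem_iff L hε hr0 y).symm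
    rw [e2, Measure.addHaar_preimage_smul _ hr0.ne', ← mul_assoc, ← ENNReal.ofReal_mul
      (by positivity), abs_of_nonneg (by positivity), mul_inv_cancel₀ (by positivity),
      ENNReal.ofReal_one, one_mul]
  rw [setLIntegral_congr_fun measurableSet_Ioi h1, lintegral_lintegral_swap]
  swap
  · refine Measurable.aemeasurable ?_
    exact ((measurable_fst.pow_const k).ennreal_ofReal).mul (measurable_one.indicator hTm)
  have h2 : ∀ y : W, ∫⁻ r in Ioi (0 : ℝ), ENNReal.ofReal (r ^ k) *
      T.indicator (1 : ℝ × W → ENNReal) (r, y) = (gno L ε ⁻¹' A).indicator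
        (fun y => ENNReal.ofReal ((√(1 + ‖y‖ ^ 2))⁻¹ ^ (k + 1) / (k + 1))) y := by
    intro y
    by_cases hy : y ∈ gno L ε ⁻¹' A
    · rw [indicator_of_mem hy, ← lintegral_pow_Ioo (by positivity), ← Ioi_inter_Iio, inter_comm,
        ← setLIntegral_indicator measurableSet_Iio]
      refine lintegral_congr fun r => ?_
      by_cases hr : r < (√(1 + ‖y‖ ^ 2))⁻¹
      · rw [indicator_of_mem (show (r, y) ∈ T from ⟨hr, hy⟩),
          indicator_of_mem (show r ∈ Iio _ from hr)]
        simp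
      · rw [indicator_of_notMem (fun h : (r, y) ∈ T => hr h.1),
          indicator_of_notMem (show r ∉ Iio _ from hr), mul_zero]
    · rw [indicator_of_notMem hy]
      have : ∀ r, T.indicator (1 : ℝ × W → ENNReal) (r, y) = 0 := fun r =>
        indicator_of_notMem (fun h => hy h.2) _
      simp [this]
  simp only [h2]
  rw [lintegral_indicator (hgm hA), Measure.map_apply hgm hA, gnoMeasure,
    withDensity_apply _ (hgm hA), ← lintegral_const_mul]
  swap
  · exact Measurable.ennreal_ofReal ((Measurable.pow_const (Measurable.inv
      (Continuous.measurable (by fun_prop))) _).div_const _)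
  refine lintegral_congr fun y => ?_
  have : (k + 1 : ENNReal) = ENNReal.ofReal (k + 1) := by
    rw [ENNReal.ofReal_add (by positivity) zero_le_one, ENNReal.ofReal_natCast, ENNReal.ofReal_one]
  rw [this, ← ENNReal.ofReal_mul (by positivity), inv_pow]
  congr 1
  rw [← hk]
  field_simp

/-- The surface measure of the unit sphere in the two gnomonic charts. -/
theorem surf_eq_map_gno :
    surf V = (gnoMeasure W).map (gno L 1) + (gnoMeasure W).map (gno L (-1)) := by
  ext A hA
  rw [Measure.add_apply, ← lintegral_half_cone L hA (one_pow 2),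
    ← lintegral_half_cone L hA neg_one_sq, ← mul_add, surf_apply hA,
    finrank_of_decomposition L]
  push_cast
  congr 1
  set S := {x : V | 0 < ‖x‖ ∧ ‖x‖ < 1 ∧ ‖x‖⁻¹ • x ∈ A} with hS
  have hSm : MeasurableSet S :=
    (measurableSet_lt measurable_const measurable_norm).inter
      ((measurableSet_lt measurable_norm measurable_const).inter
        ((measurable_norm.inv.smul measurable_id) hA))
  have mp := measurePreserving_decomposition L
  -- The truncated cone is sliced by the last coordinate: positive heights give the first chart,
  -- negative heights the second, and height 0 is null.
  rw [← mp.measure_preimage hSm.nullMeasurableSet, Measure.volume_eq_prod,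
    Measure.prod_apply_symm (mp.measurable hSm), ← lintegral_add_compl _ measurableSet_Ioi,
    compl_Ioi, ← setLIntegral_congr Iio_ae_eq_Iic]
  congr 1
  · refine lintegral_congr fun r => ?_
    rw [mul_one]
    rfl
  · have e := (Measure.measurePreserving_neg (volume : Measure ℝ)).setLIntegral_comp_emb
      (MeasurableEquiv.neg ℝ).measurableEmbedding
      (fun r => volume ((fun y : W => (y, r)) ⁻¹'
        ((fun p : W × ℝ => L (WithLp.toLp 2 p)) ⁻¹' S))) (Ioi (0 : ℝ))
    rw [image_neg_Ioi, neg_zero] at e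
    refine e.symm.trans (lintegral_congr fun r => ?_)
    rw [mul_neg_one]
    rfl

variable {F : Type*} [NormedAddCommGroup F] [NormedSpace ℝ F]

theorem integrable_gnoMeasure_iff {f : W → F} :
    Integrable f (gnoMeasure W) ↔
      Integrable (fun y => (√(1 + ‖y‖ ^ 2) ^ (Module.finrank ℝ W + 1))⁻¹ • f y) := by
  rw [gnoMeasure, integrable_withDensity_iff_integrable_smul' measurable_gnoDensity
    (Eventually.of_forall fun _ => ENNReal.ofReal_lt_top)]
  simp_rw [ENNReal.toReal_ofReal (inv_nonneg.2 (pow_nonneg (Real.sqrt_nonneg _) _))]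

theorem integral_gnoMeasure (f : W → F) :
    ∫ y, f y ∂(gnoMeasure W) =
      ∫ y, (√(1 + ‖y‖ ^ 2) ^ (Module.finrank ℝ W + 1))⁻¹ • f y := by
  rw [gnoMeasure, integral_withDensity_eq_integral_toReal_smul measurable_gnoDensity
    (Eventually.of_forall fun _ => ENNReal.ofReal_lt_top)]
  simp_rw [ENNReal.toReal_ofReal (inv_nonneg.2 (pow_nonneg (Real.sqrt_nonneg _) _))]

theorem gnoMeasure_map_neg : (gnoMeasure W).map (fun y => -y) = gnoMeasure W := by
  ext A hA
  rw [Measure.map_apply measurable_neg hA, gnoMeasure, withDensity_apply _ hA,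
    withDensity_apply _ (measurable_neg hA),
    ← (Measure.measurePreserving_neg (volume : Measure W)).setLIntegral_comp_preimage hA
      measurable_gnoDensity]
  simp only [norm_neg]

/-- For an even function the two charts differ by y ↦ -y, which preserves `gnoMeasure`; one chart
suffices. -/
theorem integrable_surf_iff {f : V → F} (hf : ∀ x, f (-x) = f x) :
    Integrable f (surf V) ↔ Integrable (fun y => f (gno L 1 y)) (gnoMeasure W) := by
  rw [surf_eq_map_gno L, integrable_add_measure,
    (measurableEmbedding_gno L one_ne_zero).integrable_map_iff,
    (measurableEmbedding_gno L (neg_ne_zero.2 one_ne_zero)).integrable_map_iff]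
  have : f ∘ gno L (-1) = (f ∘ gno L 1) ∘ fun y => -y := by
    funext y
    simp only [Function.comp_apply, gno_neg, hf]
  have h : (gnoMeasure W).map (MeasurableEquiv.neg W) = gnoMeasure W := gnoMeasure_map_neg
  have e := (MeasurableEquiv.neg W).measurableEmbedding.integrable_map_iff
    (μ := gnoMeasure W) (g := f ∘ gno L 1)
  rw [h] at e
  rw [this]
  exact ⟨fun h => h.1, fun h => ⟨h, e.1 h⟩⟩

theorem integral_surf {f : V → F} (hf : ∀ x, f (-x) = f x) :
    ∫ x, f x ∂(surf V) = (2 : ℝ) • ∫ y, f (gno L 1 y) ∂(gnoMeasure W) := by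
  -- Without integrability both integrals take the default value 0, so no hypothesis on f is needed.
  by_cases hi : Integrable f (surf V)
  swap
  · rw [integral_undef hi, integral_undef (fun h => hi ((integrable_surf_iff L hf).2 h)), smul_zero]
  have hi' := hi
  rw [surf_eq_map_gno L, integrable_add_measure] at hi'
  rw [surf_eq_map_gno L, integral_add_measure hi'.1 hi'.2,
    (measurableEmbedding_gno L one_ne_zero).integral_map,
    (measurableEmbedding_gno L (neg_ne_zero.2 one_ne_zero)).integral_map]
  have h : (gnoMeasure W).map (MeasurableEquiv.neg W) = gnoMeasure W := gnoMeasure_map_neg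
  have : ∫ y, f (gno L (-1) y) ∂(gnoMeasure W) = ∫ y, f (gno L 1 y) ∂(gnoMeasure W) := by
    conv_rhs => rw [← h, (MeasurableEquiv.neg W).measurableEmbedding.integral_map]
    refine integral_congr_ae (Eventually.of_forall fun y => ?_)
    simp only [gno_neg, hf]
    rfl
  rw [this, two_smul]

/-- The integrand over the affine hyperplane at height `h` that corresponds to a function `f`
on the sphere. -/
theorem gno_smul {h : ℝ} (hh : 0 < h) (f : V → F) (y : W) :
    (√(1 + ‖h⁻¹ • y‖ ^ 2) ^ (Module.finrank ℝ W + 1))⁻¹ • f (gno L 1 (h⁻¹ • y)) =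
      (h ^ (Module.finrank ℝ W + 1) / √(‖y‖ ^ 2 + h ^ 2) ^ (Module.finrank ℝ W + 1)) •
        f ((√(‖y‖ ^ 2 + h ^ 2))⁻¹ • L (WithLp.toLp 2 (y, h))) := by
  have e : √(1 + ‖h⁻¹ • y‖ ^ 2) = h⁻¹ * √(‖y‖ ^ 2 + h ^ 2) := by
    rw [norm_smul, norm_inv, Real.norm_of_nonneg hh.le, ← Real.sqrt_sq (inv_pos.2 hh).le,
      ← Real.sqrt_mul (sq_nonneg _), Real.sqrt_sq (inv_pos.2 hh).le]
    congr 1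
    field_simp
    ring
  have e2 : L (WithLp.toLp 2 (h⁻¹ • y, 1)) = h⁻¹ • L (WithLp.toLp 2 (y, h)) := by
    rw [← decomposition_smul, inv_mul_cancel₀ hh.ne']
  rw [gno, e, e2, smul_smul, mul_inv, inv_inv, mul_right_comm, mul_inv_cancel₀ hh.ne', one_mul,
    mul_pow, mul_inv, inv_pow, inv_inv, div_eq_mul_inv]

/-- Dilation of the chart at height 1. Height h is needed because τ lies at distance √(1 + t²) from
the origin inside `perp (muTilde η t)`. -/
theorem integrable_surf_iff_height {h : ℝ} (hh : 0 < h) {f : V → F} (hf : ∀ x, f (-x) = f x) :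
    Integrable f (surf V) ↔ Integrable (fun y : W =>
      (√(‖y‖ ^ 2 + h ^ 2) ^ (Module.finrank ℝ W + 1))⁻¹ •
        f ((√(‖y‖ ^ 2 + h ^ 2))⁻¹ • L (WithLp.toLp 2 (y, h)))) := by
  rw [integrable_surf_iff L hf, integrable_gnoMeasure_iff,
    ← integrable_comp_smul_iff volume _ (inv_ne_zero hh.ne')]
  simp_rw [gno_smul L hh, div_eq_mul_inv, mul_smul]
  exact integrable_smul_iff (pow_ne_zero _ hh.ne') _

theorem integral_surf_height {h : ℝ} (hh : 0 < h) {f : V → F} (hf : ∀ x, f (-x) = f x) :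
    ∫ x, f x ∂(surf V) = (2 * h) • ∫ y : W, (√(‖y‖ ^ 2 + h ^ 2) ^ (Module.finrank ℝ W + 1))⁻¹ •
        f ((√(‖y‖ ^ 2 + h ^ 2))⁻¹ • L (WithLp.toLp 2 (y, h))) := by
  have e := Measure.integral_comp_inv_smul_of_nonneg (volume : Measure W)
    (fun y => (√(1 + ‖y‖ ^ 2) ^ (Module.finrank ℝ W + 1))⁻¹ • f (gno L 1 y)) hh.le
  simp_rw [gno_smul L hh, div_eq_mul_inv, mul_smul] at e
  rw [integral_smul, pow_succ, mul_smul] at e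
  have e' := smul_right_injective F (pow_ne_zero (Module.finrank ℝ W) hh.ne') e
  rw [integral_surf L hf, integral_gnoMeasure, ← e', smul_smul]

end Gnomonic

/-! ### Coordinates of ℝⁿ⁺¹ and the operator B. -/

section Lift

variable {n : ℕ}

@[simp] theorem head_lift (x : E n) (c : ℝ) : head (lift x c) = x := by
  ext i; simp [head, lift]

@[simp] theorem last_lift (x : E n) (c : ℝ) : last (lift x c) = c := by
  simp [last, lift]

theorem lift_head_last (θ : E (n + 1)) : lift (head θ) (last θ) = θ := by
  ext i
  refine Fin.lastCases ?_ (fun j => ?_) i <;> simp [head, lift, last]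

theorem head_add (x y : E (n + 1)) : head (x + y) = head x + head y := by
  ext i; simp [head]

theorem head_smul (c : ℝ) (x : E (n + 1)) : head (c • x) = c • head x := by
  ext i; simp [head]

theorem last_add (x y : E (n + 1)) : last (x + y) = last x + last y := by simp [last]

theorem last_smul (c : ℝ) (x : E (n + 1)) : last (c • x) = c * last x := by simp [last]

theorem lift_add (x y : E n) (c d : ℝ) : lift (x + y) (c + d) = lift x c + lift y d := by
  rw [← lift_head_last (lift x c + lift y d)]
  simp [head_add, last_add]

theorem lift_smul (a : ℝ) (x : E n) (c : ℝ) : lift (a • x) (a * c) = a • lift x c := by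
  rw [← lift_head_last (a • lift x c)]
  simp [head_smul, last_smul]

theorem inner_eq_head_last (x y : E (n + 1)) : ⟪x, y⟫ = ⟪head x, head y⟫ + last x * last y := by
  rw [PiLp.inner_apply, Fin.sum_univ_castSucc, PiLp.inner_apply]
  simp [head, last, mul_comm]

theorem inner_lift (x y : E n) (c d : ℝ) : ⟪lift x c, lift y d⟫ = ⟪x, y⟫ + c * d := by
  simp [inner_eq_head_last]

theorem norm_lift_sq (x : E n) (c : ℝ) : ‖lift x c‖ ^ 2 = ‖x‖ ^ 2 + c ^ 2 := by
  rw [← real_inner_self_eq_norm_sq, inner_lift, real_inner_self_eq_norm_sq, sq c]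

theorem norm_lift (x : E n) (c : ℝ) : ‖lift x c‖ = √(‖x‖ ^ 2 + c ^ 2) := by
  rw [← norm_lift_sq, Real.sqrt_sq (norm_nonneg _)]

variable (n) in
/-- The decomposition `ℝⁿ⁺¹ = ℝⁿ ⊕ ℝ`. -/
def liftIso : WithLp 2 (E n × ℝ) ≃ₗᵢ[ℝ] E (n + 1) where
  toFun p := lift p.fst p.snd
  invFun θ := WithLp.toLp 2 (head θ, last θ)
  map_add' p q := by simp [lift_add]
  map_smul' c p := by simp [lift_smul]
  left_inv p := by
    change WithLp.toLp 2 (head (lift p.fst p.snd), last (lift p.fst p.snd)) = p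
    rw [head_lift, last_lift]
    rfl
  right_inv θ := lift_head_last θ
  norm_map' p := by
    change ‖lift p.fst p.snd‖ = _
    rw [WithLp.prod_norm_eq_of_L2, norm_lift, Real.norm_eq_abs, sq_abs]

theorem liftIso_apply (x : E n) (c : ℝ) : liftIso n (WithLp.toLp 2 (x, c)) = lift x c := rfl

variable {𝕜 : Type*} [RCLike 𝕜]

theorem opB_neg (g : E n → 𝕜) (θ : E (n + 1)) : opB g (-θ) = opB g θ := by
  have h1 : last (-θ) = -last θ := by simp [last]
  have h2 : head (-θ) = -head θ := by ext i; simp [head]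
  rw [opB, opB, h1, h2, abs_neg, inv_neg, smul_neg, neg_smul, neg_neg]

/-- This is the homogeneity of degree -n of `opB g`; it absorbs the powers of the norm in the chart
densities. -/
theorem opB_smul_lift (g : E n → 𝕜) {c : ℝ} (hc : 0 < c) (x : E n) :
    opB g (c⁻¹ • lift x 1) = c ^ n • g x := by
  rw [opB, last_smul, head_smul, head_lift, last_lift, mul_one, inv_inv, smul_inv_smul₀ hc.ne',
    abs_of_pos (inv_pos.2 hc), inv_pow, inv_inv]

theorem opBinv_opB (g : E n → 𝕜) (x : E n) : opBinv (opB g) x = g x := by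
  have h : 0 < ‖lift x 1‖ := by rw [norm_lift]; positivity
  rw [opBinv, mu, opB_smul_lift g h, smul_smul]
  have h2 : (1 + ‖x‖ ^ 2) ^ (-(n : ℝ) / 2) = (‖lift x 1‖ ^ n)⁻¹ := by
    have h3 : 0 < 1 + ‖x‖ ^ 2 := by positivity
    rw [norm_lift, one_pow, add_comm (‖x‖ ^ 2), neg_div, Real.rpow_neg h3.le, Real.sqrt_eq_rpow,
      ← Real.rpow_natCast _ n, ← Real.rpow_mul h3.le, one_div_mul_eq_div]
  rw [h2, inv_mul_cancel₀ (pow_ne_zero _ h.ne'), one_smul]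

/-- Against the chart density of exponent n + 1, homogeneity gives back n powers of √(1 + |x|²), and
what is left is the weight in the hypothesis on `g`. -/
theorem integrable_surf_opB (g : E n → 𝕜) (hg : AEStronglyMeasurable g volume)
    (hint : Integrable (fun x : E n => ‖g x‖ / √(1 + ‖x‖ ^ 2)) volume) :
    Integrable (opB g) (surf (E (n + 1))) := by
  rw [integrable_surf_iff_height (liftIso n) one_pos (opB_neg g)]
  have e : ∀ y : E n, (√(‖y‖ ^ 2 + 1 ^ 2) ^ (Module.finrank ℝ (E n) + 1))⁻¹ •
      opB g ((√(‖y‖ ^ 2 + 1 ^ 2))⁻¹ • liftIso n (WithLp.toLp 2 (y, 1))) =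
      (√(1 + ‖y‖ ^ 2))⁻¹ • g y := by
    intro y
    have : 0 < √(‖y‖ ^ 2 + 1 ^ 2) := by positivity
    rw [liftIso_apply, opB_smul_lift g this, smul_smul, finrank_euclideanSpace_fin, pow_succ,
      mul_inv, mul_right_comm, inv_mul_cancel₀ (pow_ne_zero _ this.ne'), one_mul, one_pow,
      add_comm (‖y‖ ^ 2)]
  simp_rw [e]
  refine hint.mono ?_ (Eventually.of_forall fun y => ?_)
  · refine AEStronglyMeasurable.smul (Continuous.aestronglyMeasurable ?_) hg
    exact Continuous.inv₀ (by fun_prop) fun y => by positivity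
  · rw [norm_smul, norm_div, norm_norm, norm_inv, div_eq_inv_mul]

/-- The decomposition of the hyperplane `μ̃(τ)^⊥` of `ℝⁿ⁺¹` as the sum of the direction of `τ` and
the line through the point of `τ` nearest to the origin. -/
theorem exists_hyperplane_decomposition {η : E n} (hη : ‖η‖ = 1) (t : ℝ) :
    ∃ L : WithLp 2 (perp η × ℝ) ≃ₗᵢ[ℝ] perp (muTilde η t),
      ∀ y : perp η,
        (L (WithLp.toLp 2 (y, √(1 + t ^ 2))) : E (n + 1)) = lift (t • η + (y : E n)) 1 := by
  have hh : 0 < √(1 + t ^ 2) := by positivity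
  -- `ζ` is the unit vector towards (tη, 1), the point of τ × {1} closest to the origin, whose norm
  -- is √(1 + t²).
  obtain ⟨ζ, hζ⟩ : ∃ ζ : E (n + 1), ζ = (√(1 + t ^ 2))⁻¹ • lift (t • η) 1 := ⟨_, rfl⟩
  have hηη : ⟪η, η⟫ = 1 := by rw [real_inner_self_eq_norm_sq, hη, one_pow]
  have hc : 0 < Real.cos (Real.arctan t) := Real.cos_arctan_pos t
  have hst : Real.sin (Real.arctan t) = t * Real.cos (Real.arctan t) := by
    rw [Real.sin_arctan, Real.cos_arctan]; ring
  have hm1 : ⟪muTilde η t, lift (t • η) 1⟫ = 0 := by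
    rw [muTilde, inner_lift, inner_neg_left, real_inner_smul_left, real_inner_smul_right, hηη, hst]
    ring
  have hm2 : ∀ y : perp η, ⟪muTilde η t, lift (y : E n) 0⟫ = 0 := by
    intro y
    rw [muTilde, inner_lift, inner_neg_left, real_inner_smul_left,
      Submodule.mem_orthogonal_singleton_iff_inner_right.1 y.2]
    ring
  have hmem : ∀ p : WithLp 2 (perp η × ℝ),
      lift (p.fst : E n) 0 + p.snd • ζ ∈ perp (muTilde η t) := by
    intro p
    rw [Submodule.mem_orthogonal_singleton_iff_inner_right, inner_add_right, hm2,
      real_inner_smul_right, hζ, real_inner_smul_right, hm1]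
    ring
  let f : WithLp 2 (perp η × ℝ) →ₗ[ℝ] perp (muTilde η t) :=
    { toFun := fun p => ⟨lift (p.fst : E n) 0 + p.snd • ζ, hmem p⟩
      map_add' := fun p q => by
        ext1
        have := lift_add (p.fst : E n) (q.fst : E n) 0 0
        rw [add_zero] at this
        simp only [WithLp.add_fst, WithLp.add_snd, Submodule.coe_add, this, add_smul]
        abel
      map_smul' := fun c p => by
        ext1
        have := lift_smul c (p.fst : E n) 0
        rw [mul_zero] at this
        simp only [WithLp.smul_fst, WithLp.smul_snd, Submodule.coe_smul, this, smul_add,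
          RingHom.id_apply, smul_eq_mul, mul_smul] }
  have hζ2 : ⟪ζ, ζ⟫ = 1 := by
    rw [hζ, real_inner_smul_left, real_inner_smul_right, inner_lift, real_inner_smul_left,
      real_inner_smul_right, hηη]
    have := Real.mul_self_sqrt (show 0 ≤ 1 + t ^ 2 by positivity)
    field_simp
    linear_combination -this
  have hyζ : ∀ y : perp η, ⟪lift (y : E n) 0, ζ⟫ = 0 := by
    intro y
    rw [hζ, real_inner_smul_right, inner_lift, real_inner_smul_right,
      Submodule.mem_orthogonal_singleton_iff_inner_left.1 y.2]
    ring
  have hnorm : ∀ p, ‖f p‖ = ‖p‖ := by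
    intro p
    rw [← sq_eq_sq₀ (norm_nonneg _) (norm_nonneg _), WithLp.prod_norm_sq_eq_of_L2,
      ← real_inner_self_eq_norm_sq]
    change ⟪lift (p.fst : E n) 0 + p.snd • ζ, lift (p.fst : E n) 0 + p.snd • ζ⟫ = _
    rw [real_inner_add_add_self, real_inner_smul_right, real_inner_smul_right,
      real_inner_smul_left, hyζ, hζ2, inner_lift, real_inner_self_eq_norm_sq, Submodule.coe_norm,
      Real.norm_eq_abs, sq_abs]
    ring
  have hn : 0 < n := by
    rcases Nat.eq_zero_or_pos n with rfl | h
    · simp [Subsingleton.elim η 0] at hη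
    · exact h
  obtain ⟨m, rfl⟩ : ∃ m, n = m + 1 := ⟨n - 1, by omega⟩
  have : Fact (Module.finrank ℝ (E (m + 1)) = m + 1) := ⟨finrank_euclideanSpace_fin⟩
  have : Fact (Module.finrank ℝ (E (m + 1 + 1)) = m + 1 + 1) := ⟨finrank_euclideanSpace_fin⟩
  have hθ0 : muTilde η t ≠ 0 := by
    intro h
    have h1 := congrArg head h
    rw [muTilde, head_lift] at h1
    have h2 : head (0 : E (m + 1 + 1)) = 0 := by ext i; simp [head]
    rw [h2, neg_eq_zero, smul_eq_zero] at h1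
    rcases h1 with h1 | h1
    · exact hc.ne' h1
    · simp [h1] at hη
  have hdim : Module.finrank ℝ (WithLp 2 (perp η × ℝ)) =
      Module.finrank ℝ (perp (muTilde η t)) := by
    rw [(WithLp.linearEquiv 2 ℝ (perp η × ℝ)).finrank_eq, Module.finrank_prod,
      Module.finrank_self,
      Submodule.finrank_orthogonal_span_singleton (n := m) (fun h => by simp [h] at hη),
      Submodule.finrank_orthogonal_span_singleton (n := m + 1) hθ0]
  refine ⟨LinearIsometry.toLinearIsometryEquiv ⟨f, hnorm⟩ hdim, fun y => ?_⟩
  rw [LinearIsometry.coe_toLinearIsometryEquiv]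
  change lift (y : E (m + 1)) 0 + √(1 + t ^ 2) • ζ = _
  rw [hζ, smul_inv_smul₀ hh.ne', ← lift_add, zero_add, add_comm (y : E (m + 1))]

end Lift

/-! ### Integrals over great spheres. -/

section Great

variable {d : ℕ} {𝕜 : Type*} [RCLike 𝕜]

theorem integrable_great_iff {θ : E d} {F : perp θ → 𝕜} :
    Integrable (fun ξ : GreatSph θ => F ξ) (greatMeasure θ) ↔ Integrable F (surf (perp θ)) :=
  (measurableEmbedding_sphere.integrable_map_iff (g := F)).symm

theorem integral_great {θ : E d} (F : perp θ → 𝕜) :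
    ∫ ξ : GreatSph θ, F ξ ∂(greatMeasure θ) = ∫ x, F x ∂(surf (perp θ)) :=
  (measurableEmbedding_sphere.integral_map F).symm

theorem average_great {θ : E d} (F : perp θ → 𝕜) :
    ⨍ ξ : GreatSph θ, F ξ ∂(greatMeasure θ) = ∫ x, F x ∂(unif (perp θ)) := by
  have h : surf (perp θ) univ = greatMeasure θ univ := by
    rw [surf, Measure.map_apply measurable_subtype_coe .univ, preimage_univ]; rfl
  rw [average_eq, integral_great, unif, integral_smul_measure, h, ENNReal.toReal_inv]
  rfl

end Great

/-! ### The factorization R = AFB. -/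

section Planes

variable {n : ℕ} {𝕜 : Type*} [RCLike 𝕜]

theorem finrank_perp {d : ℕ} {θ : E (d + 1)} (hθ : ‖θ‖ = 1) : Module.finrank ℝ (perp θ) = d := by
  have : Fact (Module.finrank ℝ (E (d + 1)) = d + 1) := ⟨finrank_euclideanSpace_fin⟩
  exact Submodule.finrank_orthogonal_span_singleton (fun h => by simp [h] at hθ)

theorem norm_muTilde {η : E n} (hη : ‖η‖ = 1) (t : ℝ) : ‖muTilde η t‖ = 1 := by
  rw [muTilde, norm_lift, norm_neg, norm_smul, hη, mul_one, Real.norm_eq_abs, sq_abs,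
    Real.cos_sq_add_sin_sq, Real.sqrt_one]

/-- The direction of τ has dimension n - 1, so the chart density has exponent n, the degree of
homogeneity of `opB g`. The two cancel exactly, and `g` on τ appears unweighted. -/
theorem opB_plane (hn : n ≠ 0) (g : E n → 𝕜) {η : E n} (hη : ‖η‖ = 1) (t : ℝ)
    (L : WithLp 2 (perp η × ℝ) ≃ₗᵢ[ℝ] perp (muTilde η t))
    (hL : ∀ y : perp η,
      (L (WithLp.toLp 2 (y, √(1 + t ^ 2))) : E (n + 1)) = lift (t • η + (y : E n)) 1)
    (y : perp η) :
    (√(‖y‖ ^ 2 + √(1 + t ^ 2) ^ 2) ^ (Module.finrank ℝ (perp η) + 1))⁻¹ •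
      opB g (((√(‖y‖ ^ 2 + √(1 + t ^ 2) ^ 2))⁻¹ •
        L (WithLp.toLp 2 (y, √(1 + t ^ 2))) : perp (muTilde η t)) : E (n + 1)) =
      g (t • η + (y : E n)) := by
  obtain ⟨m, rfl⟩ : ∃ m, n = m + 1 := ⟨n - 1, by omega⟩
  have hp : 0 < √(‖y‖ ^ 2 + √(1 + t ^ 2) ^ 2) := by positivity
  rw [Submodule.coe_smul, hL, opB_smul_lift g hp, finrank_perp hη, smul_smul,
    inv_mul_cancel₀ (pow_ne_zero _ hp.ne'), one_smul]

theorem planeIntegrable_iff (hn : n ≠ 0) (g : E n → 𝕜) {η : E n} (hη : ‖η‖ = 1) (t : ℝ) :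
    PlaneIntegrable g η t ↔ GreatIntegrable (opB g) (muTilde η t) := by
  obtain ⟨L, hL⟩ := exists_hyperplane_decomposition hη t
  have h := integrable_surf_iff_height L (h := √(1 + t ^ 2)) (by positivity)
    (f := fun v : perp (muTilde η t) => opB g (v : E (n + 1))) (fun v => opB_neg g v)
  simp_rw [opB_plane hn g hη t L hL] at h
  exact h.symm.trans (integrable_great_iff
    (F := fun v : perp (muTilde η t) => opB g (v : E (n + 1)))).symm

/-- `integral_surf_height` on the great sphere, at height √(1 + t²), combined with `opB_plane`. The
constant in `opA` is the area of the great sphere over twice that height. The identity persists, as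
0 = 0, when `g` is not integrable over τ. -/
theorem radon_eq_opA (hn : n ≠ 0) (g : E n → 𝕜) {η : E n} (hη : ‖η‖ = 1) (t : ℝ) :
    radon g η t = opA (funk (opB g)) η t := by
  obtain ⟨L, hL⟩ := exists_hyperplane_decomposition hη t
  have hh : 0 < √(1 + t ^ 2) := by positivity
  have h := integral_surf_height L hh
    (f := fun v : perp (muTilde η t) => opB g (v : E (n + 1))) (fun v => opB_neg g v)
  simp_rw [opB_plane hn g hη t L hL] at h
  have hfin : Module.finrank ℝ (perp (muTilde η t)) = n := finrank_perp (norm_muTilde hη t)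
  have : Nontrivial (perp (muTilde η t)) :=
    Module.nontrivial_of_finrank_pos (R := ℝ) (by omega)
  have hσ := sphArea_pos (Nat.pos_of_ne_zero hn)
  rw [opA, funk, average_great (fun v : perp (muTilde η t) => opB g (v : E (n + 1))), unif,
    integral_smul_measure, h, surf_univ_toReal hfin, smul_smul, smul_smul, ENNReal.toReal_inv,
    ENNReal.toReal_ofReal hσ.le, radon]
  have : sphArea n / (2 * √(1 + t ^ 2)) * ((sphArea n)⁻¹ * (2 * √(1 + t ^ 2))) = 1 := by
    field_simp
  rw [mul_assoc, this, one_smul]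

theorem opAinv_opA (F : E (n + 1) → 𝕜) {ω : E (n + 1)} (hn : n ≠ 0) (hω : ‖ω‖ = 1)
    (hω' : head ω ≠ 0) : opAinv (opA F) ω = F ω := by
  have hp : 0 < ‖head ω‖ := norm_pos_iff.2 hω'
  have hσ := sphArea_pos (Nat.pos_of_ne_zero hn)
  have h1 : ‖head ω‖ ^ 2 + last ω ^ 2 = 1 := by
    rw [← norm_lift_sq, lift_head_last, hω, one_pow]
  have h2 : √(1 + (last ω / ‖head ω‖) ^ 2) = ‖head ω‖⁻¹ := by
    rw [← Real.sqrt_sq (inv_pos.2 hp).le]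
    congr 1
    field_simp
    linarith
  have h3 : muTilde (-(‖head ω‖⁻¹ • head ω)) (last ω / ‖head ω‖) = ω := by
    rw [muTilde, Real.cos_arctan, Real.sin_arctan, h2, one_div, inv_inv, smul_neg, neg_neg,
      smul_inv_smul₀ hp.ne', div_div, mul_inv_cancel₀ hp.ne', div_one, lift_head_last]
  rw [opAinv, opA, h2, h3, smul_smul]
  have : 2 / (sphArea n * ‖head ω‖) * (sphArea n / (2 * ‖head ω‖⁻¹)) = 1 := by
    field_simp
  rw [this, one_smul]

/-- The excluded points lie on the last coordinate axis, a proper subspace because n + 1 ≥ 2. -/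
theorem ae_head_ne_zero (hn : n ≠ 0) : ∀ᵐ ω ∂(surf (E (n + 1))), head ω ≠ 0 := by
  have hS : (ℝ ∙ (lift (0 : E n) 1)) ≠ ⊤ := by
    intro h
    have := finrank_span_le_card (R := ℝ) ({lift (0 : E n) 1} : Set (E (n + 1)))
    rw [h, finrank_top, finrank_euclideanSpace_fin] at this
    simp at this
    omega
  filter_upwards [measure_eq_zero_iff_ae_notMem.1 (surf_submodule _ hS)] with ω hω h
  refine hω (Submodule.mem_span_singleton.2 ⟨last ω, ?_⟩)
  rw [← lift_smul, smul_zero, mul_one, ← h, lift_head_last]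

theorem opAinv_radon_ae (hn : n ≠ 0) (g : E n → 𝕜) :
    ∀ᵐ ω ∂(surf (E (n + 1))), opAinv (radon g) ω = funk (opB g) ω := by
  filter_upwards [ae_head_ne_zero hn, ae_surf_norm_eq_one] with ω h0 h1
  rw [← opAinv_opA (funk (opB g)) hn h1 h0, opAinv, opAinv, radon_eq_opA hn]
  rw [norm_neg, norm_smul, norm_inv, norm_norm, inv_mul_cancel₀ (norm_ne_zero_iff.2 h0)]

end Planes

/-! ### Fubini for points and great spheres. -/

section GreatLaw

variable {n : ℕ} {F : Type*} [NormedAddCommGroup F] [NormedSpace ℝ F] {𝕜 : Type*} [RCLike 𝕜]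

/-- The uniform distribution on the great sphere orthogonal to `θ`. -/
def greatLaw {d : ℕ} (θ : E d) : Measure (E d) := (unif (E d)).map (dirPerp θ)

theorem nontrivial_E (n : ℕ) : Nontrivial (E (n + 1)) :=
  Module.nontrivial_of_finrank_pos (R := ℝ) (by rw [finrank_euclideanSpace_fin]; omega)

theorem exists_unit_orthogonal (hn : n ≠ 0) {θ : E (n + 1)} (hθ : ‖θ‖ = 1) :
    ∃ η : E (n + 1), ‖η‖ = 1 ∧ ⟪θ, η⟫ = 0 :=
  exists_unit_inner_eq_zero finrank_euclideanSpace_fin hn hθ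

theorem greatLaw_eq (hn : n ≠ 0) {θ : E (n + 1)} (hθ : ‖θ‖ = 1) :
    greatLaw θ = (unif (perp θ)).map (Subtype.val : perp θ → E (n + 1)) := by
  obtain ⟨η, hη, hθη⟩ := exists_unit_orthogonal hn hθ
  exact map_dirPerp hθ hη hθη

theorem measurableEmbedding_perp {d : ℕ} (θ : E d) :
    MeasurableEmbedding (Subtype.val : perp θ → E d) :=
  MeasurableEmbedding.subtype_coe (Submodule.isClosed_orthogonal _).measurableSet

theorem nontrivial_perp (hn : n ≠ 0) {θ : E (n + 1)} (hθ : ‖θ‖ = 1) : Nontrivial (perp θ) :=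
  Module.nontrivial_of_finrank_pos (R := ℝ) (by rw [finrank_perp hθ]; omega)

theorem integrable_greatMeasure_iff (hn : n ≠ 0) {θ : E (n + 1)} (hθ : ‖θ‖ = 1)
    {f : E (n + 1) → F} :
    Integrable (fun ξ : GreatSph θ => f ((ξ : perp θ) : E (n + 1))) (greatMeasure θ) ↔
      Integrable f (greatLaw θ) := by
  have := nontrivial_perp hn hθ
  rw [greatLaw_eq hn hθ, (measurableEmbedding_perp θ).integrable_map_iff, unif,
    integrable_smul_measure (ENNReal.inv_ne_zero.2 (measure_ne_top _ _))
      (ENNReal.inv_ne_top.2 surf_univ_ne_zero)]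
  exact (measurableEmbedding_sphere.integrable_map_iff
    (g := fun x : perp θ => f (x : E (n + 1)))).symm

theorem average_greatMeasure (hn : n ≠ 0) {θ : E (n + 1)} (hθ : ‖θ‖ = 1)
    (f : E (n + 1) → 𝕜) :
    ⨍ ξ : GreatSph θ, f ((ξ : perp θ) : E (n + 1)) ∂(greatMeasure θ) =
      ∫ x, f x ∂(greatLaw θ) := by
  rw [average_great (fun x : perp θ => f (x : E (n + 1))), greatLaw_eq hn hθ,
    (measurableEmbedding_perp θ).integral_map]

theorem ae_zon_of_ae (hn : n ≠ 0) {P : E (n + 1) → Prop} (hP : ∀ᵐ x ∂(surf (E (n + 1))), P x)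
    {t : ℝ} (ht : |t| ≤ 1) :
    ∀ᵐ θ ∂(surf (E (n + 1))), ∀ᵐ x ∂(unif (E (n + 1))), P (zon t θ x) := by
  rw [← surf_eq_map_zon finrank_euclideanSpace_fin hn ht] at hP
  exact Measure.ae_ae_of_ae_prod (ae_of_ae_map (measurable_zon_prod t).aemeasurable hP)

/-- Almost everywhere statements are passed through pushforwards in the direction that needs a
measurable set; this supplies one. -/
theorem exists_measurableSet_of_ae {α : Type*} [MeasurableSpace α] {μ : Measure α} {P : α → Prop}
    (hP : ∀ᵐ x ∂μ, P x) : ∃ S : Set α, MeasurableSet S ∧ (∀ᵐ x ∂μ, x ∈ S) ∧ ∀ x ∈ S, P x := by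
  obtain ⟨N, hN, hNm, hN0⟩ := exists_measurable_superset_of_null (ae_iff.1 hP)
  refine ⟨Nᶜ, hNm.compl, measure_eq_zero_iff_ae_notMem.1 hN0, fun x hx => ?_⟩
  by_contra h
  exact hx (hN h)

/-- A uniform point of a uniform great sphere is uniform on the sphere: this is `surf_eq_map_zon` at
height 0. So a null set meets almost every great sphere in a null set. -/
theorem ae_greatLaw_of_ae (hn : n ≠ 0) {P : E (n + 1) → Prop}
    (hP : ∀ᵐ x ∂(surf (E (n + 1))), P x) :
    ∀ᵐ θ ∂(surf (E (n + 1))), ∀ᵐ x ∂(greatLaw θ), P x := by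
  obtain ⟨S, hS, hS1, hSP⟩ := exists_measurableSet_of_ae hP
  filter_upwards [ae_zon_of_ae hn hS1 (t := 0) (by simp)] with θ hθ
  simp only [zon_zero] at hθ
  filter_upwards [(ae_map_iff (measurable_dirPerp_right θ).aemeasurable hS).2 hθ] with x hx
    using hSP x hx

theorem ae_integrable_greatLaw (hn : n ≠ 0) {f : E (n + 1) → F}
    (hf : Integrable f (surf (E (n + 1)))) :
    ∀ᵐ θ ∂(surf (E (n + 1))), Integrable f (greatLaw θ) := by
  have hi : Integrable (fun p : E (n + 1) × E (n + 1) => hf.1.mk f (zon 0 p.1 p.2))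
      ((surf (E (n + 1))).prod (unif (E (n + 1)))) := by
    have h0 := hf.congr hf.1.ae_eq_mk
    -- The representative depends on the measure through `hf`; it is made opaque before the measure
    -- is rewritten.
    generalize hf.1.mk f = f' at h0
    rw [← surf_eq_map_zon finrank_euclideanSpace_fin hn (t := 0) (by simp)] at h0
    exact (integrable_map_measure h0.1 (measurable_zon_prod 0).aemeasurable).1 h0
  have := nontrivial_E n
  filter_upwards [hi.prod_right_ae, ae_greatLaw_of_ae hn hf.1.ae_eq_mk] with θ h1 h2
  refine Integrable.congr ?_ (h2.mono fun x hx => hx.symm)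
  simp only [zon_zero] at h1
  exact (integrable_map_measure hf.1.stronglyMeasurable_mk.aestronglyMeasurable
    (measurable_dirPerp_right θ).aemeasurable).2 h1

end GreatLaw

/-! ### Cones over null sets. -/

section ConeNull

variable {V : Type*} [NormedAddCommGroup V] [InnerProductSpace ℝ V] [FiniteDimensional ℝ V]
  [MeasurableSpace V] [BorelSpace V]

/-- The truncated cone over a null set of the sphere is null by `surf_apply`, and countably many of
its dilates cover the whole cone except the origin. -/
theorem ae_direction_of_ae_surf [Nontrivial V] {S : Set V} (hS : MeasurableSet S)
    (h : ∀ᵐ x ∂(surf V), x ∈ S) : ∀ᵐ x : V, ‖x‖⁻¹ • x ∈ S := by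
  have h0 : surf V Sᶜ = 0 := h
  rw [surf_apply hS.compl, mul_eq_zero, Nat.cast_eq_zero] at h0
  have h1 := h0.resolve_left Module.finrank_pos.ne'
  rw [ae_iff]
  refine measure_mono_null (t := {0} ∪ ⋃ k : ℕ, (fun x : V => ((k : ℝ) + 1)⁻¹ • x) ⁻¹'
    {x | 0 < ‖x‖ ∧ ‖x‖ < 1 ∧ ‖x‖⁻¹ • x ∈ Sᶜ}) ?_ ?_
  · intro x hx
    rcases eq_or_ne x 0 with rfl | hx0
    · exact .inl rfl
    · right
      obtain ⟨k, hk⟩ := exists_nat_gt ‖x‖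
      have hk1 : (0 : ℝ) < k + 1 := by positivity
      have hp : 0 < ‖x‖ := norm_pos_iff.2 hx0
      refine mem_iUnion.2 ⟨k, ?_, ?_, ?_⟩
      · exact norm_pos_iff.2 (smul_ne_zero (by positivity) hx0)
      · rw [norm_smul, norm_inv, Real.norm_of_nonneg hk1.le, inv_mul_lt_iff₀ hk1]
        linarith
      · rw [norm_smul, norm_inv, Real.norm_of_nonneg hk1.le, smul_smul, mul_inv, inv_inv,
          mul_right_comm, mul_inv_cancel₀ hk1.ne', one_mul]
        exact hx
  · refine measure_union_null (measure_singleton 0) (measure_iUnion_null fun k => ?_)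
    rw [Measure.addHaar_preimage_smul _ (by positivity), h1, mul_zero]

end ConeNull

/-! ### Null sets of hyperplanes. -/

section HyperplaneMeasure

variable {n : ℕ}

/-- The parametrization of points of `Sⁿ` by hyperplanes of `ℝⁿ` is nonsingular. -/
theorem ae_muTilde_of_ae {P : E (n + 1) → Prop}
    (hP : ∀ᵐ x ∂(surf (E (n + 1))), P x) :
    ∀ᵐ τ : Sph n × ℝ ∂((sphMeasure n).prod volume), P (muTilde (τ.1 : E n) τ.2) := by
  obtain ⟨S, hS, hS1, hSP⟩ := exists_measurableSet_of_ae hP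
  have := nontrivial_E n
  have cl : Continuous fun p : E n × ℝ => lift p.1 p.2 := continuous_decomposition (liftIso n)
  have hd : Measurable fun x : E (n + 1) => ‖x‖⁻¹ • x := measurable_norm.inv.smul measurable_id
  have hdir : ∀ (c : ℝ) (x : E (n + 1)), 0 < c → ‖c • x‖⁻¹ • c • x = ‖x‖⁻¹ • x := by
    intro c x hc
    rw [norm_smul, Real.norm_of_nonneg hc.le, smul_smul, mul_inv, mul_right_comm,
      inv_mul_cancel₀ hc.ne', one_mul]
  have h1 : ∀ᵐ p : E n × ℝ, ‖lift p.1 p.2‖⁻¹ • lift p.1 p.2 ∈ S :=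
    (measurePreserving_decomposition (liftIso n)).quasiMeasurePreserving.ae
      (ae_direction_of_ae_surf hS hS1)
  -- The direction of (-z, t|z|) is `muTilde (z/|z|) t`. For fixed z ≠ 0 the height r = t|z| is a
  -- dilation of t, so null sets of r are null sets of t.
  have h2 : ∀ᵐ z : E n, ∀ᵐ t : ℝ, z ≠ 0 →
      ‖lift (-z) (t * ‖z‖)‖⁻¹ • lift (-z) (t * ‖z‖) ∈ S := by
    have h3 := Measure.ae_ae_of_ae_prod h1
    have h4 := (Measure.measurePreserving_neg (volume : Measure (E n))).quasiMeasurePreserving.ae h3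
    filter_upwards [h4] with z hz
    rcases eq_or_ne z 0 with rfl | hz0
    · simp
    · have hz1 : ‖z‖ ≠ 0 := norm_ne_zero_iff.2 hz0
      rw [ae_iff] at hz ⊢
      have h5 := Measure.addHaar_preimage_smul (volume : Measure ℝ) hz1
        {r | ¬ ‖lift (-z) r‖⁻¹ • lift (-z) r ∈ S}
      rw [hz, mul_zero] at h5
      refine measure_mono_null (fun t ht => ?_) h5
      have ht' := (Classical.not_imp.1 ht).2
      rw [mul_comm] at ht'
      exact ht'
  have hm : MeasurableSet {p : E n × ℝ | p.1 ≠ 0 →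
      ‖lift (-p.1) (p.2 * ‖p.1‖)‖⁻¹ • lift (-p.1) (p.2 * ‖p.1‖) ∈ S} := by
    have h6 : Measurable fun p : E n × ℝ =>
        ‖lift (-p.1) (p.2 * ‖p.1‖)‖⁻¹ • lift (-p.1) (p.2 * ‖p.1‖) := by
      have h6' : Continuous fun p : E n × ℝ => lift (-p.1) (p.2 * ‖p.1‖) :=
        cl.comp (f := fun p : E n × ℝ => (-p.1, p.2 * ‖p.1‖)) (by fun_prop)
      exact hd.comp h6'.measurable
    have h7 : MeasurableSet {p : E n × ℝ | p.1 = 0} :=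
      measurableSet_eq_fun measurable_fst measurable_const
    have : {p : E n × ℝ | p.1 ≠ 0 →
      ‖lift (-p.1) (p.2 * ‖p.1‖)‖⁻¹ • lift (-p.1) (p.2 * ‖p.1‖) ∈ S} = {p : E n × ℝ | p.1 = 0} ∪
      (fun p : E n × ℝ =>
        ‖lift (-p.1) (p.2 * ‖p.1‖)‖⁻¹ • lift (-p.1) (p.2 * ‖p.1‖)) ⁻¹' S := by
      ext p
      simp only [mem_union, mem_preimage, Set.mem_ofPred_eq]
      tauto
    rw [this]
    exact h7.union (h6 hS)
  rw [Measure.ae_ae_comm hm] at h2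
  have h8 : Measurable fun p : Sph n × ℝ => muTilde (p.1 : E n) p.2 := by
    have : Continuous fun p : Sph n × ℝ => muTilde (p.1 : E n) p.2 := by
      unfold muTilde
      refine cl.comp (Continuous.prodMk ?_ ?_)
      · exact ((((Real.continuous_cos.comp Real.continuous_arctan).comp continuous_snd).smul
          (continuous_subtype_val.comp continuous_fst))).neg
      · exact (Real.continuous_sin.comp Real.continuous_arctan).comp continuous_snd
    exact this.measurable
  suffices H : ∀ᵐ τ : Sph n × ℝ ∂((sphMeasure n).prod volume), muTilde (τ.1 : E n) τ.2 ∈ S from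
    H.mono fun τ hτ => hSP _ hτ
  have : IsFiniteMeasure (sphMeasure n) := by unfold sphMeasure; infer_instance
  -- With t fixed outside, the bad set of η is measured by its truncated cone in ℝⁿ, which is null
  -- by `h2`.
  rw [Measure.ae_prod_iff_ae_ae (h8 hS), Measure.ae_ae_comm
    (p := fun (η : Sph n) (t : ℝ) => muTilde (η : E n) t ∈ S) (h8 hS)]
  filter_upwards [h2] with t ht
  have h9 : Measurable fun η : E n => muTilde η t := by
    have : Continuous fun η : E n => muTilde η t := by
      unfold muTilde
      exact cl.comp (Continuous.prodMk (by fun_prop) continuous_const)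
    exact this.measurable
  refine (ae_surf_iff (P := fun η => muTilde η t ∈ S)).1 ?_
  change surf (E n) {η | ¬ muTilde η t ∈ S} = 0
  rw [surf_apply (A := {η | ¬ muTilde η t ∈ S}) (h9 hS).compl]
  refine mul_eq_zero_of_right _ (measure_mono_null ?_ ht)
  rintro z ⟨hz0, -, hz⟩ h
  refine hz ?_
  have hz0' : z ≠ 0 := norm_pos_iff.1 hz0
  have h10 := h hz0'
  have hc := Real.cos_arctan_pos t
  have e : muTilde (‖z‖⁻¹ • z) t =
      (Real.cos (Real.arctan t) * ‖z‖⁻¹) • lift (-z) (t * ‖z‖) := by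
    rw [muTilde, ← lift_smul, smul_smul, smul_neg]
    congr 1
    rw [Real.sin_arctan, Real.cos_arctan]
    field_simp
  have hn1 : ‖muTilde (‖z‖⁻¹ • z) t‖ = 1 := norm_muTilde (by
    rw [norm_smul, norm_inv, norm_norm, inv_mul_cancel₀ hz0.ne']) t
  have h11 := hdir (Real.cos (Real.arctan t) * ‖z‖⁻¹) (lift (-z) (t * ‖z‖)) (by positivity)
  rw [← e, hn1, inv_one, one_smul] at h11
  rw [h11]
  exact h10

end HyperplaneMeasure

/-! ### The law of one coordinate of a uniform point. -/

section CoordinateLaw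

theorem lintegral_norm {W : Type*} [NormedAddCommGroup W] [InnerProductSpace ℝ W]
    [FiniteDimensional ℝ W] [MeasurableSpace W] [BorelSpace W] [Nontrivial W]
    {f : ℝ → ENNReal} (hf : Measurable f) :
    ∫⁻ x : W, f ‖x‖ =
      surf W univ * ∫⁻ r in Ioi (0 : ℝ), ENNReal.ofReal (r ^ (Module.finrank ℝ W - 1)) * f r := by
  have hsm : MeasurableSet ({(0 : W)}ᶜ : Set W) := (measurableSet_singleton 0).compl
  have h1 : ∫⁻ x : W, f ‖x‖ = ∫⁻ x : ({(0 : W)}ᶜ : Set W), f ‖(x : W)‖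
      ∂((volume : Measure W).comap Subtype.val) := by
    rw [lintegral_subtype_comap hsm (fun x : W => f ‖x‖), restrict_compl_singleton]
  have h2 := (Measure.measurePreserving_homeomorphUnitSphereProd
    (volume : Measure W)).lintegral_comp_emb (Homeomorph.measurableEmbedding _)
    (fun p : Metric.sphere (0 : W) 1 × Ioi (0 : ℝ) => f p.2)
  simp only [homeomorphUnitSphereProd_apply_snd_coe] at h2
  have hf' : Measurable fun r : Ioi (0 : ℝ) => f r := hf.comp measurable_subtype_coe
  have h3 : surf W univ = (volume : Measure W).toSphere univ := by
    rw [surf, Measure.map_apply measurable_subtype_coe .univ, preimage_univ]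
  have hm : Measurable fun p : Metric.sphere (0 : W) 1 × Ioi (0 : ℝ) => f p.2 :=
    hf'.comp measurable_snd
  rw [h1, h2, lintegral_prod _ hm.aemeasurable]
  simp only [lintegral_const]
  rw [mul_comm, h3, Measure.volumeIoiPow,
    lintegral_withDensity_eq_lintegral_mul _ (by fun_prop) hf']
  congr 1
  exact lintegral_subtype_comap measurableSet_Ioi
    (fun r : ℝ => ENNReal.ofReal (r ^ (Module.finrank ℝ W - 1)) * f r)

theorem image_inv_sqrt : (fun r : ℝ => (√(1 + r ^ 2))⁻¹) '' Ioi 0 = Ioo 0 1 := by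
  ext u
  constructor
  · rintro ⟨r, hr, rfl⟩
    have hr' : (0 : ℝ) < r := hr
    refine ⟨by positivity, inv_lt_one_of_one_lt₀ ?_⟩
    rw [Real.lt_sqrt zero_le_one]
    nlinarith
  · rintro ⟨h0, h1⟩
    have h2 : 0 < 1 - u ^ 2 := by nlinarith
    refine ⟨√(1 - u ^ 2) / u, div_pos (Real.sqrt_pos.2 h2) h0, ?_⟩
    have : 1 + (√(1 - u ^ 2) / u) ^ 2 = u⁻¹ ^ 2 := by
      rw [div_pow, Real.sq_sqrt h2.le]
      field_simp
      ring
    simp only [this, Real.sqrt_sq (inv_pos.2 h0).le, inv_inv]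

theorem hasDerivAt_inv_sqrt (r : ℝ) :
    HasDerivAt (fun r : ℝ => (√(1 + r ^ 2))⁻¹) (-(r / √(1 + r ^ 2) ^ 3)) r := by
  have h0 : (0 : ℝ) < 1 + r ^ 2 := by positivity
  have h1 := (((hasDerivAt_id r).pow 2).const_add 1).sqrt h0.ne'
  have h2 := h1.inv (Real.sqrt_pos.2 h0).ne'
  refine h2.congr_deriv ?_
  simp only [id, Pi.pow_apply]
  field_simp
  norm_num

theorem injOn_inv_sqrt : InjOn (fun r : ℝ => (√(1 + r ^ 2))⁻¹) (Ioi 0) := by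
  intro r hr s hs h
  have h1 := Real.sqrt_inj (by positivity) (by positivity) |>.1 (inv_injective h)
  exact (pow_left_inj₀ (le_of_lt hr) (le_of_lt hs) two_ne_zero).1 (by linarith)

/-- Substitution u = (1 + r²)^(-1/2) in the radial part of the gnomonic density: 1 - u² = r²/(1 +
r²), and the factor in absolute value is |du/dr|. -/
theorem radial_density_eq {n : ℕ} (hn : 2 ≤ n) {r : ℝ} (hr : 0 < r) :
    r ^ (n - 2) * (√(1 + r ^ 2) ^ n)⁻¹ =
      |-(r / √(1 + r ^ 2) ^ 3)| * (1 - ((√(1 + r ^ 2))⁻¹) ^ 2) ^ (((n : ℝ) - 3) / 2) := by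
  obtain ⟨m, rfl⟩ : ∃ m, n = m + 2 := ⟨n - 2, by omega⟩
  have h0 : (0 : ℝ) < 1 + r ^ 2 := by positivity
  have hq : 0 < √(1 + r ^ 2) := Real.sqrt_pos.2 h0
  have hqq : √(1 + r ^ 2) ^ 2 = 1 + r ^ 2 := Real.sq_sqrt h0.le
  have h1 : 1 - ((√(1 + r ^ 2))⁻¹) ^ 2 = (r / √(1 + r ^ 2)) ^ (2 : ℝ) := by
    rw [Real.rpow_two, inv_pow, div_pow, hqq]
    field_simp
    ring
  have h2 : (2 : ℝ) * ((((m + 2 : ℕ) : ℝ) - 3) / 2) = (m : ℝ) - 1 := by push_cast; ring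
  rw [h1, ← Real.rpow_mul (by positivity), h2, Real.rpow_sub_one (by positivity),
    Real.rpow_natCast, abs_neg, abs_of_pos (by positivity), Nat.add_sub_cancel,
    div_pow]
  field_simp
  ring

variable (n : ℕ)

/-- The density on `(0, 1)` of a coordinate of a uniform point of `Sⁿ⁻¹`. -/
def coordDensity (u : ℝ) : ℝ :=
  sphArea (n - 1) / sphArea n * (1 - u ^ 2) ^ (((n : ℝ) - 3) / 2)

/-- The part of the law of a coordinate of a uniform point of `Sⁿ⁻¹` on the positive axis. -/
def coordHalf : Measure ℝ :=
  (volume.restrict (Ioo 0 1)).withDensity fun u => ENNReal.ofReal (coordDensity n u)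

/-- The law of a coordinate of a uniform point of `Sⁿ⁻¹`. -/
def coordLaw : Measure ℝ := coordHalf n + (coordHalf n).map fun u => -u

theorem measurable_coordDensity : Measurable (coordDensity n) := by
  unfold coordDensity
  fun_prop

variable {n}

/-- (1 + |y|²)^(-1/2) is the height of the chart point over y; polar coordinates in W followed by
the substitution u = (1 + r²)^(-1/2) give its density. -/
theorem map_gnoMeasure {W : Type*} [NormedAddCommGroup W] [InnerProductSpace ℝ W]
    [FiniteDimensional ℝ W] [MeasurableSpace W] [BorelSpace W] (hn : 2 ≤ n)
    (hW : Module.finrank ℝ W = n - 1) :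
    (gnoMeasure W).map (fun y => (√(1 + ‖y‖ ^ 2))⁻¹) =
      ENNReal.ofReal (sphArea n) • coordHalf n := by
  have : Nontrivial W := Module.nontrivial_of_finrank_pos (R := ℝ) (by omega)
  have hpn := sphArea_pos (show 0 < n by omega)
  have hpn' := sphArea_pos (show 0 < n - 1 by omega)
  have hu : Measurable fun r : ℝ => (√(1 + r ^ 2))⁻¹ := by fun_prop
  have hu' : Measurable fun y : W => (√(1 + ‖y‖ ^ 2))⁻¹ := by fun_prop
  ext A hA
  rw [Measure.map_apply hu' hA, Measure.smul_apply, coordHalf,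
    withDensity_apply _ hA, gnoMeasure, withDensity_apply _ (hu' hA),
    ← lintegral_indicator (hu' hA), ← lintegral_indicator hA, hW]
  have hf : Measurable fun r : ℝ => ((fun r : ℝ => (√(1 + r ^ 2))⁻¹) ⁻¹' A).indicator
      (fun r => ENNReal.ofReal ((√(1 + r ^ 2) ^ (n - 1 + 1))⁻¹)) r := by
    refine Measurable.indicator ?_ (hu hA)
    fun_prop
  have e1 := lintegral_norm (W := W) hf
  have e2 : ∀ y : W, ((fun r : ℝ => (√(1 + r ^ 2))⁻¹) ⁻¹' A).indicator
      (fun r => ENNReal.ofReal ((√(1 + r ^ 2) ^ (n - 1 + 1))⁻¹)) ‖y‖ =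
      ((fun y : W => (√(1 + ‖y‖ ^ 2))⁻¹) ⁻¹' A).indicator
      (fun y => ENNReal.ofReal ((√(1 + ‖y‖ ^ 2) ^ (n - 1 + 1))⁻¹)) y := fun y => rfl
  simp_rw [e2] at e1
  rw [e1, surf_univ_toReal hW, hW, ← image_inv_sqrt,
    lintegral_image_eq_lintegral_abs_deriv_mul measurableSet_Ioi
      (fun r _ => (hasDerivAt_inv_sqrt r).hasDerivWithinAt) injOn_inv_sqrt, smul_eq_mul,
    ← lintegral_const_mul' _ _ ENNReal.ofReal_ne_top,
    ← lintegral_const_mul' _ _ ENNReal.ofReal_ne_top]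
  refine setLIntegral_congr_fun measurableSet_Ioi fun r hr => ?_
  have hr0 : (0 : ℝ) < r := hr
  by_cases hrA : (√(1 + r ^ 2))⁻¹ ∈ A
  · simp only [indicator, mem_preimage, hrA, if_true]
    rw [← ENNReal.ofReal_mul (by positivity), ← ENNReal.ofReal_mul hpn'.le,
      ← ENNReal.ofReal_mul (abs_nonneg _), ← ENNReal.ofReal_mul hpn.le, coordDensity]
    congr 1
    have h := radial_density_eq hn hr0
    rw [show n - 1 - 1 = n - 2 by omega, show n - 1 + 1 = n by omega, h]
    field_simp
  · simp [indicator, hrA]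

variable {V : Type*} [NormedAddCommGroup V] [InnerProductSpace ℝ V] [FiniteDimensional ℝ V]
  [MeasurableSpace V] [BorelSpace V]

theorem exists_axis_decomposition (hn : n ≠ 0) (hV : Module.finrank ℝ V = n) {e : V}
    (he : ‖e‖ = 1) : ∃ L : WithLp 2 ((ℝ ∙ e)ᗮ × ℝ) ≃ₗᵢ[ℝ] V,
      ∀ (y : (ℝ ∙ e)ᗮ) (r : ℝ), L (WithLp.toLp 2 (y, r)) = (y : V) + r • e := by
  obtain ⟨m, rfl⟩ : ∃ m, n = m + 1 := ⟨n - 1, by omega⟩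
  have : Fact (Module.finrank ℝ V = m + 1) := ⟨hV⟩
  let f : WithLp 2 ((ℝ ∙ e)ᗮ × ℝ) →ₗ[ℝ] V :=
    { toFun := fun p => (p.fst : V) + p.snd • e
      map_add' := fun p q => by
        simp only [WithLp.add_fst, WithLp.add_snd, Submodule.coe_add, add_smul]
        abel
      map_smul' := fun c p => by
        simp only [WithLp.smul_fst, WithLp.smul_snd, Submodule.coe_smul, smul_add,
          RingHom.id_apply, smul_eq_mul, mul_smul] }
  have hnorm : ∀ p, ‖f p‖ = ‖p‖ := by
    intro p
    rw [← sq_eq_sq₀ (norm_nonneg _) (norm_nonneg _), WithLp.prod_norm_sq_eq_of_L2]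
    change ‖(p.fst : V) + p.snd • e‖ ^ 2 = _
    rw [norm_add_sq_real, real_inner_smul_right,
      Submodule.mem_orthogonal_singleton_iff_inner_left.1 p.fst.2, norm_smul, he,
      Submodule.coe_norm]
    ring
  have hdim : Module.finrank ℝ (WithLp 2 ((ℝ ∙ e)ᗮ × ℝ)) = Module.finrank ℝ V := by
    rw [(WithLp.linearEquiv 2 ℝ ((ℝ ∙ e)ᗮ × ℝ)).finrank_eq, Module.finrank_prod,
      Module.finrank_self,
      Submodule.finrank_orthogonal_span_singleton (n := m) (fun h => by simp [h] at he), hV]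
  exact ⟨LinearIsometry.toLinearIsometryEquiv ⟨f, hnorm⟩ hdim, fun y r => rfl⟩

/-- The law of a coordinate of a uniform point of the unit sphere. -/
theorem map_inner_unif (hn : 2 ≤ n) (hV : Module.finrank ℝ V = n) {e : V} (he : ‖e‖ = 1) :
    (unif V).map (fun x => ⟪e, x⟫) = coordLaw n := by
  have : Nontrivial V := nontrivial_of_norm_eq_one he
  have hpn := sphArea_pos (show 0 < n by omega)
  obtain ⟨L, hL⟩ := exists_axis_decomposition (by omega) hV he
  have hW : Module.finrank ℝ (ℝ ∙ e)ᗮ = n - 1 := by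
    have := finrank_of_decomposition L
    omega
  have mi : Measurable fun x : V => ⟪e, x⟫ := Continuous.measurable (by fun_prop)
  have hg : ∀ ε : ℝ, (fun x : V => ⟪e, x⟫) ∘ gno L ε =
      fun y => ε * (√(1 + ‖y‖ ^ 2))⁻¹ := by
    intro ε
    funext y
    simp only [Function.comp_apply, gno]
    rw [hL, real_inner_smul_right, inner_add_right, real_inner_smul_right,
      Submodule.mem_orthogonal_singleton_iff_inner_right.1 y.2, real_inner_self_eq_norm_sq, he]
    ring
  have hu : Measurable fun y : (ℝ ∙ e)ᗮ => (√(1 + ‖y‖ ^ 2))⁻¹ := by fun_prop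
  have hneg : (fun y : (ℝ ∙ e)ᗮ => -1 * (√(1 + ‖y‖ ^ 2))⁻¹) =
      (fun u : ℝ => -u) ∘ fun y => (√(1 + ‖y‖ ^ 2))⁻¹ := by
    funext y
    simp
  rw [unif, surf_univ_toReal hV, Measure.map_smul, surf_eq_map_gno L, Measure.map_add _ _ mi,
    Measure.map_map mi (continuous_gno L 1).measurable,
    Measure.map_map mi (continuous_gno L (-1)).measurable, hg, hg, hneg,
    ← Measure.map_map measurable_neg hu]
  simp only [one_mul]
  rw [map_gnoMeasure hn hW, Measure.map_smul, ← smul_add, smul_smul,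
    ENNReal.inv_mul_cancel (by simpa using hpn) ENNReal.ofReal_ne_top, one_smul]
  rfl

theorem map_inner_dirPerp (hn : 2 ≤ n) {ω e : E (n + 1)} (hω : ‖ω‖ = 1) (he : ‖e‖ = 1)
    (hωe : ⟪ω, e⟫ = 0) :
    (unif (E (n + 1))).map (fun y => ⟪e, dirPerp ω y⟫) = coordLaw n := by
  have mi : Measurable fun x : E (n + 1) => ⟪e, x⟫ := Continuous.measurable (by fun_prop)
  have h1 : (unif (E (n + 1))).map (fun y => ⟪e, dirPerp ω y⟫) =
      (greatLaw ω).map (fun x => ⟪e, x⟫) :=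
    (Measure.map_map mi (measurable_dirPerp_right ω)).symm
  rw [h1, greatLaw_eq (by omega) hω, Measure.map_map mi measurable_subtype_coe]
  exact map_inner_unif hn (finrank_perp hω)
    (e := (⟨e, Submodule.mem_orthogonal_singleton_iff_inner_right.2 hωe⟩ : perp ω)) he

theorem isProbabilityMeasure_coordLaw (hn : 2 ≤ n) : IsProbabilityMeasure (coordLaw n) := by
  have := nontrivial_E n
  obtain ⟨ω, hω⟩ := exists_norm_eq (E (n + 1)) zero_le_one
  obtain ⟨e, he, hωe⟩ := exists_unit_orthogonal (show n ≠ 0 by omega) hω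
  rw [← map_inner_dirPerp hn hω he hωe]
  exact Measure.isProbabilityMeasure_map
    (Measurable.inner measurable_const (measurable_dirPerp_right ω)).aemeasurable

/-- The normalization is read off from the law being a probability measure, so no Beta integral has
to be evaluated. -/
theorem coordHalf_univ (hn : 2 ≤ n) : 2 * coordHalf n univ = 1 := by
  have := isProbabilityMeasure_coordLaw hn
  have h : coordLaw n univ = 1 := measure_univ
  rwa [coordLaw, Measure.add_apply, Measure.map_apply measurable_neg .univ, preimage_univ,
    ← two_mul] at h

end CoordinateLaw

/-! ### Zonal means as an L¹-continuous family. -/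

section ZonalMean

variable {n : ℕ} {𝕜 : Type*} [RCLike 𝕜]

/-- The nearest point of the unit interval. -/
def clamp (t : ℝ) : ℝ := max 0 (min t 1)

/-- Clamping extends the zonal means continuously to all real t, so differentiation needs no
one-sided treatment and every height function is admissible. -/
theorem continuous_clamp : Continuous clamp := by unfold clamp; fun_prop

theorem abs_clamp_le (t : ℝ) : |clamp t| ≤ 1 := by
  rw [clamp, abs_of_nonneg (le_max_left _ _)]
  exact max_le zero_le_one (min_le_right _ _)

theorem clamp_of_mem {t : ℝ} (h0 : 0 ≤ t) (h1 : t ≤ 1) : clamp t = t := by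
  rw [clamp, min_eq_left h1, max_eq_right h0]

/-- The mean of `f` over the points of the sphere at height `t` over `θ^⊥`. -/
def zonMean {d : ℕ} (f : E d → 𝕜) (t : ℝ) (θ : E d) : 𝕜 :=
  ∫ x, f (zon (clamp t) θ x) ∂(unif (E d))

theorem measurable_zonFamily {d : ℕ} {A : Type*} [MeasurableSpace A] {h : A → ℝ}
    (hh : Measurable h) :
    Measurable fun p : E d × A × E d => zon (clamp (h p.2.1)) p.1 p.2.2 := by
  have h1 : Measurable fun p : E d × A × E d => clamp (h p.2.1) :=
    continuous_clamp.measurable.comp (hh.comp (measurable_fst.comp measurable_snd))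
  exact measurable_zon.comp (h1.prodMk (measurable_fst.prodMk
    (measurable_snd.comp measurable_snd)))

theorem lintegral_prod_rotate {X A Y : Type*} [MeasurableSpace X] [MeasurableSpace A]
    [MeasurableSpace Y] {μ : Measure X} {ν : Measure A} {ρ : Measure Y} [SFinite μ] [SFinite ν]
    [SFinite ρ] {G : X × A × Y → ENNReal} (hG : Measurable G) :
    ∫⁻ p, G p ∂(μ.prod (ν.prod ρ)) = ∫⁻ a, ∫⁻ p, G (p.1, a, p.2) ∂(μ.prod ρ) ∂ν := by
  have h1 : Measurable fun p : (X × A) × Y => G (p.1.1, p.1.2, p.2) :=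
    hG.comp (measurable_fst.fst.prodMk (measurable_fst.snd.prodMk measurable_snd))
  have h2 : ∀ x, Measurable fun p : A × Y => G (x, p) := fun x => hG.comp measurable_prodMk_left
  have h3 : ∀ a, Measurable fun p : X × Y => G (p.1, a, p.2) := fun a =>
    hG.comp (measurable_fst.prodMk (measurable_const.prodMk measurable_snd))
  rw [lintegral_prod _ hG.aemeasurable]
  simp_rw [fun x => lintegral_prod (μ := ν) (ν := ρ) _ (h2 x).aemeasurable,
    fun a => lintegral_prod (μ := μ) (ν := ρ) _ (h3 a).aemeasurable]
  exact lintegral_lintegral_swap h1.lintegral_prod_right.aemeasurable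

/-- For each value of the parameter the pair (θ, x) produces `surf`, so the parameter contributes
only its total mass. Nothing is assumed on how the height depends on the parameter beyond
measurability. -/
theorem map_zonFamily (hn : n ≠ 0) {A : Type*} [MeasurableSpace A] {h : A → ℝ}
    (hh : Measurable h) (ν : Measure A) [SFinite ν] :
    ((surf (E (n + 1))).prod (ν.prod (unif (E (n + 1))))).map
      (fun p => zon (clamp (h p.2.1)) p.1 p.2.2) = ν univ • surf (E (n + 1)) := by
  have hz := measurable_zonFamily (d := n + 1) hh
  ext S hS
  have hi : Measurable (S.indicator (1 : E (n + 1) → ENNReal)) := measurable_one.indicator hS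
  have e2 : ∀ a, ∫⁻ p : E (n + 1) × E (n + 1), S.indicator (1 : E (n + 1) → ENNReal)
      (zon (clamp (h a)) p.1 p.2) ∂((surf (E (n + 1))).prod (unif (E (n + 1)))) =
      surf (E (n + 1)) S := by
    intro a
    rw [← lintegral_map hi (measurable_zon_prod (clamp (h a))),
      surf_eq_map_zon finrank_euclideanSpace_fin hn (abs_clamp_le _), lintegral_indicator_one hS]
  rw [← lintegral_indicator_one hS, lintegral_map hi hz]
  refine (lintegral_prod_rotate (hi.comp hz)).trans ?_
  simp only [Function.comp_apply, e2]
  simp [mul_comm]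

theorem integrable_zonFamily (hn : n ≠ 0) {A : Type*} [MeasurableSpace A] {h : A → ℝ}
    (hh : Measurable h) (ν : Measure A) [IsFiniteMeasure ν] {f : E (n + 1) → 𝕜}
    (hf : Integrable f (surf (E (n + 1)))) :
    Integrable (fun p : E (n + 1) × A × E (n + 1) => f (zon (clamp (h p.2.1)) p.1 p.2.2))
      ((surf (E (n + 1))).prod (ν.prod (unif (E (n + 1))))) := by
  have h1 : Integrable f (ν univ • surf (E (n + 1))) :=
    hf.smul_measure (measure_ne_top _ _)
  rw [← map_zonFamily hn hh ν] at h1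
  exact (integrable_map_measure h1.1 (measurable_zonFamily hh).aemeasurable).1 h1

theorem integrable_zon (hn : n ≠ 0) (t : ℝ) {f : E (n + 1) → 𝕜}
    (hf : Integrable f (surf (E (n + 1)))) :
    Integrable (fun p : E (n + 1) × E (n + 1) => f (zon (clamp t) p.1 p.2))
      ((surf (E (n + 1))).prod (unif (E (n + 1)))) := by
  rw [← surf_eq_map_zon finrank_euclideanSpace_fin hn (abs_clamp_le t)] at hf
  exact (integrable_map_measure hf.1 (measurable_zon_prod _).aemeasurable).1 hf

theorem integral_norm_zon (hn : n ≠ 0) (t : ℝ) {f : E (n + 1) → 𝕜}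
    (hf : Integrable f (surf (E (n + 1)))) :
    ∫ θ, ∫ x, ‖f (zon (clamp t) θ x)‖ ∂(unif (E (n + 1))) ∂(surf (E (n + 1))) =
      ∫ x, ‖f x‖ ∂(surf (E (n + 1))) := by
  have := nontrivial_E n
  rw [← integral_prod _ (integrable_zon hn t hf).norm]
  have h := surf_eq_map_zon finrank_euclideanSpace_fin hn (V := E (n + 1)) (abs_clamp_le t)
  conv_rhs => rw [← h]
  rw [integral_map (measurable_zon_prod _).aemeasurable]
  rw [h]
  exact hf.1.norm

theorem integrable_zonMean (hn : n ≠ 0) (t : ℝ) {f : E (n + 1) → 𝕜}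
    (hf : Integrable f (surf (E (n + 1)))) : Integrable (zonMean f t) (surf (E (n + 1))) :=
  (integrable_zon hn t hf).integral_prod_left

theorem integrable_sph_iff {d : ℕ} {F : Type*} [NormedAddCommGroup F] {f : E d → F} :
    Integrable f (surf (E d)) ↔ Integrable (fun θ : Sph d => f θ) (sphMeasure d) :=
  measurableEmbedding_sphere.integrable_map_iff

theorem integral_sph {d : ℕ} {F : Type*} [NormedAddCommGroup F] [NormedSpace ℝ F] (f : E d → F) :
    ∫ θ : Sph d, f θ ∂(sphMeasure d) = ∫ x, f x ∂(surf (E d)) :=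
  (measurableEmbedding_sphere.integral_map f).symm

/-- Zonal averaging is an L¹ contraction, because it is a partial integral of f over a product space
that maps to `surf`. The bound is uniform in t. -/
theorem norm_zonMean_sub_le (hn : n ≠ 0) (t : ℝ) {f g : E (n + 1) → 𝕜}
    (hf : Integrable f (surf (E (n + 1)))) (hg : Integrable g (surf (E (n + 1)))) :
    ∫ θ, ‖zonMean f t θ - zonMean g t θ‖ ∂(surf (E (n + 1))) ≤
      ∫ x, ‖f x - g x‖ ∂(surf (E (n + 1))) := by
  have := nontrivial_E n
  have h1 := integrable_zon hn t hf
  have h2 := integrable_zon hn t hg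
  have e := integral_norm_zon hn t (hf.sub hg)
  simp only [Pi.sub_apply] at e
  rw [← e]
  refine integral_mono_ae ((integrable_zonMean hn t hf).sub (integrable_zonMean hn t hg)).norm
    (h1.sub h2).norm.integral_prod_left ?_
  filter_upwards [h1.prod_right_ae, h2.prod_right_ae] with θ h3 h4
  rw [zonMean, zonMean, ← integral_sub h3 h4]
  exact norm_integral_le_integral_norm _

/-- The zonal means as elements of `L¹`. -/
def zonLp (hn : n ≠ 0) {f : E (n + 1) → 𝕜} (hf : Integrable f (surf (E (n + 1)))) (t : ℝ) :
    Lp 𝕜 1 (sphMeasure (n + 1)) :=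
  (integrable_sph_iff.1 (integrable_zonMean hn t hf)).toL1 _

theorem coeFn_zonLp (hn : n ≠ 0) {f : E (n + 1) → 𝕜} (hf : Integrable f (surf (E (n + 1))))
    (t : ℝ) : ∀ᵐ θ : Sph (n + 1) ∂(sphMeasure (n + 1)), zonLp hn hf t θ = zonMean f t θ :=
  Integrable.coeFn_toL1 _

theorem dist_toL1 {d : ℕ} {f g : E d → 𝕜} (hf : Integrable f (surf (E d)))
    (hg : Integrable g (surf (E d))) :
    dist ((integrable_sph_iff.1 hf).toL1 _ : Lp 𝕜 1 (sphMeasure d))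
      ((integrable_sph_iff.1 hg).toL1 _) = ∫ x, ‖f x - g x‖ ∂(surf (E d)) := by
  rw [dist_eq_norm, ← Integrable.toL1_sub, L1.norm_of_fun_eq_integral_norm, ← integral_sph]
  rfl

theorem continuous_zonMean_of_bounded {d : ℕ} [Nontrivial (E d)] {g : E d → 𝕜}
    (hg : Continuous g) {C : ℝ} (hC : ∀ x, ‖g x‖ ≤ C) (θ : E d) :
    Continuous fun t => zonMean g t θ := by
  refine continuous_of_dominated (bound := fun _ => C) (fun t => ?_)
    (fun t => Eventually.of_forall fun x => hC _) (integrable_const C)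
    (Eventually.of_forall fun x => ?_)
  · refine (hg.measurable.comp (measurable_zon.comp (measurable_const.prodMk
      (measurable_const.prodMk measurable_id)))).aestronglyMeasurable
  · have := continuous_clamp
    unfold zon
    fun_prop

theorem norm_zonMean_le {d : ℕ} [Nontrivial (E d)] {g : E d → 𝕜} {C : ℝ} (hC : ∀ x, ‖g x‖ ≤ C)
    (t : ℝ) (θ : E d) : ‖zonMean g t θ‖ ≤ C := by
  have := norm_integral_le_of_norm_le_const (μ := unif (E d))
    (Eventually.of_forall fun x => hC (zon (clamp t) θ x))
  simpa [zonMean] using this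

/-- For bounded continuous functions this is dominated convergence. These are dense in L¹, and the
contraction makes the approximation uniform in t. -/
theorem continuous_zonLp (hn : n ≠ 0) {f : E (n + 1) → 𝕜}
    (hf : Integrable f (surf (E (n + 1)))) : Continuous (zonLp hn hf) := by
  have := nontrivial_E n
  refine continuous_of_uniform_approx_of_continuous fun u hu => ?_
  obtain ⟨ε, hε, hεu⟩ := Metric.mem_uniformity_dist.1 hu
  obtain ⟨g, hfg, hg⟩ := hf.exists_boundedContinuous_integral_sub_le (half_pos hε)
  refine ⟨zonLp hn hg, ?_, fun t => hεu ?_⟩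
  · refine continuous_iff_continuousAt.2 fun t₀ => tendsto_iff_dist_tendsto_zero.2 ?_
    have e : ∀ t, dist (zonLp hn hg t) (zonLp hn hg t₀) =
        ∫ θ, ‖zonMean g t θ - zonMean g t₀ θ‖ ∂(surf (E (n + 1))) := fun t =>
      dist_toL1 (integrable_zonMean hn t hg) (integrable_zonMean hn t₀ hg)
    simp_rw [e]
    have h0 : ∫ _θ : E (n + 1), (0 : ℝ) ∂(surf (E (n + 1))) = 0 := by simp
    rw [← h0]
    refine tendsto_integral_filter_of_dominated_convergence (fun _ => ‖g‖ + ‖g‖)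
      (Eventually.of_forall fun t => ((integrable_zonMean hn t hg).sub
        (integrable_zonMean hn t₀ hg)).norm.1) (Eventually.of_forall fun t =>
        Eventually.of_forall fun θ => ?_) (integrable_const _)
      (Eventually.of_forall fun θ => ?_)
    · rw [norm_norm]
      exact (norm_sub_le _ _).trans (add_le_add (norm_zonMean_le g.norm_coe_le_norm t θ)
        (norm_zonMean_le g.norm_coe_le_norm t₀ θ))
    · have h1 := (continuous_zonMean_of_bounded g.continuous g.norm_coe_le_norm θ).tendsto t₀
      exact tendsto_iff_norm_sub_tendsto_zero.1 h1
  · have h1 := dist_toL1 (integrable_zonMean hn t hf) (integrable_zonMean hn t hg)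
    exact (h1.trans_le ((norm_zonMean_sub_le hn t hf hg).trans hfg)).trans_lt (half_lt_self hε)

theorem zonMean_one {f : E (n + 1) → 𝕜} (θ : E (n + 1)) : zonMean f 1 θ = f θ := by
  have := nontrivial_E n
  simp [zonMean, clamp_of_mem zero_le_one le_rfl, zon_one]

end ZonalMean

/-! ### Bochner integrals in L¹ and pointwise integrals. -/

section Representation

variable {n : ℕ} {𝕜 : Type*} [RCLike 𝕜]

instance (d : ℕ) : IsFiniteMeasure (sphMeasure d) := by unfold sphMeasure; infer_instance

theorem integrable_prod_zonMean (hn : n ≠ 0) {f : E (n + 1) → 𝕜}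
    (hf : Integrable f (surf (E (n + 1)))) (ν : Measure ℝ) [IsFiniteMeasure ν] :
    Integrable (fun p : E (n + 1) × ℝ => zonMean f p.2 p.1) ((surf (E (n + 1))).prod ν) := by
  have h := integrable_zonFamily hn measurable_id ν hf
  have hp : MeasurePreserving (MeasurableEquiv.prodAssoc (α := E (n + 1)) (β := ℝ)
      (γ := E (n + 1))) (((surf (E (n + 1))).prod ν).prod (unif (E (n + 1))))
      ((surf (E (n + 1))).prod (ν.prod (unif (E (n + 1))))) :=
    measurePreserving_prodAssoc _ _ _
  exact ((hp.integrable_comp_emb (MeasurableEquiv.measurableEmbedding _)).2 h).integral_prod_left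

/-- Both sides have the same integral over each measurable set s: on the left integration over s is
a continuous functional and commutes with the Bochner integral, on the right Fubini applies. -/
theorem integral_zonLp_coeFn (hn : n ≠ 0) {f : E (n + 1) → 𝕜}
    (hf : Integrable f (surf (E (n + 1)))) {κ : ℝ → ℝ} (hκ : Continuous κ) {t : ℝ} (ht : 0 ≤ t) :
    ∀ᵐ θ : Sph (n + 1) ∂(sphMeasure (n + 1)),
      (∫ v in (0 : ℝ)..t, κ v • zonLp hn hf v : Lp 𝕜 1 (sphMeasure (n + 1))) θ =
        ∫ v in (0 : ℝ)..t, κ v • zonMean f v θ := by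
  set μ := sphMeasure (n + 1)
  have hi : Integrable (fun p : E (n + 1) × ℝ => κ p.2 • zonMean f p.2 p.1)
      ((surf (E (n + 1))).prod (volume.restrict (Ioc 0 t))) := by
    obtain ⟨C, hC⟩ := (isCompact_Icc (a := (0 : ℝ)) (b := t)).exists_bound_of_continuousOn
      hκ.continuousOn
    refine (integrable_prod_zonMean hn hf (volume.restrict (Ioc 0 t))).bdd_smul C
      (hκ.comp continuous_snd).aestronglyMeasurable ?_
    have : ∀ᵐ v ∂(volume.restrict (Ioc 0 t)), ‖κ v‖ ≤ C := by
      filter_upwards [ae_restrict_mem measurableSet_Ioc] with v hv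
        using hC v (Ioc_subset_Icc_self hv)
    exact Measure.quasiMeasurePreserving_snd.ae this
  have hi' : Integrable (fun p : Sph (n + 1) × ℝ => κ p.2 • zonMean f p.2 (p.1 : E (n + 1)))
      (μ.prod (volume.restrict (Ioc 0 t))) := by
    have e : (surf (E (n + 1))).prod (volume.restrict (Ioc 0 t)) =
        (μ.prod (volume.restrict (Ioc 0 t))).map (Prod.map Subtype.val id) := by
      conv_lhs => rw [surf, ← Measure.map_id (μ := volume.restrict (Ioc 0 t))]
      exact Measure.map_prod_map _ _ measurable_subtype_coe measurable_id
    rw [e] at hi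
    exact (integrable_map_measure hi.1
      (measurable_subtype_coe.prodMap measurable_id).aemeasurable).1 hi
  have hc : Continuous fun v => κ v • zonLp hn hf v := hκ.smul (continuous_zonLp hn hf)
  simp_rw [intervalIntegral.integral_of_le ht]
  refine Integrable.ae_eq_of_forall_setIntegral_eq _ _ (L1.integrable_coeFn _)
    hi'.integral_prod_left fun s hs _ => ?_
  let T : Lp 𝕜 1 μ →L[ℝ] 𝕜 := (L1.integralCLM).comp (LpToLpRestrictCLM _ 𝕜 ℝ μ 1 s)
  have hT : ∀ h : Lp 𝕜 1 μ, T h = ∫ θ in s, h θ ∂μ := by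
    intro h
    have h1 : T h = ∫ θ, (LpToLpRestrictCLM _ 𝕜 ℝ μ 1 s h) θ ∂(μ.restrict s) := by
      rw [← L1.integral_eq_integral]
      exact (L1.integral_eq _).symm
    rw [h1]
    exact integral_congr_ae (LpToLpRestrictCLM_coeFn ℝ s h)
  rw [← hT, ← T.integral_comp_comm (hc.integrableOn_Icc.mono_set Ioc_subset_Icc_self)]
  have hsw : Integrable (Function.uncurry fun (θ : Sph (n + 1)) (v : ℝ) =>
      κ v • zonMean f v (θ : E (n + 1))) ((μ.restrict s).prod (volume.restrict (Ioc 0 t))) :=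
    hi'.mono_measure (Measure.prod_mono Measure.restrict_le_self le_rfl)
  rw [integral_integral_swap hsw]
  refine integral_congr_ae (Eventually.of_forall fun v => ?_)
  have hTs : T (κ v • zonLp hn hf v) = κ v • T (zonLp hn hf v) := T.map_smul _ _
  simp only [hTs]
  rw [hT, integral_smul]
  congr 1
  exact setIntegral_congr_ae hs ((coeFn_zonLp hn hf v).mono fun θ hθ _ => hθ)

end Representation

/-! ### Differentiation of iterated integrals. -/

section AbelCalculus

variable {X : Type*} [NormedAddCommGroup X] [NormedSpace ℝ X]

/-- The iterated integral `∫₀ᵗ (p(t) - p(v))ᵏ m(v) dv`. -/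
def abelInt (p : ℝ → ℝ) (k : ℕ) (m : ℝ → X) (t : ℝ) : X :=
  ∫ v in (0 : ℝ)..t, (p t - p v) ^ k • m v

variable {p p' : ℝ → ℝ} {m : ℝ → X}

theorem abelInt_succ (hp : Continuous p) (hm : Continuous m) (k : ℕ) (t : ℝ) :
    abelInt p (k + 1) m t = p t • abelInt p k m t - abelInt p k (fun v => p v • m v) t := by
  rw [abelInt, abelInt, abelInt, ← intervalIntegral.integral_smul,
    ← intervalIntegral.integral_sub]
  · refine intervalIntegral.integral_congr fun v _ => ?_
    simp only [smul_smul, ← sub_smul]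
    congr 1
    ring
  · exact Continuous.intervalIntegrable (by fun_prop) _ _
  · exact Continuous.intervalIntegrable (by fun_prop) _ _

variable [CompleteSpace X]

theorem hasDerivAt_abelInt_zero (hm : Continuous m) (t : ℝ) :
    HasDerivAt (abelInt p 0 m) (m t) t := by
  have : abelInt p 0 m = fun t => ∫ v in (0 : ℝ)..t, m v := by
    funext t; simp [abelInt]
  rw [this]
  exact (hm.integral_hasStrictDerivAt 0 t).hasDerivAt

/-- By `abelInt_succ`, p(t) is pulled out as a scalar factor, so only the fundamental theorem of
calculus and the product rule are needed. The induction is over all `m` at once, since the recursion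
replaces `m` by p · m. -/
theorem hasDerivAt_abelInt_succ (hp : ∀ t, HasDerivAt p (p' t) t) (hm : Continuous m) (k : ℕ)
    (t : ℝ) : HasDerivAt (abelInt p (k + 1) m) (((k + 1 : ℝ) * p' t) • abelInt p k m t) t := by
  have hpc : Continuous p := continuous_iff_continuousAt.2 fun t => (hp t).continuousAt
  induction k generalizing m with
  | zero =>
    rw [funext (abelInt_succ hpc hm 0)]
    refine (((hp t).smul (hasDerivAt_abelInt_zero hm t)).sub
      (hasDerivAt_abelInt_zero (hpc.smul hm) t)).congr_deriv ?_
    simp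
  | succ k ih =>
    rw [funext (abelInt_succ hpc hm (k + 1))]
    refine (((hp t).smul (ih hm)).sub (ih (hpc.smul hm))).congr_deriv ?_
    rw [abelInt_succ hpc hm k t]
    push_cast
    module

theorem contDiff_abelInt (hp : ∀ t, HasDerivAt p (p' t) t) (hp' : ∀ i : ℕ, ContDiff ℝ i p')
    (hm : Continuous m) (k : ℕ) : ContDiff ℝ (k + 1 : ℕ) (abelInt p k m) := by
  induction k with
  | zero =>
    rw [Nat.cast_succ, contDiff_succ_iff_deriv]
    refine ⟨fun t => (hasDerivAt_abelInt_zero hm t).differentiableAt, by simp, ?_⟩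
    rw [funext fun t => (hasDerivAt_abelInt_zero (p := p) hm t).deriv]
    exact contDiff_zero.2 hm
  | succ k ih =>
    rw [Nat.cast_succ, contDiff_succ_iff_deriv]
    refine ⟨fun t => (hasDerivAt_abelInt_succ hp hm k t).differentiableAt, by simp, ?_⟩
    rw [funext fun t => (hasDerivAt_abelInt_succ hp hm k t).deriv]
    exact (contDiff_const.mul (hp' _)).smul ih

variable {D : (ℝ → X) → ℝ → X} {c : ℝ → ℝ}

theorem eqOn_iterate_of_eqOn (hD : ∀ w t, D w t = c t • deriv w t) {w w' : ℝ → X}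
    (h : EqOn w w' (Ioo 0 1)) (j : ℕ) : EqOn (D^[j] w) (D^[j] w') (Ioo 0 1) := by
  induction j generalizing w w' with
  | zero => exact h
  | succ j ih =>
    rw [Function.iterate_succ_apply, Function.iterate_succ_apply]
    refine ih fun t ht => ?_
    rw [hD, hD, (h.eventuallyEq_of_mem (isOpen_Ioo.mem_nhds ht)).deriv_eq]

/-- Since c p' = 1, D is differentiation in p. The first k applications lower the exponent and
collect k!; the last one acts on the upper limit, where dv rather than dp is integrated, and leaves
a factor c(t). -/
theorem iterate_abelInt (hp : ∀ t, HasDerivAt p (p' t) t) (hm : Continuous m)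
    (hD : ∀ w t, D w t = c t • deriv w t) (hc : ∀ t ∈ Ioo (0 : ℝ) 1, c t * p' t = 1) (k : ℕ)
    (a : ℝ) : EqOn (D^[k + 1] fun t => a • abelInt p k m t)
      (fun t => (a * (k.factorial : ℝ) * c t) • m t) (Ioo 0 1) := by
  induction k generalizing a with
  | zero =>
    intro t _
    have h : HasDerivAt (fun t => a • abelInt p 0 m t) (a • m t) t :=
      (hasDerivAt_abelInt_zero hm t).const_smul a
    rw [Function.iterate_succ_apply, Function.iterate_zero_apply, hD, h.deriv, smul_smul]
    simp [mul_comm]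
  | succ k ih =>
    intro t ht
    have h1 : EqOn (D fun t => a • abelInt p (k + 1) m t)
        (fun t => (a * (k + 1)) • abelInt p k m t) (Ioo 0 1) := by
      intro s hs
      have h : HasDerivAt (fun t => a • abelInt p (k + 1) m t) _ s :=
        (hasDerivAt_abelInt_succ hp hm k s).const_smul a
      rw [hD, h.deriv, smul_smul, smul_smul]
      congr 1
      linear_combination a * (k + 1) * hc s hs
    rw [Function.iterate_succ_apply, eqOn_iterate_of_eqOn hD h1 (k + 1) ht, ih _ ht]
    rw [Nat.factorial_succ]
    push_cast
    ring_nf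

end AbelCalculus

/-! ### Composition of Abel kernels. -/

section AbelKernel

theorem lintegral_Ioo_comp {f f' : ℝ → ℝ} {a b : ℝ} (hab : a < b)
    (hd : ∀ x ∈ Icc a b, HasDerivAt f (f' x) x) (hpos : ∀ x ∈ Ioo a b, 0 < f' x)
    (g : ℝ → ENNReal) :
    ∫⁻ y in Ioo (f a) (f b), g y = ∫⁻ x in Ioo a b, ENNReal.ofReal (f' x) * g (f x) := by
  have hc : ContinuousOn f (Icc a b) := fun x hx => (hd x hx).continuousAt.continuousWithinAt
  have hm : StrictMonoOn f (Icc a b) := by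
    refine strictMonoOn_of_deriv_pos (convex_Icc a b) hc fun x hx => ?_
    rw [interior_Icc] at hx
    rw [(hd x (Ioo_subset_Icc_self hx)).deriv]
    exact hpos x hx
  have hi : f '' Ioo a b = Ioo (f a) (f b) := by
    refine Subset.antisymm ?_ (intermediate_value_Ioo hab.le hc)
    rintro _ ⟨x, hx, rfl⟩
    exact ⟨hm (left_mem_Icc.2 hab.le) (Ioo_subset_Icc_self hx) hx.1,
      hm (Ioo_subset_Icc_self hx) (right_mem_Icc.2 hab.le) hx.2⟩
  rw [← hi, lintegral_image_eq_lintegral_abs_deriv_mul measurableSet_Ioo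
    (fun x hx => (hd x (Ioo_subset_Icc_self hx)).hasDerivWithinAt)
    (hm.injOn.mono Ioo_subset_Icc_self)]
  refine setLIntegral_congr_fun measurableSet_Ioo fun x hx => ?_
  simp only [abs_of_pos (hpos x hx)]

variable {n : ℕ}

/-- The exponent of the kernels of Abel type. -/
def abelExp (n : ℕ) : ℝ := ((n : ℝ) - 3) / 2

/-- The integral `∫_{-a}^a (a² - w²)^{(n-3)/2} dw`. -/
def betaInt (n : ℕ) (a : ℝ) : ENNReal :=
  ∫⁻ w in Ioo (-a) a, ENNReal.ofReal ((a ^ 2 - w ^ 2) ^ abelExp n)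

/-- The normalizing constant of `coordDensity`. -/
def coordConst (n : ℕ) : ℝ := sphArea (n - 1) / sphArea n

theorem coordConst_pos (hn : 2 ≤ n) : 0 < coordConst n :=
  div_pos (sphArea_pos (by omega)) (sphArea_pos (by omega))

theorem coordDensity_eq (u : ℝ) :
    coordDensity n u = coordConst n * (1 - u ^ 2) ^ abelExp n := rfl

theorem rpow_mul_self_abelExp (hn : 2 ≤ n) {a : ℝ} (ha : 0 < a) :
    a * (a ^ 2) ^ abelExp n = a ^ (n - 2) := by
  obtain ⟨m, rfl⟩ : ∃ m, n = m + 2 := ⟨n - 2, by omega⟩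
  rw [← Real.rpow_two, ← Real.rpow_mul ha.le, Nat.add_sub_cancel, ← Real.rpow_natCast]
  nth_rewrite 1 [← Real.rpow_one a]
  rw [← Real.rpow_add ha]
  congr 1
  unfold abelExp
  push_cast
  ring

theorem coordConst_mul_betaInt_one (hn : 2 ≤ n) :
    ENNReal.ofReal (coordConst n) * betaInt n 1 = 1 := by
  have h1 : ∫⁻ w in Ioo (-1 : ℝ) 1, ENNReal.ofReal ((1 ^ 2 - w ^ 2) ^ abelExp n) =
      2 * ∫⁻ w in Ioo (0 : ℝ) 1, ENNReal.ofReal ((1 ^ 2 - w ^ 2) ^ abelExp n) := by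
    have hu : Ioo (-1 : ℝ) 1 =ᵐ[volume] (Ioo (-1 : ℝ) 0 ∪ Ioo 0 1 : Set ℝ) := by
      have h0 : ∀ᵐ x : ℝ, x ≠ 0 := by simp [ae_iff]
      filter_upwards [h0] with x hx
      apply propext
      change x ∈ Ioo (-1 : ℝ) 1 ↔ x ∈ (Ioo (-1 : ℝ) 0 ∪ Ioo 0 1 : Set ℝ)
      simp only [mem_Ioo, mem_union]
      constructor
      · rintro ⟨h1, h2⟩
        rcases lt_or_gt_of_ne hx with h | h
        · exact .inl ⟨h1, h⟩
        · exact .inr ⟨h, h2⟩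
      · rintro (⟨h1, h2⟩ | ⟨h1, h2⟩) <;> constructor <;> linarith
    have hdis : Disjoint (Ioo (-1 : ℝ) 0) (Ioo 0 1) :=
      disjoint_left.2 fun x hx hx' => lt_asymm hx.2 hx'.1
    rw [setLIntegral_congr hu, lintegral_union measurableSet_Ioo hdis, two_mul]
    congr 1
    have e := (Measure.measurePreserving_neg (volume : Measure ℝ)).setLIntegral_comp_emb
      (MeasurableEquiv.neg ℝ).measurableEmbedding
      (fun w => ENNReal.ofReal ((1 ^ 2 - w ^ 2) ^ abelExp n)) (Ioo (0 : ℝ) 1)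
    rw [image_neg_Ioo, neg_zero] at e
    simp only [neg_sq] at e
    exact e.symm
  have h2 := coordHalf_univ hn
  rw [coordHalf, withDensity_apply _ .univ, Measure.restrict_univ] at h2
  simp_rw [coordDensity_eq, ENNReal.ofReal_mul (coordConst_pos hn).le] at h2
  rw [lintegral_const_mul' _ _ ENNReal.ofReal_ne_top] at h2
  rw [betaInt, h1, ← h2, one_pow]
  ring

/-- Rescaling to (-1, 1) produces a · (a²)^((n-3)/2) = a^(n-2); the remaining integral is the
reciprocal of `coordConst n`. -/
theorem coordConst_mul_betaInt (hn : 2 ≤ n) {a : ℝ} (ha : 0 < a) :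
    ENNReal.ofReal (coordConst n) * betaInt n a = ENNReal.ofReal (a ^ (n - 2)) := by
  have h := lintegral_Ioo_comp (f := fun x => a * x) (f' := fun _ => a) (a := -1) (b := 1)
    (by norm_num) (fun x _ => by simpa using (hasDerivAt_id x).const_mul a) (fun _ _ => ha)
    (fun w => ENNReal.ofReal ((a ^ 2 - w ^ 2) ^ abelExp n))
  rw [mul_neg_one, mul_one] at h
  have h2 : betaInt n a = ENNReal.ofReal (a ^ (n - 2)) * betaInt n 1 := by
    rw [betaInt, h, betaInt, ← lintegral_const_mul' _ _ ENNReal.ofReal_ne_top]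
    refine setLIntegral_congr_fun measurableSet_Ioo fun w hw => ?_
    have hw1 : 0 ≤ 1 ^ 2 - w ^ 2 := by nlinarith [hw.1, hw.2]
    rw [← ENNReal.ofReal_mul ha.le, ← ENNReal.ofReal_mul (by positivity)]
    congr 1
    rw [show a ^ 2 - (a * w) ^ 2 = a ^ 2 * (1 ^ 2 - w ^ 2) by ring,
      Real.mul_rpow (sq_nonneg a) hw1, ← mul_assoc, rpow_mul_self_abelExp hn ha]
  rw [h2, mul_left_comm, coordConst_mul_betaInt_one hn, mul_one]

/-- With w = s² - (t² + v²)/2 and a = (t² - v²)/2 the product (t² - s²)(s² - v²) becomes a² - w²,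
and dw = 2s ds. -/
theorem lintegral_abel_one {v t : ℝ} (hv : 0 < v) (hvt : v < t) :
    2 * ∫⁻ s in Ioo v t, ENNReal.ofReal (s * ((t ^ 2 - s ^ 2) * (s ^ 2 - v ^ 2)) ^ abelExp n) =
      betaInt n ((t ^ 2 - v ^ 2) / 2) := by
  have h := lintegral_Ioo_comp (f := fun s => s ^ 2 - (t ^ 2 + v ^ 2) / 2) (f' := fun s => 2 * s)
    hvt (fun x _ => by simpa using (hasDerivAt_pow 2 x).sub_const ((t ^ 2 + v ^ 2) / 2))
    (fun x hx => by linarith [hx.1])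
    (fun w => ENNReal.ofReal ((((t ^ 2 - v ^ 2) / 2) ^ 2 - w ^ 2) ^ abelExp n))
  rw [show v ^ 2 - (t ^ 2 + v ^ 2) / 2 = -((t ^ 2 - v ^ 2) / 2) by ring,
    show t ^ 2 - (t ^ 2 + v ^ 2) / 2 = (t ^ 2 - v ^ 2) / 2 by ring] at h
  rw [betaInt, h, ← lintegral_const_mul' _ _ ENNReal.ofNat_ne_top]
  refine setLIntegral_congr_fun measurableSet_Ioo fun s hs => ?_
  have hs0 : 0 < s := hv.trans hs.1
  rw [show ((t ^ 2 - v ^ 2) / 2) ^ 2 - (s ^ 2 - (t ^ 2 + v ^ 2) / 2) ^ 2 =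
    (t ^ 2 - s ^ 2) * (s ^ 2 - v ^ 2) by ring, ENNReal.ofReal_mul hs0.le,
    ENNReal.ofReal_mul zero_le_two, ENNReal.ofReal_ofNat, mul_assoc]

/-- The substitution w = s - tv/s maps (v, t) increasingly onto (v - t, t - v), with derivative 1 +
tv/s². The involution s ↦ tv/s of (v, t) sends w to -w and exchanges the two terms of this
derivative, so each contributes half. -/
theorem lintegral_abel_two {v t : ℝ} (hv : 0 < v) (hvt : v < t) :
    2 * ∫⁻ s in Ioo v t, ENNReal.ofReal (((t - v) ^ 2 - (s - t * v / s) ^ 2) ^ abelExp n) =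
      betaInt n (t - v) := by
  have ht : 0 < t := hv.trans hvt
  have hder : ∀ x, 0 < x → HasDerivAt (fun s => t * v / s) (-(t * v / x ^ 2)) x := by
    intro x hx
    have := (hasDerivAt_inv hx.ne').const_mul (t * v)
    refine this.congr_deriv ?_
    ring
  have h := lintegral_Ioo_comp (f := fun s => s - t * v / s) (f' := fun s => 1 + t * v / s ^ 2)
    hvt (fun x hx => ((hasDerivAt_id x).sub (hder x (hv.trans_le hx.1))).congr_deriv (by ring))
    (fun x hx => by
      have := hv.trans hx.1
      positivity)
    (fun w => ENNReal.ofReal (((t - v) ^ 2 - w ^ 2) ^ abelExp n))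
  rw [mul_div_cancel_right₀ t hv.ne', mul_div_cancel_left₀ v ht.ne',
    ← neg_sub t v] at h
  have him : (fun s => t * v / s) '' Ioo v t = Ioo v t := by
    have hsub : ∀ s ∈ Ioo v t, t * v / s ∈ Ioo v t := by
      intro s hs
      have hs0 := hv.trans hs.1
      constructor
      · rw [lt_div_iff₀ hs0]; nlinarith [hs.2]
      · rw [div_lt_iff₀ hs0]; nlinarith [hs.1]
    refine Subset.antisymm (image_subset_iff.2 hsub) fun s hs => ⟨t * v / s, hsub s hs, ?_⟩
    have hs0 := hv.trans hs.1
    field_simp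
  have hinj : InjOn (fun s => t * v / s) (Ioo v t) := by
    intro x hx y hy hxy
    have hx0 := hv.trans hx.1
    have hy0 := hv.trans hy.1
    have hxy' : t * v / x = t * v / y := hxy
    rw [div_eq_div_iff hx0.ne' hy0.ne'] at hxy'
    exact (mul_left_cancel₀ (mul_pos ht hv).ne' hxy').symm
  set q : ℝ → ENNReal := fun s =>
    ENNReal.ofReal (((t - v) ^ 2 - (s - t * v / s) ^ 2) ^ abelExp n) with hq
  have h2 : ∫⁻ s in Ioo v t, q s = ∫⁻ s in Ioo v t, ENNReal.ofReal (t * v / s ^ 2) * q s := by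
    conv_lhs => rw [← him]
    rw [lintegral_image_eq_lintegral_abs_deriv_mul measurableSet_Ioo
      (fun x hx => (hder x (hv.trans hx.1)).hasDerivWithinAt) hinj]
    refine setLIntegral_congr_fun measurableSet_Ioo fun s hs => ?_
    have hs0 := hv.trans hs.1
    have e : t * v / s - t * v / (t * v / s) = -(s - t * v / s) := by
      field_simp
      ring
    simp only [hq, e, neg_sq]
    rw [abs_neg, abs_of_pos (by positivity)]
  have hqm : Measurable q := by
    simp only [hq]
    fun_prop
  rw [betaInt, h, two_mul]
  nth_rewrite 2 [h2]
  rw [← lintegral_add_left hqm]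
  refine setLIntegral_congr_fun measurableSet_Ioo fun s hs => ?_
  have hs0 := hv.trans hs.1
  simp only [hq]
  rw [ENNReal.ofReal_add zero_le_one (by positivity), ENNReal.ofReal_one, add_mul, one_mul]

/-- The measure `k(s) ds` on `(0, t)`. -/
def kernelMeasure (t : ℝ) (k : ℝ → ℝ) : Measure ℝ :=
  (volume.restrict (Ioo 0 t)).withDensity fun s => ENNReal.ofReal (k s)

theorem map_mul_coordHalf {s : ℝ} (hs : 0 < s) :
    ((2 : ENNReal) • coordHalf n).map (fun u => s * u) =
      kernelMeasure s fun v => 2 * (coordDensity n (v / s) / s) := by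
  ext A hA
  have hm : Measurable fun u : ℝ => s * u := measurable_const_mul s
  rw [Measure.map_apply hm hA, Measure.smul_apply, coordHalf, kernelMeasure,
    withDensity_apply _ (hm hA), withDensity_apply _ hA, ← lintegral_indicator (hm hA),
    ← lintegral_indicator hA]
  have h := lintegral_Ioo_comp (f := fun x => s * x) (f' := fun _ => s) (a := 0) (b := 1)
    one_pos (fun x _ => by simpa using (hasDerivAt_id x).const_mul s) (fun _ _ => hs)
    (A.indicator fun v => ENNReal.ofReal (2 * (coordDensity n (v / s) / s)))
  rw [mul_zero, mul_one] at h
  rw [h, smul_eq_mul, ← lintegral_const_mul' _ _ ENNReal.ofNat_ne_top]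
  refine lintegral_congr fun u => ?_
  by_cases hu : s * u ∈ A
  · rw [indicator_of_mem hu, indicator_of_mem (show u ∈ (fun u => s * u) ⁻¹' A from hu),
      mul_div_cancel_left₀ u hs.ne', ← ENNReal.ofReal_ofNat 2, ← ENNReal.ofReal_mul zero_le_two,
      ← ENNReal.ofReal_mul hs.le]
    congr 1
    field_simp
  · rw [indicator_of_notMem hu, indicator_of_notMem (show u ∉ (fun u => s * u) ⁻¹' A from hu),
      mul_zero, mul_zero]

instance : SFinite (coordHalf n) := by unfold coordHalf; infer_instance

instance (t : ℝ) (k : ℝ → ℝ) : SFinite (kernelMeasure t k) := by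
  unfold kernelMeasure; infer_instance

/-- For fixed s the variable v = su has density 2 · `coordDensity n (v / s) / s` on (0, s). Tonelli
on v < s < t then integrates out s, which is the integral in `hK`. -/
theorem map_mul_kernelMeasure {t : ℝ} {k K : ℝ → ℝ} (hk : Measurable k)
    (hk0 : ∀ s ∈ Ioo 0 t, 0 ≤ k s)
    (hK : ∀ v ∈ Ioo 0 t, ∫⁻ s in Ioo v t,
      ENNReal.ofReal (k s * (2 * (coordDensity n (v / s) / s))) = ENNReal.ofReal (K v)) :
    ((kernelMeasure t k).prod ((2 : ENNReal) • coordHalf n)).map (fun p => p.1 * p.2) =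
      kernelMeasure t K := by
  have hmul : Measurable fun p : ℝ × ℝ => p.1 * p.2 := measurable_mul
  ext A hA
  have hd : Measurable fun p : ℝ × ℝ => 2 * (coordDensity n (p.2 / p.1) / p.1) :=
    (((measurable_coordDensity n).comp (measurable_snd.div measurable_fst)).div
      measurable_fst).const_mul 2
  set G : ℝ → ℝ → ENNReal := fun s v => (Iio s).indicator (A.indicator fun v =>
    ENNReal.ofReal (k s * (2 * (coordDensity n (v / s) / s)))) v with hG
  have hGm : Measurable (Function.uncurry G) := by
    have : Function.uncurry G = ({p : ℝ × ℝ | p.2 < p.1} ∩ Prod.snd ⁻¹' A).indicator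
        fun p : ℝ × ℝ => ENNReal.ofReal (k p.1 * (2 * (coordDensity n (p.2 / p.1) / p.1))) := by
      funext ⟨s, v⟩
      simp only [Function.uncurry, hG, indicator, mem_Iio, mem_inter_iff, Set.mem_ofPred_eq,
        mem_preimage]
      by_cases h1 : v < s <;> by_cases h2 : v ∈ A <;> simp [h1, h2]
    rw [this]
    exact ((hk.comp measurable_fst).mul hd).ennreal_ofReal.indicator
      ((measurableSet_lt measurable_snd measurable_fst).inter (measurable_snd hA))
  rw [Measure.map_apply hmul hA, Measure.prod_apply (hmul hA), kernelMeasure,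
    lintegral_withDensity_eq_lintegral_mul _ hk.ennreal_ofReal
      (measurable_measure_prodMk_left (hmul hA))]
  have e1 : ∀ s ∈ Ioo 0 t, ((fun s => ENNReal.ofReal (k s)) * fun s =>
      ((2 : ENNReal) • coordHalf n) (Prod.mk s ⁻¹' ((fun p : ℝ × ℝ => p.1 * p.2) ⁻¹' A))) s =
      ∫⁻ v in Ioo 0 t, G s v := by
    intro s hs
    have h1 : Prod.mk s ⁻¹' ((fun p : ℝ × ℝ => p.1 * p.2) ⁻¹' A) = (fun u => s * u) ⁻¹' A := rfl
    rw [Pi.mul_apply, h1, ← Measure.map_apply (measurable_const_mul s) hA,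
      map_mul_coordHalf hs.1, kernelMeasure, withDensity_apply _ hA,
      ← lintegral_const_mul' _ _ ENNReal.ofReal_ne_top]
    simp_rw [← ENNReal.ofReal_mul (hk0 s hs)]
    rw [← lintegral_indicator hA, setLIntegral_indicator measurableSet_Iio]
    congr 2
    ext v
    simp only [mem_Ioo, mem_inter_iff, mem_Iio]
    constructor
    · rintro ⟨h2, h3⟩
      exact ⟨h3, h2, h3.trans hs.2⟩
    · rintro ⟨h2, h3, -⟩
      exact ⟨h3, h2⟩
  rw [setLIntegral_congr_fun measurableSet_Ioo e1, lintegral_lintegral_swap hGm.aemeasurable,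
    kernelMeasure, withDensity_apply _ hA, ← lintegral_indicator hA]
  refine setLIntegral_congr_fun measurableSet_Ioo fun v hv => ?_
  by_cases hvA : v ∈ A
  · rw [indicator_of_mem hvA, ← hK v hv]
    have e2 : ∀ s, G s v = (Ioi v).indicator (fun s =>
        ENNReal.ofReal (k s * (2 * (coordDensity n (v / s) / s)))) s := by
      intro s
      by_cases h : v < s <;> simp [hG, indicator, h, hvA]
    simp_rw [e2]
    rw [setLIntegral_indicator measurableSet_Ioi]
    congr 2
    ext s
    simp only [mem_Ioo, mem_inter_iff, mem_Ioi]
    constructor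
    · rintro ⟨h2, -, h3⟩
      exact ⟨h2, h3⟩
    · rintro ⟨h2, h3⟩
      exact ⟨h2, hv.1.trans h2, h3⟩
  · rw [indicator_of_notMem hvA]
    have e2 : ∀ s, G s v = 0 := fun s => by simp [hG, indicator, hvA]
    simp [e2]

theorem kernel_one (hn : 2 ≤ n) {t v : ℝ} (hv : v ∈ Ioo 0 t) :
    ∫⁻ s in Ioo v t, ENNReal.ofReal ((t ^ 2 - s ^ 2) ^ abelExp n * s ^ (n - 1) *
      (2 * (coordDensity n (v / s) / s))) = ENNReal.ofReal (((t ^ 2 - v ^ 2) / 2) ^ (n - 2)) := by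
  have ha : 0 < (t ^ 2 - v ^ 2) / 2 := by nlinarith [hv.1, hv.2]
  have hc := coordConst_pos hn
  rw [← coordConst_mul_betaInt hn ha, ← lintegral_abel_one hv.1 hv.2,
    ← lintegral_const_mul' _ _ ENNReal.ofNat_ne_top,
    ← lintegral_const_mul' _ _ ENNReal.ofReal_ne_top]
  refine setLIntegral_congr_fun measurableSet_Ioo fun s hs => ?_
  have hs0 : 0 < s := hv.1.trans hs.1
  have h1 : 0 ≤ t ^ 2 - s ^ 2 := by nlinarith [hs.2]
  have h2 : 0 ≤ s ^ 2 - v ^ 2 := by nlinarith [hs.1, hv.1]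
  have h3 : 1 - (v / s) ^ 2 = (s ^ 2 - v ^ 2) / s ^ 2 := by field_simp
  rw [← ENNReal.ofReal_ofNat 2, ← ENNReal.ofReal_mul zero_le_two, ← ENNReal.ofReal_mul hc.le,
    coordDensity_eq, h3, Real.div_rpow h2 (sq_nonneg s), Real.mul_rpow h1 h2]
  congr 1
  have h4 := rpow_mul_self_abelExp hn hs0
  have h5 : 0 < (s ^ 2) ^ abelExp n := Real.rpow_pos_of_pos (by positivity) _
  have h6 : s ^ (n - 1) = s * (s * (s ^ 2) ^ abelExp n) := by
    rw [h4, ← pow_succ', show n - 2 + 1 = n - 1 by omega]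
  rw [h6]
  field_simp

/-- Rests on (t² - s²)(1 - (v/s)²) = (t - v)² - (s - tv/s)², which brings the integrand to the form
of `lintegral_abel_two`. -/
theorem kernel_two (hn : 2 ≤ n) {t v : ℝ} (hv : v ∈ Ioo 0 t) :
    ∫⁻ s in Ioo v t, ENNReal.ofReal ((t ^ 2 - s ^ 2) ^ abelExp n * s *
      (2 * (coordDensity n (v / s) / s))) = ENNReal.ofReal ((t - v) ^ (n - 2)) := by
  have ha : 0 < t - v := sub_pos.2 hv.2
  have hc := coordConst_pos hn
  rw [← coordConst_mul_betaInt hn ha, ← lintegral_abel_two hv.1 hv.2,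
    ← lintegral_const_mul' _ _ ENNReal.ofNat_ne_top,
    ← lintegral_const_mul' _ _ ENNReal.ofReal_ne_top]
  refine setLIntegral_congr_fun measurableSet_Ioo fun s hs => ?_
  have hs0 : 0 < s := hv.1.trans hs.1
  have h1 : 0 ≤ t ^ 2 - s ^ 2 := by nlinarith [hs.2]
  have h2 : 0 ≤ 1 - (v / s) ^ 2 := by
    rw [div_pow, sub_nonneg, div_le_one (by positivity)]
    nlinarith [hs.1, hv.1]
  have h3 : (t - v) ^ 2 - (s - t * v / s) ^ 2 = (t ^ 2 - s ^ 2) * (1 - (v / s) ^ 2) := by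
    field_simp
    ring
  rw [← ENNReal.ofReal_ofNat 2, ← ENNReal.ofReal_mul zero_le_two, ← ENNReal.ofReal_mul hc.le,
    coordDensity_eq, h3, Real.mul_rpow h1 h2]
  congr 1
  field_simp

end AbelKernel

/-! ### Measurability of composed directions. -/

section Measurability

variable {V X : Type*} [NormedAddCommGroup V] [InnerProductSpace ℝ V] [MeasurableSpace V]
  [BorelSpace V] [SecondCountableTopology V] [MeasurableSpace X] {F G : X → V}

theorem measurable_dirPerp_comp (hF : Measurable F) (hG : Measurable G) :
    Measurable fun x => dirPerp (F x) (G x) :=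
  measurable_dirPerp.comp (hF.prodMk hG)

theorem measurable_zon_comp {h : X → ℝ} (hh : Measurable h) (hF : Measurable F)
    (hG : Measurable G) : Measurable fun x => zon (h x) (F x) (G x) :=
  measurable_zon.comp (hh.prodMk (hF.prodMk hG))

end Measurability

/-! ### Cap means of a Funk transform as averages of zonal means. -/

section CapMean

variable {n : ℕ} {𝕜 : Type*} [RCLike 𝕜]

theorem surf_map_neg (d : ℕ) : (surf (E d)).map (fun x => -x) = surf (E d) :=
  surf_map_isometry (LinearIsometryEquiv.neg ℝ)

theorem unif_map_neg (d : ℕ) : (unif (E d)).map (fun x => -x) = unif (E d) :=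
  unif_map_isometry (LinearIsometryEquiv.neg ℝ)

/-- The mean of `f` over the great sphere orthogonal to `ω`, in the parametrization by `dirPerp`. -/
def funkMean {d : ℕ} (f : E d → 𝕜) (ω : E d) : 𝕜 := ∫ y, f (dirPerp ω y) ∂(unif (E d))

theorem stronglyMeasurable_funkMean {d : ℕ} {f : E d → 𝕜} (hf : StronglyMeasurable f) :
    StronglyMeasurable (funkMean f) :=
  StronglyMeasurable.integral_prod_right (f := fun ω y => f (dirPerp ω y))
    (hf.comp_measurable measurable_dirPerp)

theorem stronglyMeasurable_zonMean {d : ℕ} {f : E d → 𝕜} (hf : StronglyMeasurable f) (θ : E d) :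
    StronglyMeasurable fun t => zonMean f t θ := by
  have h : Measurable fun p : ℝ × E d => zon (clamp p.1) θ p.2 :=
    measurable_zon_comp (continuous_clamp.measurable.comp measurable_fst) measurable_const
      measurable_snd
  exact StronglyMeasurable.integral_prod_right (f := fun t x => f (zon (clamp t) θ x))
    (hf.comp_measurable h)

theorem measurable_zon_right {d : ℕ} (t : ℝ) (θ : E d) : Measurable fun x => zon t θ x :=
  measurable_zon_comp measurable_const measurable_const measurable_id

theorem zon_sqrt {d : ℕ} {s : ℝ} (hs0 : 0 ≤ s) (θ x : E d) (hs1 : s ≤ 1) :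
    zon √(1 - s ^ 2) θ x = s • dirPerp θ x + √(1 - s ^ 2) • θ := by
  rw [zon, Real.sq_sqrt (by nlinarith), sub_sub_cancel, Real.sqrt_sq hs0, add_comm]

theorem clamp_sqrt {s : ℝ} : clamp √(1 - s ^ 2) = √(1 - s ^ 2) :=
  clamp_of_mem (Real.sqrt_nonneg _) (Real.sqrt_le_one.2 (by nlinarith [sq_nonneg s]))

/-- φ is only known almost everywhere and need not be measurable on a given parallel. It is replaced
by ψ on those parallels that lie almost entirely in the full set `S`. -/
theorem ae_eq_capPoint {φ ψ : E (n + 1) → 𝕜} {S : Set (E (n + 1))} (hS : MeasurableSet S)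
    (hφ : ∀ x ∈ S, φ x = ψ x) {θ : E (n + 1)} {s : ℝ} (hs0 : 0 ≤ s) (hs1 : s ≤ 1)
    (h : ∀ᵐ x ∂(unif (E (n + 1))), zon √(1 - s ^ 2) θ x ∈ S) :
    ∀ᵐ x ∂(greatLaw θ), φ (s • x + √(1 - s ^ 2) • θ) = ψ (s • x + √(1 - s ^ 2) • θ) := by
  have hm : Measurable fun x : E (n + 1) => s • x + √(1 - s ^ 2) • θ := by fun_prop
  have h1 : ∀ᵐ x ∂(greatLaw θ), s • x + √(1 - s ^ 2) • θ ∈ S := by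
    refine (ae_map_iff (measurable_dirPerp_right θ).aemeasurable (hm hS)).2 ?_
    filter_upwards [h] with x hx
    rwa [zon_sqrt hs0 θ x hs1] at hx
  exact h1.mono fun x hx => hφ _ hx

theorem integrable_capPoint_iff (hn : n ≠ 0) {φ ψ : E (n + 1) → 𝕜} (hψ : StronglyMeasurable ψ)
    {S : Set (E (n + 1))} (hS : MeasurableSet S) (hφ : ∀ x ∈ S, φ x = ψ x) {θ : E (n + 1)}
    (hθ : ‖θ‖ = 1) {s : ℝ} (hs0 : 0 ≤ s) (hs1 : s ≤ 1)
    (h : ∀ᵐ x ∂(unif (E (n + 1))), zon √(1 - s ^ 2) θ x ∈ S) :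
    Integrable (capPoint φ θ s) (greatMeasure θ) ↔
      Integrable (fun x => ψ (zon √(1 - s ^ 2) θ x)) (unif (E (n + 1))) := by
  have hm : Measurable fun x : E (n + 1) => s • x + √(1 - s ^ 2) • θ := by fun_prop
  refine (integrable_greatMeasure_iff hn hθ
    (f := fun x => φ (s • x + √(1 - s ^ 2) • θ))).trans ?_
  rw [integrable_congr (ae_eq_capPoint hS hφ hs0 hs1 h), greatLaw, integrable_map_measure
    (f := dirPerp θ) (g := fun x => ψ (s • x + √(1 - s ^ 2) • θ))
    (hψ.comp_measurable hm).aestronglyMeasurable (measurable_dirPerp_right θ).aemeasurable]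
  simp_rw [fun x => zon_sqrt hs0 θ x hs1]
  rfl

theorem capMean_eq (hn : n ≠ 0) {φ ψ : E (n + 1) → 𝕜} (hψ : StronglyMeasurable ψ)
    {S : Set (E (n + 1))} (hS : MeasurableSet S) (hφ : ∀ x ∈ S, φ x = ψ x) {θ : E (n + 1)}
    (hθ : ‖θ‖ = 1) {s : ℝ} (hs0 : 0 ≤ s) (hs1 : s ≤ 1)
    (h : ∀ᵐ x ∂(unif (E (n + 1))), zon √(1 - s ^ 2) θ x ∈ S) :
    capMean φ θ s = ∫ x, ψ (zon √(1 - s ^ 2) θ x) ∂(unif (E (n + 1))) := by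
  have hm : Measurable fun x : E (n + 1) => s • x + √(1 - s ^ 2) • θ := by fun_prop
  refine (average_greatMeasure hn hθ (fun x => φ (s • x + √(1 - s ^ 2) • θ))).trans ?_
  rw [integral_congr_ae (ae_eq_capPoint hS hφ hs0 hs1 h), greatLaw, integral_map
    (f := fun x => ψ (s • x + √(1 - s ^ 2) • θ))
    (measurable_dirPerp_right θ).aemeasurable (hψ.comp_measurable hm).aestronglyMeasurable]
  simp_rw [fun x => zon_sqrt hs0 θ x hs1]

/-- The law of the modulus of a coordinate of a uniform point of the sphere. -/
def absCoordLaw (n : ℕ) : Measure ℝ := (2 : ENNReal) • coordHalf n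

theorem isProbabilityMeasure_absCoordLaw (hn : 2 ≤ n) : IsProbabilityMeasure (absCoordLaw n) :=
  ⟨by rw [absCoordLaw, Measure.smul_apply, smul_eq_mul, coordHalf_univ hn]⟩

instance : SFinite (absCoordLaw n) := by unfold absCoordLaw; infer_instance

theorem ae_absCoordLaw_mem : ∀ᵐ u ∂(absCoordLaw n), u ∈ Ioo (0 : ℝ) 1 := by
  refine Measure.smul_absolutelyContinuous.ae_le ?_
  unfold coordHalf
  exact (withDensity_absolutelyContinuous _ _).ae_le (ae_restrict_mem measurableSet_Ioo)

/-- The map (u, x) ↦ (-u, -x) sends the point at height su to its antipode, where an even function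
has the same value. -/
theorem map_neg_coordHalf_prod (θ : E (n + 1)) (s : ℝ) {f : E (n + 1) → 𝕜}
    (hf : StronglyMeasurable f) (he : ∀ x, f (-x) = f x)
    (hi : Integrable (fun p : ℝ × E (n + 1) => f (zon (s * p.1) θ p.2))
      ((coordHalf n).prod (unif (E (n + 1))))) :
    Integrable (fun p : ℝ × E (n + 1) => f (zon (s * p.1) θ p.2))
      (((coordHalf n).map fun u => -u).prod (unif (E (n + 1)))) ∧
    ∫ p : ℝ × E (n + 1), f (zon (s * p.1) θ p.2)
      ∂(((coordHalf n).map fun u => -u).prod (unif (E (n + 1)))) =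
    ∫ p : ℝ × E (n + 1), f (zon (s * p.1) θ p.2) ∂((coordHalf n).prod (unif (E (n + 1)))) := by
  have e : ((coordHalf n).map fun u => -u).prod (unif (E (n + 1))) =
      ((coordHalf n).prod (unif (E (n + 1)))).map (Prod.map (fun u => -u) fun x => -x) := by
    conv_lhs => rw [← unif_map_neg]
    exact Measure.map_prod_map _ _ measurable_neg measurable_neg
  have hm : Measurable (Prod.map (fun u : ℝ => -u) fun x : E (n + 1) => -x) :=
    measurable_neg.prodMap measurable_neg
  have hz : Measurable fun p : ℝ × E (n + 1) => zon (s * p.1) θ p.2 :=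
    measurable_zon_comp (measurable_fst.const_mul s) measurable_const measurable_snd
  have h1 : ∀ p : ℝ × E (n + 1), f (zon (s * (Prod.map (fun u : ℝ => -u) (fun x => -x) p).1) θ
      (Prod.map (fun u : ℝ => -u) (fun x => -x) p).2) = f (zon (s * p.1) θ p.2) := by
    rintro ⟨u, x⟩
    simp only [Prod.map_apply, mul_neg, zon_neg, he]
  have hfm := (hf.comp_measurable hz).aestronglyMeasurable (μ :=
    ((coordHalf n).prod (unif (E (n + 1)))).map (Prod.map (fun u => -u) fun x => -x))
  rw [e]
  refine ⟨(integrable_map_measure hfm hm.aemeasurable).2 ?_, ?_⟩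
  · exact hi.congr (Eventually.of_forall fun p => (h1 p).symm)
  · exact (integral_map hm.aemeasurable hfm).trans
      (integral_congr_ae (Eventually.of_forall h1))

theorem integral_coordLaw_prod (θ : E (n + 1)) (s : ℝ) {f : E (n + 1) → 𝕜}
    (hf : StronglyMeasurable f) (he : ∀ x, f (-x) = f x)
    (hi : Integrable (fun p : ℝ × E (n + 1) => f (zon (s * p.1) θ p.2))
      ((absCoordLaw n).prod (unif (E (n + 1))))) :
    Integrable (fun p : ℝ × E (n + 1) => f (zon (s * p.1) θ p.2))
      ((coordLaw n).prod (unif (E (n + 1)))) ∧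
    ∫ p : ℝ × E (n + 1), f (zon (s * p.1) θ p.2) ∂((coordLaw n).prod (unif (E (n + 1)))) =
    ∫ p : ℝ × E (n + 1), f (zon (s * p.1) θ p.2) ∂((absCoordLaw n).prod (unif (E (n + 1)))) := by
  have e : (absCoordLaw n).prod (unif (E (n + 1))) =
      (2 : ENNReal) • (coordHalf n).prod (unif (E (n + 1))) := Measure.prod_smul_left _
  rw [e] at hi ⊢
  have hi' := (integrable_smul_measure two_ne_zero ENNReal.ofNat_ne_top).1 hi
  have h := map_neg_coordHalf_prod θ s hf he hi'
  rw [coordLaw, Measure.add_prod]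
  refine ⟨hi'.add_measure h.1, ?_⟩
  rw [integral_add_measure hi' h.1, h.2, integral_smul_measure, ENNReal.toReal_ofNat, two_smul]

/-- The equality of laws `map_dirPerp_zon`, tested on f. Evenness of f folds the symmetric law of u
onto (0, 1), where the clamp is inactive. -/
theorem funkMean_zon (hn : 2 ≤ n) {θ : E (n + 1)} (hθ : ‖θ‖ = 1) {s : ℝ} (hs0 : 0 ≤ s)
    (hs1 : s ≤ 1) {f : E (n + 1) → 𝕜} (hf : StronglyMeasurable f) (he : ∀ x, f (-x) = f x)
    (hi : Integrable (fun p : ℝ × E (n + 1) => f (zon (clamp (s * p.1)) θ p.2))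
      ((absCoordLaw n).prod (unif (E (n + 1))))) :
    Integrable (fun x => funkMean f (zon √(1 - s ^ 2) θ x)) (unif (E (n + 1))) ∧
    ∫ x, funkMean f (zon √(1 - s ^ 2) θ x) ∂(unif (E (n + 1))) =
      ∫ u, zonMean f (s * u) θ ∂(absCoordLaw n) := by
  have := isProbabilityMeasure_coordLaw hn
  have hc : ∀ᵐ p ∂((absCoordLaw n).prod (unif (E (n + 1)))),
      f (zon (clamp (s * p.1)) θ p.2) = f (zon (s * p.1) θ p.2) := by
    filter_upwards [Measure.quasiMeasurePreserving_fst.ae (ae_absCoordLaw_mem (n := n))] with p hp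
    rw [clamp_of_mem (mul_nonneg hs0 hp.1.le) (mul_le_one₀ hs1 hp.1.le hp.2.le)]
  have hi' : Integrable (fun p : ℝ × E (n + 1) => f (zon (s * p.1) θ p.2))
      ((absCoordLaw n).prod (unif (E (n + 1)))) := hi.congr hc
  have h := integral_coordLaw_prod θ s hf he hi'
  have hz : Measurable fun p : ℝ × E (n + 1) => zon (s * p.1) θ p.2 :=
    measurable_zon_comp (measurable_fst.const_mul s) measurable_const measurable_snd
  have hω : Measurable fun p : E (n + 1) × E (n + 1) => zon √(1 - s ^ 2) θ p.1 :=
    (measurable_zon_right _ θ).comp measurable_fst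
  have hd : Measurable fun p : E (n + 1) × E (n + 1) => dirPerp (zon √(1 - s ^ 2) θ p.1) p.2 :=
    measurable_dirPerp_comp hω measurable_snd
  have hmap := map_dirPerp_zon (V := E (n + 1)) finrank_euclideanSpace_fin (by omega)
    (lam := coordLaw n) (fun ω e h1 h2 h3 => map_inner_dirPerp hn h1 h2 h3) hθ hs0 hs1
  have h1 : Integrable (fun p : E (n + 1) × E (n + 1) => f (dirPerp (zon √(1 - s ^ 2) θ p.1) p.2))
      ((unif (E (n + 1))).prod (unif (E (n + 1)))) := by
    refine (integrable_map_measure hf.aestronglyMeasurable hd.aemeasurable).1 ?_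
    rw [hmap]
    exact (integrable_map_measure hf.aestronglyMeasurable hz.aemeasurable).2 h.1
  have e1 : ∫ p : E (n + 1) × E (n + 1), f (dirPerp (zon √(1 - s ^ 2) θ p.1) p.2)
      ∂((unif (E (n + 1))).prod (unif (E (n + 1)))) =
      ∫ p : ℝ × E (n + 1), f (zon (s * p.1) θ p.2) ∂((coordLaw n).prod (unif (E (n + 1)))) := by
    refine (integral_map hd.aemeasurable hf.aestronglyMeasurable).symm.trans ?_
    rw [hmap]
    exact integral_map hz.aemeasurable hf.aestronglyMeasurable
  have e2 := integral_prod _ h1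
  have e3 := integral_prod _ hi
  have e4 := integral_congr_ae hc
  have e5 := e2.symm.trans (e1.trans (h.2.trans (e4.symm.trans e3)))
  have h2 := h1.integral_prod_left
  unfold funkMean zonMean
  exact ⟨h2, e5⟩

/-- Representation of the cap means of a function agreeing almost everywhere with the Funk
transform of `f` by the zonal means of `f`. -/
theorem ae_capMean (hn : 2 ≤ n) {f φ : E (n + 1) → 𝕜} (hf : StronglyMeasurable f)
    (he : ∀ x, f (-x) = f x) (hi : Integrable f (surf (E (n + 1))))
    (hφ : ∀ᵐ x ∂(surf (E (n + 1))), φ x = funkMean f x) (ν : Measure ℝ) [IsFiniteMeasure ν]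
    (hν : ∀ᵐ s ∂ν, s ∈ Ioo (0 : ℝ) 1) :
    ∀ᵐ θ ∂(surf (E (n + 1))),
      Integrable (fun p : ℝ × ℝ => zonMean f (p.1 * p.2) θ) (ν.prod (absCoordLaw n)) ∧
      ∀ᵐ s ∂ν, Integrable (capPoint φ θ s) (greatMeasure θ) ∧
        capMean φ θ s = ∫ u, zonMean f (s * u) θ ∂(absCoordLaw n) := by
  have hn0 : n ≠ 0 := by omega
  have := nontrivial_E n
  have := isProbabilityMeasure_absCoordLaw hn
  obtain ⟨S, hS, hS1, hSφ⟩ := exists_measurableSet_of_ae hφ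
  have hsq : Measurable fun s : ℝ => √(1 - s ^ 2) := by fun_prop
  have h1 : ∀ᵐ p ∂((surf (E (n + 1))).prod (ν.prod (unif (E (n + 1))))),
      -- This holds for every finite ν, singular ones included; Lebesgue measure on (0, 1), kernel
      -- measures and point masses are all used later.
      zon (clamp √(1 - p.2.1 ^ 2)) p.1 p.2.2 ∈ S := by
    refine ae_of_ae_map (p := fun x => x ∈ S) (measurable_zonFamily hsq).aemeasurable ?_
    rw [map_zonFamily hn0 hsq ν]
    exact Measure.smul_absolutelyContinuous.ae_le hS1
  have h2 := integrable_zonFamily hn0 (measurable_fst.mul measurable_snd)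
    (ν.prod (absCoordLaw n)) hi
  filter_upwards [Measure.ae_ae_of_ae_prod h1, h2.prod_right_ae, ae_surf_norm_eq_one]
    with θ h3 h4 hθ
  refine ⟨h4.integral_prod_left, ?_⟩
  have h5 : Integrable (fun p : ℝ × ℝ × E (n + 1) => f (zon (clamp (p.1 * p.2.1)) θ p.2.2))
      (ν.prod ((absCoordLaw n).prod (unif (E (n + 1))))) :=
    ((measurePreserving_prodAssoc ν (absCoordLaw n) (unif (E (n + 1)))).integrable_comp_emb
      (MeasurableEquiv.measurableEmbedding _)).1 h4
  filter_upwards [Measure.ae_ae_of_ae_prod h3, h5.prod_right_ae, hν] with s h6 h7 hs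
  simp only [clamp_sqrt] at h6
  have h8 := funkMean_zon hn hθ hs.1.le hs.2.le hf he h7
  have hψ := stronglyMeasurable_funkMean hf
  exact ⟨(integrable_capPoint_iff hn0 hψ hS hSφ hθ hs.1.le hs.2.le h6).2 h8.1,
    (capMean_eq hn0 hψ hS hSφ hθ hs.1.le hs.2.le h6).trans h8.2⟩

end CapMean

/-! ### The inversion formulas in L¹. -/

section Inversion

variable {n : ℕ} {𝕜 : Type*} [RCLike 𝕜]

/-- Evenness in `L1Even` holds only almost everywhere, while the folding argument on single
parallels needs it at every point; symmetrizing a measurable representative repairs this. -/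
theorem exists_even_representative {d : ℕ} {f : E d → 𝕜} (hf : L1Even f) :
    ∃ f' : E d → 𝕜, StronglyMeasurable f' ∧ (∀ x, f' (-x) = f' x) ∧
      ∀ᵐ x ∂(surf (E d)), f x = f' x := by
  have hi : Integrable f (surf (E d)) := integrable_sph_iff.2 hf.1
  have he : ∀ᵐ x ∂(surf (E d)), f (-x) = f x := ae_surf_iff.2 hf.2
  have hm := hi.1.stronglyMeasurable_mk
  have h1 := hi.1.ae_eq_mk
  generalize hi.1.mk f = f₀ at hm h1
  have h2 : ∀ᵐ x ∂(surf (E d)), f (-x) = f₀ (-x) := by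
    rw [← surf_map_neg d] at h1
    exact ae_of_ae_map measurable_neg.aemeasurable h1
  refine ⟨fun x => (2⁻¹ : ℝ) • (f₀ x + f₀ (-x)), ?_, fun x => ?_, ?_⟩
  · exact (hm.add (hm.comp_measurable measurable_neg)).const_smul _
  · simp only [neg_neg, add_comm]
  · filter_upwards [h1, h2, he] with x h3 h4 h5
    rw [← h3, ← h4, h5, ← two_smul ℝ (f x), smul_smul, inv_mul_cancel₀ two_ne_zero, one_smul]

theorem ae_funk_eq_funkMean (hn : n ≠ 0) {f f' : E (n + 1) → 𝕜} (hf' : StronglyMeasurable f')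
    (h : ∀ᵐ x ∂(surf (E (n + 1))), f x = f' x) :
    ∀ᵐ ω ∂(surf (E (n + 1))), funk f ω = funkMean f' ω := by
  filter_upwards [ae_greatLaw_of_ae hn h, ae_surf_norm_eq_one] with ω h1 hω
  rw [funk, average_greatMeasure hn hω f, integral_congr_ae h1, greatLaw,
    integral_map (measurable_dirPerp_right ω).aemeasurable hf'.aestronglyMeasurable, funkMean]

/-- The `L¹`-limit for a family given by iterated integrals of zonal means. -/
theorem hasL1Limit_of_abelInt (hn : n ≠ 0) {f f' : E (n + 1) → 𝕜}
    (hf' : Integrable f' (surf (E (n + 1)))) (hff' : ∀ᵐ x ∂(surf (E (n + 1))), f x = f' x)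
    {p p' c : ℝ → ℝ} (hp : ∀ t, HasDerivAt p (p' t) t) (hp' : ∀ i : ℕ, ContDiff ℝ i p')
    {D : (ℝ → Lp 𝕜 1 (sphMeasure (n + 1))) → ℝ → Lp 𝕜 1 (sphMeasure (n + 1))}
    (hD : ∀ w t, D w t = c t • deriv w t) (hc : ∀ t ∈ Ioo (0 : ℝ) 1, c t * p' t = 1)
    (hc1 : ContinuousAt c 1) {k : ℕ} {a : ℝ} (ha : a * (k.factorial : ℝ) * c 1 = 1)
    {w : E (n + 1) → ℝ → 𝕜}
    (hw : ∀ t ∈ Ioo (0 : ℝ) 1, ∀ᵐ θ ∂(surf (E (n + 1))),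
      w θ t = a • ∫ v in (0 : ℝ)..t, (p t - p v) ^ k • zonMean f' v θ) :
    HasL1Limit (k + 1) D w f := by
  have hpc : Continuous p := continuous_iff_continuousAt.2 fun t => (hp t).continuousAt
  have hm := continuous_zonLp hn hf'
  refine ⟨fun t => a • abelInt p k (zonLp hn hf') t, zonLp hn hf' 1, fun t ht => ?_, ?_, ?_, ?_⟩
  · have hκ : Continuous fun v => (p t - p v) ^ k := by fun_prop
    filter_upwards [ae_surf_iff.1 (hw t ht), integral_zonLp_coeFn hn hf' hκ ht.1.le,
      Lp.coeFn_smul a (abelInt p k (zonLp hn hf') t)] with θ h1 h2 h3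
    rw [h1, h3, Pi.smul_apply, ← h2]
    rfl
  · filter_upwards [coeFn_zonLp hn hf' 1, ae_surf_iff.1 hff'] with θ h1 h2
    rw [h1, zonMean_one, h2]
  · exact ((contDiff_abelInt hp hp' hm k).const_smul a).contDiffOn
  · have h1 : Tendsto (fun t => (a * (k.factorial : ℝ) * c t) • zonLp hn hf' t) (𝓝[<] 1)
        (𝓝 (zonLp hn hf' 1)) := by
      have h2 : ContinuousAt (fun t => (a * (k.factorial : ℝ) * c t) • zonLp hn hf' t) 1 :=
        (continuousAt_const.mul hc1).smul hm.continuousAt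
      have h3 := h2.tendsto
      rw [ha, one_smul] at h3
      exact h3.mono_left nhdsWithin_le_nhds
    refine h1.congr' ?_
    filter_upwards [Ioo_mem_nhdsLT (zero_lt_one (α := ℝ))] with t ht
      using (iterate_abelInt hp hm hD hc k a ht).symm

theorem integrable_kernelMeasure_iff {t : ℝ} (ht : 0 ≤ t) {k : ℝ → ℝ} (hk : Measurable k)
    (hk0 : ∀ s ∈ Ioo 0 t, 0 ≤ k s) {F : ℝ → 𝕜} :
    Integrable F (kernelMeasure t k) ↔ IntervalIntegrable (fun s => k s • F s) volume 0 t := by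
  rw [kernelMeasure, integrable_withDensity_iff_integrable_smul' hk.ennreal_ofReal
    (Eventually.of_forall fun _ => ENNReal.ofReal_lt_top),
    intervalIntegrable_iff_integrableOn_Ioo_of_le ht, IntegrableOn]
  refine integrable_congr ?_
  filter_upwards [ae_restrict_mem measurableSet_Ioo] with s hs
  rw [ENNReal.toReal_ofReal (hk0 s hs)]

theorem integral_kernelMeasure {t : ℝ} (ht : 0 ≤ t) {k : ℝ → ℝ} (hk : Measurable k)
    (hk0 : ∀ s ∈ Ioo 0 t, 0 ≤ k s) (F : ℝ → 𝕜) :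
    ∫ s, F s ∂(kernelMeasure t k) = ∫ s in (0 : ℝ)..t, k s • F s := by
  rw [kernelMeasure, integral_withDensity_eq_integral_toReal_smul hk.ennreal_ofReal
    (Eventually.of_forall fun _ => ENNReal.ofReal_lt_top),
    intervalIntegral.integral_of_le ht, integral_Ioc_eq_integral_Ioo]
  refine integral_congr_ae ?_
  filter_upwards [ae_restrict_mem measurableSet_Ioo] with s hs
  rw [ENNReal.toReal_ofReal (hk0 s hs)]

theorem ae_kernelMeasure_mem {t : ℝ} (k : ℝ → ℝ) : ∀ᵐ s ∂(kernelMeasure t k), s ∈ Ioo 0 t :=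
  (withDensity_absolutelyContinuous _ _).ae_le (ae_restrict_mem measurableSet_Ioo)

theorem isFiniteMeasure_kernelMeasure {t : ℝ} {K : ℝ → ℝ} (hK : Continuous K) :
    IsFiniteMeasure (kernelMeasure t K) := by
  obtain ⟨C, hC⟩ := (isCompact_Icc (a := (0 : ℝ)) (b := t)).exists_bound_of_continuousOn
    hK.continuousOn
  refine ⟨?_⟩
  rw [kernelMeasure, withDensity_apply _ .univ, Measure.restrict_univ]
  refine (setLIntegral_mono measurable_const fun s hs => ENNReal.ofReal_le_ofReal
    ((le_abs_self _).trans (hC s (Ioo_subset_Icc_self hs)))).trans_lt ?_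
  rw [setLIntegral_const]
  exact ENNReal.mul_lt_top ENNReal.ofReal_lt_top measure_Ioo_lt_top

/-- The integrals of the cap means against a kernel `k` are integrals of zonal means against a
kernel `K`. -/
theorem ae_integral_capMean (hn : 2 ≤ n) {f φ : E (n + 1) → 𝕜} (hf : StronglyMeasurable f)
    (he : ∀ x, f (-x) = f x) (hi : Integrable f (surf (E (n + 1))))
    (hφ : ∀ᵐ x ∂(surf (E (n + 1))), φ x = funkMean f x) {t : ℝ} (ht : t ∈ Ioo (0 : ℝ) 1)
    {k K : ℝ → ℝ} (hk : Measurable k) (hk0 : ∀ s ∈ Ioo 0 t, 0 ≤ k s) (hKc : Continuous K)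
    (hK0 : ∀ s ∈ Ioo 0 t, 0 ≤ K s)
    (hK : ∀ v ∈ Ioo 0 t, ∫⁻ s in Ioo v t,
      ENNReal.ofReal (k s * (2 * (coordDensity n (v / s) / s))) = ENNReal.ofReal (K v)) :
    ∀ᵐ θ ∂(surf (E (n + 1))),
      IntervalIntegrable (fun s => k s • capMean φ θ s) volume 0 t ∧
      ∫ s in (0 : ℝ)..t, k s • capMean φ θ s = ∫ v in (0 : ℝ)..t, K v • zonMean f v θ := by
  have := isProbabilityMeasure_absCoordLaw hn
  have hmul : Measurable fun p : ℝ × ℝ => p.1 * p.2 := measurable_mul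
  have hmap : ((kernelMeasure t k).prod (absCoordLaw n)).map (fun p => p.1 * p.2) =
      kernelMeasure t K := map_mul_kernelMeasure hk hk0 hK
  -- The kernel k may be unbounded near t (as for n = 2). Finiteness comes from its image, which has
  -- the continuous density K and the same mass.
  have hfin : IsFiniteMeasure (kernelMeasure t k) := by
    refine ⟨?_⟩
    have h1 := (isFiniteMeasure_kernelMeasure (t := t) hKc).measure_univ_lt_top
    rwa [← hmap, Measure.map_apply hmul .univ, preimage_univ, ← univ_prod_univ,
      Measure.prod_prod, measure_univ (μ := absCoordLaw n), mul_one] at h1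
  have hmem : ∀ᵐ s ∂(kernelMeasure t k), s ∈ Ioo (0 : ℝ) 1 :=
    (ae_kernelMeasure_mem k).mono fun s hs => ⟨hs.1, hs.2.trans ht.2⟩
  filter_upwards [ae_capMean hn hf he hi hφ (kernelMeasure t k) hmem] with θ hθ
  obtain ⟨h1, h2⟩ := hθ
  have h3 : (fun s => ∫ u, zonMean f (s * u) θ ∂(absCoordLaw n)) =ᵐ[kernelMeasure t k]
      capMean φ θ := h2.mono fun s hs => hs.2.symm
  have h4 : Integrable (fun s => ∫ u, zonMean f (s * u) θ ∂(absCoordLaw n)) (kernelMeasure t k) :=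
    h1.integral_prod_left
  refine ⟨(integrable_kernelMeasure_iff ht.1.le hk hk0).1 (h4.congr h3), ?_⟩
  rw [← integral_kernelMeasure ht.1.le hk hk0, ← integral_congr_ae h3, ← integral_prod _ h1,
    ← integral_kernelMeasure ht.1.le hKc.measurable hK0, ← hmap]
  exact (integral_map hmul.aemeasurable
    (stronglyMeasurable_zonMean hf θ).aestronglyMeasurable).symm

theorem ae_integrable_capPoint (hn : 2 ≤ n) {f φ : E (n + 1) → 𝕜} (hf : StronglyMeasurable f)
    (he : ∀ x, f (-x) = f x) (hi : Integrable f (surf (E (n + 1))))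
    (hφ : ∀ᵐ x ∂(surf (E (n + 1))), φ x = funkMean f x) :
    ∀ᵐ θ : Sph (n + 1) ∂(sphMeasure (n + 1)), ∀ᵐ s : ℝ, s ∈ Ioo (0 : ℝ) 1 →
      Integrable (capPoint φ (θ : E (n + 1)) s) (greatMeasure (θ : E (n + 1))) := by
  filter_upwards [ae_surf_iff.1 (ae_capMean hn hf he hi hφ (volume.restrict (Ioo 0 1))
    (ae_restrict_mem measurableSet_Ioo))] with θ hθ
  exact (ae_restrict_iff' measurableSet_Ioo).1 (hθ.2.mono fun s hs => hs.1)

/-- `ae_capMean` for the point mass at t, which yields the representation at each given t rather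
than at almost every one. -/
theorem ae_capMean_apply (hn : 2 ≤ n) {f φ : E (n + 1) → 𝕜} (hf : StronglyMeasurable f)
    (he : ∀ x, f (-x) = f x) (hi : Integrable f (surf (E (n + 1))))
    (hφ : ∀ᵐ x ∂(surf (E (n + 1))), φ x = funkMean f x) {t : ℝ} (ht : t ∈ Ioo (0 : ℝ) 1) :
    ∀ᵐ θ ∂(surf (E (n + 1))), Integrable (capPoint φ θ t) (greatMeasure θ) ∧
      capMean φ θ t = ∫ v in (0 : ℝ)..t, (2 * (coordDensity n (v / t) / t)) • zonMean f v θ := by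
  have hm : ∀ᵐ s ∂(Measure.dirac t), s ∈ Ioo (0 : ℝ) 1 := by
    rw [ae_dirac_eq]; exact ht
  filter_upwards [ae_capMean hn hf he hi hφ (Measure.dirac t) hm] with θ hθ
  have h1 := hθ.2
  rw [ae_dirac_eq] at h1
  refine ⟨h1.1, ?_⟩
  have hk : Measurable fun v => 2 * (coordDensity n (v / t) / t) :=
    (((measurable_coordDensity n).comp (measurable_id.div_const t)).div_const t).const_mul 2
  rw [h1.2, ← integral_kernelMeasure ht.1.le hk, ← map_mul_coordHalf ht.1]
  · exact (integral_map (measurable_const_mul t).aemeasurable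
      (stronglyMeasurable_zonMean hf θ).aestronglyMeasurable).symm
  · intro v hv
    have h2 : 0 ≤ 1 - (v / t) ^ 2 := by
      rw [div_pow, sub_nonneg, div_le_one (pow_pos ht.1 2)]
      nlinarith [hv.1, hv.2]
    have h3 := (coordConst_pos hn).le
    rw [coordDensity_eq]
    exact mul_nonneg zero_le_two (div_nonneg (mul_nonneg h3 (Real.rpow_nonneg h2 _)) ht.1.le)

theorem funkInversionI (hn : 2 ≤ n) {f φ : E (n + 1) → 𝕜} (hf : L1Even f)
    (hφ : ∀ᵐ x ∂(surf (E (n + 1))), φ x = funk f x) : FunkInversionI n φ f := by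
  have hn0 : n ≠ 0 := by omega
  obtain ⟨f', hm, he, hff'⟩ := exists_even_representative hf
  have hi : Integrable f' (surf (E (n + 1))) := (integrable_sph_iff.2 hf.1).congr hff'
  have hφ' : ∀ᵐ x ∂(surf (E (n + 1))), φ x = funkMean f' x := by
    filter_upwards [hφ, ae_funk_eq_funkMean hn0 hm hff'] with x h1 h2 using h1.trans h2
  have key : ∀ t ∈ Ioo (0 : ℝ) 1, ∀ᵐ θ ∂(surf (E (n + 1))),
      IntervalIntegrable (fun s => ((t ^ 2 - s ^ 2) ^ (((n : ℝ) - 3) / 2) * s ^ (n - 1)) •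
        capMean φ θ s) volume 0 t ∧
      ∫ s in (0 : ℝ)..t, ((t ^ 2 - s ^ 2) ^ (((n : ℝ) - 3) / 2) * s ^ (n - 1)) • capMean φ θ s =
        ∫ v in (0 : ℝ)..t, ((t ^ 2 - v ^ 2) / 2) ^ (n - 2) • zonMean f' v θ := by
    intro t ht
    refine ae_integral_capMean hn hm he hi hφ' ht (by fun_prop) (fun s hs => ?_) (by fun_prop)
      (fun s hs => ?_) fun v hv => kernel_one hn hv
    · have : 0 ≤ t ^ 2 - s ^ 2 := by nlinarith [hs.1, hs.2]
      have := hs.1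
      positivity
    · have : 0 ≤ t ^ 2 - s ^ 2 := by nlinarith [hs.1, hs.2]
      positivity
  refine ⟨ae_integrable_capPoint hn hm he hi hφ', fun t ht =>
    ae_surf_iff.1 ((key t ht).mono fun θ h => h.1), ?_⟩
  obtain ⟨j, rfl⟩ : ∃ j, n = j + 2 := ⟨n - 2, by omega⟩
  have hj : ((j.factorial : ℕ) : ℝ) ≠ 0 := by positivity
  -- The factor 2^(n-1)/(n-2)! loses 2^(n-2) to the kernel ((t² - v²)/2)^(n-2), hence a = 2/j!; with
  -- c(1) = 1/2 this gives a · j! · c(1) = 1.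
  refine hasL1Limit_of_abelInt (p := fun t => t ^ 2) (p' := fun t => 2 * t)
    (c := fun t => 1 / (2 * t)) (k := j) (a := 2 / j.factorial) hn0 hi hff' (fun t => ?_)
    (fun i => by fun_prop) (fun w t => rfl) (fun t ht => ?_) ?_ ?_ fun t ht => ?_
  · simpa using hasDerivAt_pow 2 t
  · have := ht.1.ne'
    field_simp
  · exact ContinuousAt.div continuousAt_const (by fun_prop) (by norm_num)
  · field_simp
  · filter_upwards [key t ht] with θ h
    rw [h.2]
    simp only [Nat.add_sub_cancel, show j + 2 - 1 = j + 1 by omega]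
    rw [← intervalIntegral.integral_smul, ← intervalIntegral.integral_smul]
    refine intervalIntegral.integral_congr fun v _ => ?_
    simp only [smul_smul]
    congr 1
    rw [div_pow, pow_succ]
    field_simp

theorem funkInversionIII (hn : 2 ≤ n) {f φ : E (n + 1) → 𝕜} (hf : L1Even f)
    (hφ : ∀ᵐ x ∂(surf (E (n + 1))), φ x = funk f x) : FunkInversionIII n φ f := by
  have hn0 : n ≠ 0 := by omega
  obtain ⟨f', hm, he, hff'⟩ := exists_even_representative hf
  have hi : Integrable f' (surf (E (n + 1))) := (integrable_sph_iff.2 hf.1).congr hff'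
  have hφ' : ∀ᵐ x ∂(surf (E (n + 1))), φ x = funkMean f' x := by
    filter_upwards [hφ, ae_funk_eq_funkMean hn0 hm hff'] with x h1 h2 using h1.trans h2
  have key : ∀ t ∈ Ioo (0 : ℝ) 1, ∀ᵐ θ ∂(surf (E (n + 1))),
      IntervalIntegrable (fun s => ((t ^ 2 - s ^ 2) ^ (((n : ℝ) - 3) / 2) * s) •
        capMean φ θ s) volume 0 t ∧
      ∫ s in (0 : ℝ)..t, ((t ^ 2 - s ^ 2) ^ (((n : ℝ) - 3) / 2) * s) • capMean φ θ s =
        ∫ v in (0 : ℝ)..t, (t - v) ^ (n - 2) • zonMean f' v θ := by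
    intro t ht
    refine ae_integral_capMean hn hm he hi hφ' ht (by fun_prop) (fun s hs => ?_) (by fun_prop)
      (fun s hs => ?_) fun v hv => kernel_two hn hv
    · have : 0 ≤ t ^ 2 - s ^ 2 := by nlinarith [hs.1, hs.2]
      have := hs.1
      positivity
    · have : 0 ≤ t - s := sub_nonneg.2 hs.2.le
      positivity
  refine ⟨ae_integrable_capPoint hn hm he hi hφ', fun t ht =>
    ae_surf_iff.1 ((key t ht).mono fun θ h => h.1), ?_⟩
  obtain ⟨j, rfl⟩ : ∃ j, n = j + 2 := ⟨n - 2, by omega⟩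
  have hj : ((j.factorial : ℕ) : ℝ) ≠ 0 := by positivity
  refine hasL1Limit_of_abelInt (p := fun t => t) (p' := fun _ => 1)
    (c := fun _ => 1) (k := j) (a := 1 / j.factorial) hn0 hi hff' hasDerivAt_id'
    (fun i => contDiff_const) (fun w t => (one_smul ℝ _).symm) (fun t ht => one_mul 1)
    continuousAt_const ?_ fun t ht => ?_
  · field_simp
  · filter_upwards [key t ht] with θ h
    rw [h.2]
    rfl

theorem funkInversionII (hn : 2 ≤ n) (hodd : Odd n) {f φ : E (n + 1) → 𝕜} (hf : L1Even f)
    (hφ : ∀ᵐ x ∂(surf (E (n + 1))), φ x = funk f x) : FunkInversionII n φ f := by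
  have hn0 : n ≠ 0 := by omega
  obtain ⟨f', hm, he, hff'⟩ := exists_even_representative hf
  have hi : Integrable f' (surf (E (n + 1))) := (integrable_sph_iff.2 hf.1).congr hff'
  have hφ' : ∀ᵐ x ∂(surf (E (n + 1))), φ x = funkMean f' x := by
    filter_upwards [hφ, ae_funk_eq_funkMean hn0 hm hff'] with x h1 h2 using h1.trans h2
  have key : ∀ t ∈ Ioo (0 : ℝ) 1, _ := fun t ht => ae_capMean_apply hn hm he hi hφ' ht
  refine ⟨fun t ht => ae_surf_iff.1 ((key t ht).mono fun θ h => h.1), ?_⟩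
  -- For odd n the exponent (n - 3)/2 is the integer j, so Φ_θ is already an iterated integral in t²
  -- and no outer Abel integral is needed.
  obtain ⟨j, rfl⟩ : ∃ j, n = 2 * j + 3 := by
    obtain ⟨m, rfl⟩ := hodd
    exact ⟨m - 1, by omega⟩
  have hexp : (((2 * j + 3 : ℕ) : ℝ) - 3) / 2 = j := by push_cast; ring
  have hc := sphArea_pos (n := 2 * j + 3) (by omega)
  have hc' := sphArea_pos (n := 2 * j + 2) (by omega)
  have hG : 0 < Real.Gamma (((2 * j + 3 : ℕ) : ℝ) / 2) := Real.Gamma_pos_of_pos (by positivity)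
  have hG' : Real.Gamma (((2 * j + 2 : ℕ) : ℝ) / 2) = j.factorial := by
    rw [← Real.Gamma_nat_eq_factorial]
    congr 1
    push_cast
    ring
  have hj : ((j.factorial : ℕ) : ℝ) ≠ 0 := by positivity
  rw [show (2 * j + 3 - 1) / 2 = j + 1 by omega]
  -- The power t^(n-2) = t^(2j+1) clears t in t⁻¹(1 - v²/t²)^j and leaves (t² - v²)^j. The condition
  -- on `a` reduces to the values of the two areas, with Γ((n-1)/2) = j!.
  refine hasL1Limit_of_abelInt (p := fun t => t ^ 2) (p' := fun t => 2 * t)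
    (c := fun t => 1 / (2 * t)) (k := j) (a := √Real.pi / Real.Gamma (((2 * j + 3 : ℕ) : ℝ) / 2) *
      (2 * (sphArea (2 * j + 2) / sphArea (2 * j + 3)))) hn0 hi hff' (fun t => ?_)
    (fun i => by fun_prop) (fun w t => rfl) (fun t ht => ?_) ?_ ?_ fun t ht => ?_
  · simpa using hasDerivAt_pow 2 t
  · have := ht.1.ne'
    field_simp
  · exact ContinuousAt.div continuousAt_const (by fun_prop) (by norm_num)
  · have hpi : Real.pi ^ (((2 * j + 3 : ℕ) : ℝ) / 2) =
        √Real.pi * Real.pi ^ (((2 * j + 2 : ℕ) : ℝ) / 2) := by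
      rw [Real.sqrt_eq_rpow, ← Real.rpow_add Real.pi_pos]
      congr 1
      push_cast
      ring
    have h1 : (0 : ℝ) < Real.pi ^ (((2 * j + 2 : ℕ) : ℝ) / 2) := Real.rpow_pos_of_pos Real.pi_pos _
    have h2 : 0 < √Real.pi := Real.sqrt_pos.2 Real.pi_pos
    simp only [sphArea]
    rw [hpi, hG']
    field_simp
  · filter_upwards [key t ht] with θ h
    have ht0 := ht.1
    rw [h.2, ← intervalIntegral.integral_smul, ← intervalIntegral.integral_smul]
    refine intervalIntegral.integral_congr fun v _ => ?_
    simp only [smul_smul]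
    congr 1
    rw [coordDensity, hexp, Real.rpow_natCast, show 2 * j + 3 - 1 = 2 * j + 2 by omega,
      show 2 * j + 3 - 2 = 2 * j + 1 by omega]
    have h3 : t ^ 2 - v ^ 2 = t ^ 2 * (1 - (v / t) ^ 2) := by field_simp
    rw [h3, mul_pow, ← pow_mul, pow_succ]
    field_simp

/-- The third inversion formula determines the function. -/
theorem ae_eq_of_funkInversionIII {φ f₁ f₂ : E (n + 1) → 𝕜} (h₁ : FunkInversionIII n φ f₁)
    (h₂ : FunkInversionIII n φ f₂) :
    ∀ᵐ θ : Sph (n + 1) ∂(sphMeasure (n + 1)), f₁ θ = f₂ θ := by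
  obtain ⟨-, -, W₁, L₁, a₁, b₁, -, d₁⟩ := h₁
  obtain ⟨-, -, W₂, L₂, a₂, b₂, -, d₂⟩ := h₂
  have hW : EqOn W₁ W₂ (Ioo 0 1) := by
    intro t ht
    refine Lp.ext ?_
    filter_upwards [a₁ t ht, a₂ t ht] with θ e₁ e₂ using e₁.trans e₂.symm
  have hI := eqOn_iterate_of_eqOn (D := deriv) (c := fun _ => 1)
    (fun w t => (one_smul ℝ _).symm) hW (n - 1)
  have hL : L₁ = L₂ := by
    refine tendsto_nhds_unique (d₁.congr' ?_) d₂
    filter_upwards [Ioo_mem_nhdsLT (zero_lt_one (α := ℝ))] with t ht using hI ht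
  subst hL
  filter_upwards [b₁, b₂] with θ e₁ e₂ using e₁.symm.trans e₂

end Inversion

end FunkRadon
end

/-! ### The main theorem. -/

theorem mainTheorem12 {𝕜 : Type*} [RCLike 𝕜] (n : ℕ) (hn : 2 ≤ n)
    (g : FunkRadon.E n → 𝕜) (hg : AEStronglyMeasurable g volume)
    (hint : Integrable (fun x : FunkRadon.E n => ‖g x‖ / √(1 + ‖x‖ ^ 2)) volume) :
    FunkRadon.L1Even (FunkRadon.opB g) ∧
    (∀ η ∈ FunkRadon.Sph n, ∀ t : ℝ,
      (FunkRadon.PlaneIntegrable g η t ↔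
        FunkRadon.GreatIntegrable (FunkRadon.opB g) (FunkRadon.muTilde η t)) ∧
      FunkRadon.radon g η t = FunkRadon.opA (FunkRadon.funk (FunkRadon.opB g)) η t) ∧
    (∀ᵐ τ : FunkRadon.Sph n × ℝ ∂((FunkRadon.sphMeasure n).prod volume),
      FunkRadon.PlaneIntegrable g τ.1 τ.2) ∧
    ∃ f : FunkRadon.E (n + 1) → 𝕜,
      -- `f = F⁻¹A⁻¹Rg`: the only element of `L¹_even` whose Funk transform is `A⁻¹Rg`
      (FunkRadon.L1Even f ∧
        (∀ᵐ ω : FunkRadon.Sph (n + 1) ∂(FunkRadon.sphMeasure (n + 1)),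
          FunkRadon.funk f ω = FunkRadon.opAinv (FunkRadon.radon g) ω) ∧
        ∀ f₁ : FunkRadon.E (n + 1) → 𝕜, FunkRadon.L1Even f₁ →
          (∀ᵐ ω : FunkRadon.Sph (n + 1) ∂(FunkRadon.sphMeasure (n + 1)),
            FunkRadon.funk f₁ ω = FunkRadon.opAinv (FunkRadon.radon g) ω) →
          ∀ᵐ θ : FunkRadon.Sph (n + 1) ∂(FunkRadon.sphMeasure (n + 1)), f₁ θ = f θ) ∧
      -- explicit evaluation of `F⁻¹`
      FunkRadon.FunkInversionI n (FunkRadon.opAinv (FunkRadon.radon g)) f ∧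
      (Odd n → FunkRadon.FunkInversionII n (FunkRadon.opAinv (FunkRadon.radon g)) f) ∧
      FunkRadon.FunkInversionIII n (FunkRadon.opAinv (FunkRadon.radon g)) f ∧
      -- `g = B⁻¹F⁻¹A⁻¹Rg`
      (∀ᵐ x : FunkRadon.E n, FunkRadon.opBinv f x = g x) := by
  have hn0 : n ≠ 0 := by omega
  have hB := FunkRadon.integrable_surf_opB g hg hint
  have hL : FunkRadon.L1Even (FunkRadon.opB g) :=
    ⟨FunkRadon.integrable_sph_iff.1 hB, Eventually.of_forall fun θ => FunkRadon.opB_neg g θ⟩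
  have hF := FunkRadon.opAinv_radon_ae hn0 g
  -- The witness is f = Bg: its Funk transform is A⁻¹Rg almost everywhere by `hF`, and B⁻¹B is the
  -- identity at every point.
  refine ⟨hL, fun η hη t => ?_, ?_, FunkRadon.opB g, ⟨hL, ?_, fun f₁ hf₁ h₁ => ?_⟩,
    FunkRadon.funkInversionI hn hL hF, fun hodd => FunkRadon.funkInversionII hn hodd hL hF,
    FunkRadon.funkInversionIII hn hL hF, Eventually.of_forall fun x => FunkRadon.opBinv_opB g x⟩
  · have hη' : ‖η‖ = 1 := mem_sphere_zero_iff_norm.1 hη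
    exact ⟨FunkRadon.planeIntegrable_iff hn0 g hη' t, FunkRadon.radon_eq_opA hn0 g hη' t⟩
  · filter_upwards [FunkRadon.ae_muTilde_of_ae (FunkRadon.ae_integrable_greatLaw hn0 hB)]
      with τ hτ
    have hη : ‖(τ.1 : FunkRadon.E n)‖ = 1 := mem_sphere_zero_iff_norm.1 τ.1.2
    exact (FunkRadon.planeIntegrable_iff hn0 g hη τ.2).2
      ((FunkRadon.integrable_greatMeasure_iff hn0 (FunkRadon.norm_muTilde hη τ.2)).2 hτ)
  · exact FunkRadon.ae_surf_iff.1 (hF.mono fun ω h => h.symm)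
  -- Any competitor satisfies the same inversion formula with the same φ, and that formula
  -- determines its limit for n of either parity.
  · refine FunkRadon.ae_eq_of_funkInversionIII (FunkRadon.funkInversionIII hn hf₁ ?_)
      (FunkRadon.funkInversionIII hn hL hF)
    exact FunkRadon.ae_surf_iff.2 (h₁.mono fun ω h => h.symm)
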